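/- Let $M$ be a smooth (Hausdorff, second countable) manifold of dimension $n$ and $x_0\in M$. For a vector space $V$ write $V((\nu))$ for the formal Laurent series in $\nu$ with coefficients in $V$; functions are smooth and complex-valued, $C^\infty(M)=C^\infty(M,\mathbb C)$. Let $\varphi=\nu^{-1}\varphi_{-1}+\varphi_0+\nu\varphi_1+\dots\in C^\infty(M)((\nu))$ be a formal phase function at $x_0$, which means that $x_0$ is a nondegenerate critical point of $\varphi_{-1}$ (the complex Hessian matrix of $\varphi_{-1}$ at $x_0$ is invertible) with zero critical value $\varphi_{-1}(x_0)=0$. Let $\rho=\rho_0+\nu\rho_1+\dots$ be a formal volume form, that is, a formal power series of smooth complex-valued $n$-forms on $M$, such that $\rho_0$ does not vanish at $x_0$. A formal distribution supported at $x_0$ is a series $\Lambda=\Lambda_0+\nu\Lambda_1+\dots$ of distributions $\Lambda_r$ on $M$ supported at $x_0$; it acts $\nu$-linearly by $\Lambda\big(\sum_s\nu^sf_s\big)=\sum_k\nu^k\sum_{r+s=k}\Lambda_r(f_s)\in\mathbb C((\nu))$ on $f=\sum_s\nu^sf_s\in C^\infty(M)((\nu))$, and it can be applied to formal functions that are defined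 only near $x_0$. It is called a formal oscillatory integral (FOI) at $x_0$ associated with $(\varphi,\rho)$ if $\Lambda_0\neq0$ and $$\Lambda\big(vf+(v\varphi+\mathrm{div}_\rho v)f\big)=0$$ for all vector fields $v$ on $M$ and all $f\in C^\infty(M)((\nu))$, where $\mathrm{div}_\rho v=(\mathbb L_v\rho)/\rho$ near $x_0$ and $\mathbb L_v$ is the Lie derivative. It is strongly associated with $(\varphi,\rho)$ if it is associated with $(\varphi,\rho)$ and moreover $$\frac{d}{d\nu}\Lambda(f)-\Lambda\left(\frac{df}{d\nu}+\Big(\frac{d\varphi}{d\nu}+\frac{du}{d\nu}-\frac{n}{2\nu}\Big)f\right)=0$$ for all $f\in C^\infty(M)((\nu))$, where $\rho=e^{u}\,dx^1\wedge\dots\wedge dx^n$ in local coordinates near $x_0$, so that $\frac{du}{d\nu}=\frac{d\rho}{d\nu}\big/\rho$ does not depend on the coordinates. Then: 1. There exists a FOI $\Lambda$ at $x_0$ strongly associated with $(\varphi,\rho)$. 2. It is determined up to a nonzero multiplicative constant from $\mathbb C$: if $\Lambda$ is a FOI strongly associated with $(\varphi,\rho)$, then the FOIs strongly associated with $(\varphi,\rho)$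 are exactly the $c\Lambda$ with $c\in\mathbb C$, $c\neq0$. 3. There is a unique FOI $\Lambda$ strongly associated with $(\varphi,\rho)$ whose leading term is the Dirac distribution, $\Lambda_0=\delta_{x_0}$. 4. If a FOI $\Lambda$ strongly associated with $(\varphi,\rho)$ is also strongly associated with $(\hat\varphi,\rho)$, where $\hat\varphi=\nu^{-1}\hat\varphi_{-1}+\hat\varphi_0+\dots$ is another formal phase function at $x_0$, then the full jet of $\varphi-\hat\varphi$ at $x_0$ is a constant from $\mathbb C$: there is $c\in\mathbb C$ such that for every power of $\nu$ the coefficient of $\varphi-\hat\varphi-c$ has vanishing full jet at $x_0$. -/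

import Mathlib

open scoped Manifold ContDiff Topology LaurentSeries

noncomputable section

namespace FOI

/-- The `ℂ`-algebra `C^∞(M)` of smooth complex-valued functions on a manifold `M` of dimension
`n`. -/
def SmoothFun (n : ℕ) (M : Type*) [TopologicalSpace M]
    [ChartedSpace (EuclideanSpace ℝ (Fin n)) M] : Subalgebra ℂ (M → ℂ) where
  carrier := {f | ContMDiff (𝓡 n) 𝓘(ℝ, ℂ) ∞ f}
  mul_mem' ha hb :=
    (contDiff_mul (𝕜 := ℝ) (𝔸 := ℂ)).contMDiff.comp (ContMDiff.prodMk_space ha hb)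
  add_mem' ha hb := (contDiff_add (𝕜 := ℝ) (F := ℂ)).contMDiff.comp (ContMDiff.prodMk_space ha hb)
  algebraMap_mem' _ := contMDiff_const

/-- Smooth (real) vector fields on `M`, as smooth sections of the tangent bundle. -/
abbrev SmoothVF (n : ℕ) (M : Type*) [TopologicalSpace M]
    [ChartedSpace (EuclideanSpace ℝ (Fin n)) M] [IsManifold (𝓡 n) ∞ M] :=
  Cₛ^∞⟮𝓡 n; EuclideanSpace ℝ (Fin n), (TangentSpace (𝓡 n) : M → Type _)⟯

/-- Smooth complex-valued differential forms of top degree `n` on `M`: an alternating form on each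
tangent space whose values on smooth vector fields are smooth functions. -/
structure TopForm (n : ℕ) (M : Type*) [TopologicalSpace M]
    [ChartedSpace (EuclideanSpace ℝ (Fin n)) M] [IsManifold (𝓡 n) ∞ M] where
  form : ∀ x : M, (TangentSpace (𝓡 n) x) [⋀^Fin n]→ₗ[ℝ] ℂ
  smooth : ∀ w : Fin n → SmoothVF n M,
    ContMDiff (𝓡 n) 𝓘(ℝ, ℂ) ∞ (fun x => form x (fun i => w i x))

/-- A formal distribution `Λ = Λ₀ + ν Λ₁ + …`, given by its components; the conditions on the
components are in `IsPointDistribution`. -/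
abbrev FormalFunctional (n : ℕ) (M : Type*) [TopologicalSpace M]
    [ChartedSpace (EuclideanSpace ℝ (Fin n)) M] :=
  ℕ → (SmoothFun n M →ₗ[ℂ] ℂ)

section
variable {n : ℕ} {M : Type*} [TopologicalSpace M] [ChartedSpace (EuclideanSpace ℝ (Fin n)) M]

/-- The function `f` read in the preferred chart at `x₀`. -/
def inChart (x₀ : M) (f : M → ℂ) : EuclideanSpace ℝ (Fin n) → ℂ :=
  fun y => f ((extChartAt (𝓡 n) x₀).symm y)

/-- The full jet of `f` at `x₀` is zero: all the partial derivatives of `f`, of all orders `≥ 0`,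
vanish at `x₀`. -/
def JetVanishes (x₀ : M) (f : SmoothFun n M) : Prop :=
  ∀ m : ℕ, iteratedFDeriv ℝ m (inChart (n := n) x₀ f) (extChartAt (𝓡 n) x₀ x₀) = 0

/-- The Hessian matrix of `f` at `x₀` in the preferred chart. -/
def hessian (x₀ : M) (f : SmoothFun n M) : Matrix (Fin n) (Fin n) ℂ :=
  Matrix.of fun k l =>
    fderiv ℝ (fderiv ℝ (inChart (n := n) x₀ f)) (extChartAt (𝓡 n) x₀ x₀)
      (EuclideanSpace.single k 1) (EuclideanSpace.single l 1)

/-- `x₀` is a nondegenerate critical point of `f`. -/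
def IsNondegenerateCritical (x₀ : M) (f : SmoothFun n M) : Prop :=
  mfderiv (𝓡 n) 𝓘(ℝ, ℂ) (f : M → ℂ) x₀ = 0 ∧ IsUnit (hessian x₀ f).det

/-- `φ = ν⁻¹ φ₋₁ + φ₀ + …`, where `x₀` is a nondegenerate critical point of `φ₋₁` with zero
critical value. -/
structure IsFormalPhase (x₀ : M) (φ : LaurentSeries (SmoothFun n M)) : Prop where
  coeff_eq_zero : ∀ k : ℤ, k < -1 → φ.coeff k = 0
  critical : IsNondegenerateCritical x₀ (φ.coeff (-1))
  critical_value : (φ.coeff (-1) : M → ℂ) x₀ = 0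

/-- A distribution on `M` supported at `x₀`: a linear functional which vanishes on the functions
vanishing near `x₀`, and which is continuous, that is, dominated by the maximum of finitely many
derivatives on a compact set (for a functional supported at `x₀` one chart around `x₀` is
enough). -/
structure IsPointDistribution (x₀ : M) (L : SmoothFun n M →ₗ[ℂ] ℂ) : Prop where
  support : ∀ f : SmoothFun n M, (∀ᶠ x in 𝓝 x₀, (f : M → ℂ) x = 0) → L f = 0
  continuous : ∃ (K : Set (EuclideanSpace ℝ (Fin n))) (N : ℕ) (C : ℝ),
    IsCompact K ∧ K ⊆ (extChartAt (𝓡 n) x₀).target ∧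
    ∀ (f : SmoothFun n M) (B : ℝ), 0 ≤ B →
      (∀ m ≤ N, ∀ y ∈ K, ‖iteratedFDeriv ℝ m (inChart (n := n) x₀ f) y‖ ≤ B) → ‖L f‖ ≤ C * B

/-- The Dirac distribution at `x₀`. -/
def dirac (x₀ : M) : SmoothFun n M →ₗ[ℂ] ℂ where
  toFun f := (f : M → ℂ) x₀
  map_add' _ _ := rfl
  map_smul' _ _ := rfl

/-- The coefficient of `Λ(f)` at `ν^k` is a sum of finitely many terms. -/
theorem finite_support_act (Λ : FormalFunctional n M) (f : LaurentSeries (SmoothFun n M))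
    (k : ℤ) : (Function.support fun r : ℕ => Λ r (f.coeff (k - r))).Finite := by
  refine (Set.finite_le_nat (k - f.order).toNat).subset fun r hr => ?_
  by_contra h
  simp only [Set.mem_ofPred_eq, not_le] at h
  refine hr ?_
  have : k - (r : ℤ) < f.order := by omega
  simp [HahnSeries.coeff_eq_zero_of_lt_order this]

/-- The `ν`-linear action of `Λ = Λ₀ + ν Λ₁ + …` on formal functions:
the coefficient of `Λ(f)` at `ν^k` is `∑ Λ_r(f_{k-r})`. -/
def act (Λ : FormalFunctional n M) (f : LaurentSeries (SmoothFun n M)) : LaurentSeries ℂ :=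
  HahnSeries.ofSuppBddBelow (fun k : ℤ => ∑ᶠ r : ℕ, Λ r (f.coeff (k - r))) <| by
    refine ⟨f.order, fun k hk => ?_⟩
    by_contra h
    refine hk (finsum_eq_zero_of_forall_eq_zero fun r => ?_)
    have : k - (r : ℤ) < f.order := by omega
    simp [HahnSeries.coeff_eq_zero_of_lt_order this]

/-- The formal constant `n / (2ν)`. -/
def halfDimOverNu (n : ℕ) (M : Type*) [TopologicalSpace M]
    [ChartedSpace (EuclideanSpace ℝ (Fin n)) M] : LaurentSeries (SmoothFun n M) :=
  HahnSeries.single (-1) (algebraMap ℂ (SmoothFun n M) ((n : ℂ) / 2))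

variable [IsManifold (𝓡 n) ∞ M]

theorem contMDiff_vfApply (v : SmoothVF n M) (f : SmoothFun n M) :
    ContMDiff (𝓡 n) 𝓘(ℝ, ℂ) ∞
      (fun x => (mfderiv (𝓡 n) 𝓘(ℝ, ℂ) (f : M → ℂ) x (v x) : ℂ)) := by
  have h1 : ContMDiff (𝓡 n).tangent 𝓘(ℝ, ℂ).tangent ∞
      (tangentMap (𝓡 n) 𝓘(ℝ, ℂ) (f : M → ℂ)) :=
    ContMDiff.contMDiff_tangentMap (n := ∞) f.2 (by simp)
  exact (contMDiff_snd_tangentBundle_modelSpace ℂ 𝓘(ℝ, ℂ)).comp (h1.comp v.contMDiff_toFun)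

/-- The derivative `v f` of a smooth function along a vector field. -/
def vfApply (v : SmoothVF n M) : SmoothFun n M →+ SmoothFun n M where
  toFun f := ⟨fun x => mfderiv (𝓡 n) 𝓘(ℝ, ℂ) (f : M → ℂ) x (v x), contMDiff_vfApply v f⟩
  map_zero' := by
    ext x
    change mfderiv (𝓡 n) 𝓘(ℝ, ℂ) (fun _ : M => (0 : ℂ)) x (v x) = 0
    rw [mfderiv_const]; rfl
  map_add' f g := by
    ext x
    have hf : MDifferentiableAt (𝓡 n) 𝓘(ℝ, ℂ) (f : M → ℂ) x :=
      (show ContMDiff (𝓡 n) 𝓘(ℝ, ℂ) ∞ (f : M → ℂ) from f.2).mdifferentiable (by simp) x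
    have hg : MDifferentiableAt (𝓡 n) 𝓘(ℝ, ℂ) (g : M → ℂ) x :=
      (show ContMDiff (𝓡 n) 𝓘(ℝ, ℂ) ∞ (g : M → ℂ) from g.2).mdifferentiable (by simp) x
    change mfderiv (𝓡 n) 𝓘(ℝ, ℂ) ((f : M → ℂ) + (g : M → ℂ)) x (v x) = _
    rw [mfderiv_add hf hg]; rfl

/-- The derivative `v f` of a formal function along a vector field, coefficient by coefficient. -/
def vfApplyFormal (v : SmoothVF n M) (f : LaurentSeries (SmoothFun n M)) :
    LaurentSeries (SmoothFun n M) :=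
  HahnSeries.map f (vfApply v)

/-- The value at `x` of `(𝕃_v σ)(w₁, …, wₙ)`, where `𝕃_v σ` is the Lie derivative of the top form
`σ`: `(𝕃_v σ)(w₁, …, wₙ) = v (σ(w₁, …, wₙ)) - ∑ᵢ σ(w₁, …, [v, wᵢ], …, wₙ)`. -/
def lieDeriv (v : SmoothVF n M) (σ : TopForm n M) (w : Fin n → SmoothVF n M) (x : M) : ℂ :=
  (vfApply v ⟨fun y => σ.form y (fun i => w i y), σ.smooth w⟩ : M → ℂ) x
    - ∑ i, σ.form x (Function.update (fun j => w j x) i (VectorField.mlieBracket (𝓡 n) v (w i) x))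

/-- The formal function `g = g₀ + ν g₁ + …` represents near `x₀` the divergence
`div_ρ v = (𝕃_v ρ) / ρ` with respect to `ρ = ρ₀ + ν ρ₁ + …`, that is, `g ρ = 𝕃_v ρ` on a
neighbourhood of `x₀` (the same for all powers of `ν`). -/
def IsDivergence (x₀ : M) (ρ : ℕ → TopForm n M) (v : SmoothVF n M)
    (g : PowerSeries (SmoothFun n M)) : Prop :=
  ∀ᶠ x in 𝓝 x₀, ∀ (k : ℕ) (w : Fin n → SmoothVF n M),
    ∑ p ∈ Finset.HasAntidiagonal.antidiagonal k,
      ((PowerSeries.coeff p.1 g : SmoothFun n M) : M → ℂ) x * (ρ p.2).form x (fun i => w i x)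
        = lieDeriv v (ρ k) w x

/-- The formal function `g = g₀ + ν g₁ + …` represents near `x₀` the logarithmic derivative
`(dρ/dν) / ρ` of `ρ = ρ₀ + ν ρ₁ + …`, that is, `g ρ = dρ/dν` on a neighbourhood of `x₀`. If
`ρ = e^u dx¹ ∧ … ∧ dxⁿ` in local coordinates, then `dρ/dν = (du/dν) ρ`, so that `g` represents
`du/dν`. -/
def IsLogDerivative (x₀ : M) (ρ : ℕ → TopForm n M) (g : PowerSeries (SmoothFun n M)) : Prop :=
  ∀ᶠ x in 𝓝 x₀, ∀ k : ℕ,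
    ∑ p ∈ Finset.HasAntidiagonal.antidiagonal k, ((PowerSeries.coeff p.1 g : SmoothFun n M) : M → ℂ) x • (ρ p.2).form x
      = ((k : ℂ) + 1) • (ρ (k + 1)).form x

/-- `Λ = Λ₀ + ν Λ₁ + …` is a formal oscillatory integral at `x₀` associated with `(φ, ρ)`:
a formal distribution supported at `x₀` with `Λ₀ ≠ 0` and `Λ(v f + (v φ + div_ρ v) f) = 0` for all
vector fields `v` and all formal functions `f`. Since `Λ` is supported at `x₀`, and `div_ρ v` is
only defined where `ρ₀ ≠ 0`, it enters through its representatives near `x₀`. -/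
structure IsFOI (x₀ : M) (φ : LaurentSeries (SmoothFun n M)) (ρ : ℕ → TopForm n M)
    (Λ : FormalFunctional n M) : Prop where
  distribution : ∀ r, IsPointDistribution x₀ (Λ r)
  leading_ne_zero : Λ 0 ≠ 0
  integration_by_parts : ∀ (v : SmoothVF n M) (g : PowerSeries (SmoothFun n M)),
    IsDivergence x₀ ρ v g → ∀ f : LaurentSeries (SmoothFun n M),
      act Λ (vfApplyFormal v f + (vfApplyFormal v φ + HahnSeries.ofPowerSeries ℤ _ g) * f) = 0

/-- The FOI `Λ` is strongly associated with `(φ, ρ)`: it is associated with `(φ, ρ)` and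
`d/dν Λ(f) - Λ(df/dν + (d(φ + u)/dν - n/(2ν)) f) = 0` for all formal functions `f`, where
`ρ = e^u dx¹ ∧ … ∧ dxⁿ` near `x₀`. -/
structure IsStrongFOI (x₀ : M) (φ : LaurentSeries (SmoothFun n M)) (ρ : ℕ → TopForm n M)
    (Λ : FormalFunctional n M) : Prop extends IsFOI x₀ φ ρ Λ where
  differentiation : ∀ g : PowerSeries (SmoothFun n M), IsLogDerivative x₀ ρ g →
    ∀ f : LaurentSeries (SmoothFun n M),
      LaurentSeries.derivative ℂ (act Λ f)
        - act Λ (LaurentSeries.derivative ℂ f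
            + (LaurentSeries.derivative ℂ φ + HahnSeries.ofPowerSeries ℤ _ g
                - halfDimOverNu n M) * f) = 0

/-- The full jet of the formal function `ψ` at `x₀` is the constant `c ∈ ℂ` (placed at `ν⁰`). -/
def JetIsConst (x₀ : M) (ψ : LaurentSeries (SmoothFun n M)) (c : ℂ) : Prop :=
  ∀ k : ℤ, JetVanishes x₀ ((ψ - HahnSeries.C (algebraMap ℂ (SmoothFun n M) c)).coeff k)

end

end FOI

end

/-! The functional is the formal version of `ν^(-n/2) ∫ e^φ f ρ`: integration by parts gives the
first identity, and differentiation under the integral sign gives the second, with `-n/(2ν)` coming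
from the prefactor.

Existence. Let `Φ = νφ`. In coordinates at `x₀` substitute `x = h y`, `ν = h²`. Since `x₀` is a
critical point of value zero, `Φ(hy, h²) = h² S` with `S = S₀ + h S₁ + …`, where `S₀` is half the
Hessian form plus a constant. The Jacobian `hⁿ = ν^(n/2)` absorbs the prefactor, and what remains is
a Gaussian functional applied to `e^(S - S₀)` times the expansion of `ρ f`. It exists algebraically:
the Gaussian functional is evaluation at zero of the exponential of a constant-coefficient
second-order operator, and nondegeneracy provides the covariance. Only even powers of `h` are kept.
Integration by parts in `y` gives the divergence identity (`formalIntegral_ibp`). The derivative in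
`ν` comes from the chain rule `h d/dh = ∑ yᵢ ∂ᵢ + 2 ν d/dν` on rescaled functions, where `∑ yᵢ ∂ᵢ`
integrates to `-n` (`formalIntegral_differentiation`).

Uniqueness. By Hadamard's lemma and invertibility of the Hessian, the derivatives of `φ₋₁` generate
the maximal ideal of germs at `x₀` (`exists_eq_sum_frame_mul`). The lowest nonzero component of a
functional that integrates by parts kills this ideal, so such a functional is determined by its
value on `1`. Two FOIs thus differ by a factor in `ℂ((ν))`, and the differentiation identity makes
this factor constant. In particular every strongly associated FOI inherits two properties of the
constructed one: its leading term is a multiple of the Dirac distribution, and it kills functions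
with zero Taylor series.

Phases. Subtracting the identities for two phases shows that `Λ` annihilates all multiples of `vG`
and of `νG' - G`, where `G = ν(φ - φ̂)`. A formal function all of whose multiples are annihilated is
flat at `x₀` (`taylor_coeff_eq_zero_of_seriesAct`). Hence every `∂ᵢ G_k` and every `(k - 1) G_k` is
flat, which leaves only a constant in `G₁`, the coefficient of `φ - φ̂` at `ν⁰`. -/

open scoped Manifold ContDiff Topology LaurentSeries
noncomputable section
namespace FOI

/-! ### Commuting coordinate vector fields near the point, extended to the manifold -/

section Frame

theorem natCast_le_infty (k : ℕ) : ((k : ℕ∞) : WithTop ℕ∞) ≤ ∞ := WithTop.coe_le_coe.2 le_top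

variable (n : ℕ) {M : Type*} [TopologicalSpace M] [ChartedSpace (EuclideanSpace ℝ (Fin n)) M]

/-- A bump function at `x₀`. -/
def bump (x₀ : M) : SmoothBumpFunction (𝓡 n) x₀ := Classical.arbitrary _

/-- An open neighbourhood of `x₀` on which the bump function is `1`. -/
def frameDomain (x₀ : M) : Set M := interior {x | bump n x₀ x = 1}

theorem isOpen_frameDomain (x₀ : M) : IsOpen (frameDomain n x₀) := isOpen_interior

theorem frameDomain_mem_nhds (x₀ : M) : frameDomain n x₀ ∈ 𝓝 x₀ :=
  interior_mem_nhds.2 (bump n x₀).eventuallyEq_one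

theorem mem_frameDomain (x₀ : M) : x₀ ∈ frameDomain n x₀ :=
  mem_of_mem_nhds (frameDomain_mem_nhds n x₀)

variable {n}

theorem bump_eq_one {x₀ x : M} (hx : x ∈ frameDomain n x₀) : bump n x₀ x = 1 := by
  have h : x ∈ {x | bump n x₀ x = 1} := interior_subset hx
  exact h

theorem frameDomain_subset (x₀ : M) :
    frameDomain n x₀ ⊆ (chartAt (EuclideanSpace ℝ (Fin n)) x₀).source := fun x hx =>
  (bump n x₀).support_subset_source (by simp [Function.mem_support, bump_eq_one hx])

variable [IsManifold (𝓡 n) ∞ M]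

/-- The standard basis of `ℝⁿ`. -/
abbrev stdBasis (n : ℕ) : Module.Basis (Fin n) ℝ (EuclideanSpace ℝ (Fin n)) :=
  (EuclideanSpace.basisFun (Fin n) ℝ).toBasis

/-- The coordinate vector fields of the preferred chart at `x₀`, which vanish off its domain. -/
def chartFrame (x₀ : M) (i : Fin n) (x : M) : TangentSpace (𝓡 n) x :=
  (trivializationAt (EuclideanSpace ℝ (Fin n)) (TangentSpace (𝓡 n) : M → Type _) x₀).localFrame
    (stdBasis n) i x

/-- The components of tangent vectors with respect to `chartFrame`. -/
def chartCoeff (x₀ : M) (i : Fin n) (x : M) : TangentSpace (𝓡 n) x →ₗ[ℝ] ℝ :=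
  (trivializationAt (EuclideanSpace ℝ (Fin n)) (TangentSpace (𝓡 n) : M → Type _) x₀).localFrameCoeff
    (𝓡 n) (stdBasis n) i x

theorem mfderiv_chartFrame {x₀ x : M}
    (hx : x ∈ (chartAt (EuclideanSpace ℝ (Fin n)) x₀).source) (i : Fin n) :
    mfderiv (𝓡 n) 𝓘(ℝ, EuclideanSpace ℝ (Fin n)) (extChartAt (𝓡 n) x₀) x (chartFrame x₀ i x)
      = EuclideanSpace.single i (1 : ℝ) := by
  rw [← TangentBundle.continuousLinearMapAt_trivializationAt hx, chartFrame,
    Bundle.Trivialization.localFrame_apply_of_mem_baseSet (hx := by simpa using hx)]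
  rw [Bundle.Trivialization.basisAt]
  refine Eq.trans ?_ ((trivializationAt (EuclideanSpace ℝ (Fin n))
    (TangentSpace (𝓡 n) : M → Type _) x₀).continuousLinearMapAt_symmL (R := ℝ) (b := x)
    (by simpa using hx) (EuclideanSpace.single i (1 : ℝ)))
  simp [-Bundle.Trivialization.continuousLinearMapAt_apply]
  exact congrArg _ (Bundle.Trivialization.symmL_apply _ (hb := by simpa using hx) _).symm

/-- The constant vector field `∂ᵢ` on `ℝⁿ`. -/
def constField (n : ℕ) (i : Fin n) (y : EuclideanSpace ℝ (Fin n)) :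
    TangentSpace 𝓘(ℝ, EuclideanSpace ℝ (Fin n)) y := EuclideanSpace.single i (1 : ℝ)

theorem chartFrame_eq_mpullback {x₀ x : M}
    (hx : x ∈ (chartAt (EuclideanSpace ℝ (Fin n)) x₀).source) (i : Fin n) :
    chartFrame x₀ i x = VectorField.mpullback (𝓡 n) 𝓘(ℝ, EuclideanSpace ℝ (Fin n))
      (extChartAt (𝓡 n) x₀) (constField n i) x :=
  ((isInvertible_mfderiv_extChartAt (by simpa using hx)).inverse_apply_eq.2
    (mfderiv_chartFrame hx i).symm).symm

variable [T2Space M]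

/-- The coordinate vector fields of the preferred chart at `x₀`, multiplied by a bump function. -/
def frame (x₀ : M) (i : Fin n) : SmoothVF n M where
  toFun x := bump n x₀ x • chartFrame x₀ i x
  contMDiff_toFun := by
    let e := trivializationAt (EuclideanSpace ℝ (Fin n)) (TangentSpace (𝓡 n) : M → Type _) x₀
    have h := e.contMDiffOn_localFrame_baseSet (I := 𝓡 n) ∞ (stdBasis n) i
    exact ContMDiffOn.smul_section_of_tsupport (bump n x₀).contMDiff.contMDiffOn e.open_baseSet
      (by simpa [e] using (bump n x₀).tsupport_subset_chartAt_source) h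

theorem frame_eq {x₀ x : M} (hx : x ∈ frameDomain n x₀) (i : Fin n) :
    frame x₀ i x = chartFrame x₀ i x := by
  change bump n x₀ x • chartFrame x₀ i x = _
  rw [bump_eq_one hx, one_smul]

/-- The components of a vector field in the frame `frame x₀`, multiplied by a bump function. -/
def coordReal (x₀ : M) (v : SmoothVF n M) (i : Fin n) (x : M) : ℝ :=
  bump n x₀ x * chartCoeff x₀ i x (v x)

theorem contMDiff_coordReal (x₀ : M) (v : SmoothVF n M) (i : Fin n) :
    ContMDiff (𝓡 n) 𝓘(ℝ, ℝ) ∞ (coordReal x₀ v i) := by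
  let e := trivializationAt (EuclideanSpace ℝ (Fin n)) (TangentSpace (𝓡 n) : M → Type _) x₀
  have h : ContMDiffOn (𝓡 n) 𝓘(ℝ, ℝ) ∞ (fun x => chartCoeff x₀ i x (v x))
      (chartAt (EuclideanSpace ℝ (Fin n)) x₀).source := by
    have := contMDiffOn_baseSet_localFrameCoeff (e := e) (I := 𝓡 n) (stdBasis n) (k := ∞)
      (s := fun x => v x) v.contMDiff_toFun.contMDiffOn i
    exact this.mono fun y hy => by simpa [e] using hy
  exact (bump n x₀).contMDiff_smul h

theorem eq_sum_frame {x₀ x : M} (hx : x ∈ frameDomain n x₀) (v : SmoothVF n M) :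
    v x = ∑ i, coordReal x₀ v i x • frame x₀ i x := by
  simp_rw [coordReal, bump_eq_one hx, one_mul, frame_eq hx]
  let e := trivializationAt (EuclideanSpace ℝ (Fin n)) (TangentSpace (𝓡 n) : M → Type _) x₀
  exact e.eq_sum_localFrameCoeff_smul (I := 𝓡 n) (b := stdBasis n) (s := fun x => v x)
    (by simpa [e] using frameDomain_subset x₀ hx)

/-- The basis of the tangent space at `x` given by the frame. -/
theorem exists_basis_frame {x₀ x : M} (hx : x ∈ frameDomain n x₀) :
    ∃ b : Module.Basis (Fin n) ℝ (TangentSpace (𝓡 n) x), (∀ i, b i = frame x₀ i x) ∧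
      ∀ (v : SmoothVF n M) i, b.repr (v x) i = coordReal x₀ v i x := by
  let e := trivializationAt (EuclideanSpace ℝ (Fin n)) (TangentSpace (𝓡 n) : M → Type _) x₀
  have hx' : x ∈ e.baseSet := by simpa [e] using frameDomain_subset x₀ hx
  refine ⟨e.basisAt (stdBasis n) hx', fun i => ?_, fun v i => ?_⟩
  · rw [frame_eq hx, chartFrame, e.localFrame_apply_of_mem_baseSet (hx := hx')]
  · rw [coordReal, bump_eq_one hx, one_mul, chartCoeff]
    exact (e.localFrameCoeff_apply_of_mem_baseSet (I := 𝓡 n) (stdBasis n) hx' (fun x => v x) i).symm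

theorem frame_eventuallyEq {x₀ x : M} (hx : x ∈ frameDomain n x₀) (i : Fin n) :
    (frame x₀ i : ∀ y : M, TangentSpace (𝓡 n) y) =ᶠ[𝓝 x]
      VectorField.mpullback (𝓡 n) 𝓘(ℝ, EuclideanSpace ℝ (Fin n))
      (extChartAt (𝓡 n) x₀) (constField n i) := by
  filter_upwards [(isOpen_frameDomain n x₀).mem_nhds hx] with y hy
  exact (frame_eq hy i).trans (chartFrame_eq_mpullback (frameDomain_subset x₀ hy) i)

theorem mlieBracket_constField (i j : Fin n) :
    VectorField.mlieBracket 𝓘(ℝ, EuclideanSpace ℝ (Fin n)) (constField n i) (constField n j)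
      = 0 := by
  have h : VectorField.lieBracket ℝ (fun _ : EuclideanSpace ℝ (Fin n) =>
      (EuclideanSpace.single i (1 : ℝ) : EuclideanSpace ℝ (Fin n)))
      (fun _ => EuclideanSpace.single j (1 : ℝ)) = 0 := by
    ext y : 1
    simp [VectorField.lieBracket]
  rw [← VectorField.mlieBracketWithin_univ]
  exact VectorField.mlieBracketWithin_eq_lieBracketWithin.trans
    (VectorField.lieBracketWithin_univ.trans h)

/-- Near each point of `frameDomain` the fields are pullbacks of constant fields by the chart, and
pullback respects brackets. -/
theorem mlieBracket_frame {x₀ x : M} (hx : x ∈ frameDomain n x₀) (i j : Fin n) :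
    VectorField.mlieBracket (𝓡 n) (frame x₀ i) (frame x₀ j) x = 0 := by
  have hs := frameDomain_subset x₀ hx
  have : IsManifold (𝓡 n) (minSmoothness ℝ 3) M := by
    rw [minSmoothness_of_isRCLikeNormedField]
    exact IsManifold.of_le (n := ∞) (natCast_le_infty 3)
  have hc : ∀ i, MDifferentiableAt 𝓘(ℝ, EuclideanSpace ℝ (Fin n))
      (𝓘(ℝ, EuclideanSpace ℝ (Fin n)).prod 𝓘(ℝ, EuclideanSpace ℝ (Fin n))) (fun y =>
      (⟨y, constField n i y⟩ : TangentBundle 𝓘(ℝ, EuclideanSpace ℝ (Fin n))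
        (EuclideanSpace ℝ (Fin n)))) (extChartAt (𝓡 n) x₀ x) := by
    intro i
    refine ContMDiffAt.mdifferentiableAt (n := 1) ?_ one_ne_zero
    exact contMDiffAt_vectorSpace_iff_contDiffAt.2
      (contDiffAt_const (c := (EuclideanSpace.single i (1 : ℝ) : EuclideanSpace ℝ (Fin n))))
  rw [(frame_eventuallyEq hx i).mlieBracket_vectorField_eq (frame_eventuallyEq hx j),
    ← VectorField.mpullback_mlieBracket (n := ∞) (hc i) (hc j) (contMDiffAt_extChartAt' hs)
      (by simpa using natCast_le_infty 2),
    VectorField.mpullback_apply, mlieBracket_constField]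
  exact map_zero _

end Frame

/-! ### Smooth functions, germs, and derivatives along the frame -/

section Functions

variable {n : ℕ} {M : Type*} [TopologicalSpace M] [ChartedSpace (EuclideanSpace ℝ (Fin n)) M]

theorem contMDiff_smoothFun (f : SmoothFun n M) : ContMDiff (𝓡 n) 𝓘(ℝ, ℂ) ∞ (f : M → ℂ) := f.2

theorem mdifferentiableAt_smoothFun (f : SmoothFun n M) (x : M) :
    MDifferentiableAt (𝓡 n) 𝓘(ℝ, ℂ) (f : M → ℂ) x :=
  (contMDiff_smoothFun f).mdifferentiable (by simp) x

/-- Evaluation at a point, as an algebra homomorphism. -/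
def evalAt (x : M) : SmoothFun n M →ₐ[ℂ] ℂ :=
  (Pi.evalAlgHom ℂ (fun _ : M => ℂ) x).comp (SmoothFun n M).val

@[simp] theorem smoothFun_sum_apply {ι : Type*} (s : Finset ι) (f : ι → SmoothFun n M) (x : M) :
    ((∑ i ∈ s, f i : SmoothFun n M) : M → ℂ) x = ∑ i ∈ s, (f i : M → ℂ) x :=
  map_sum (evalAt x) f s

theorem mul_smooth_of_source {x₀ : M} {g : M → ℂ}
    (hg : ContMDiffOn (𝓡 n) 𝓘(ℝ, ℂ) ∞ g (chartAt (EuclideanSpace ℝ (Fin n)) x₀).source)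
    [T2Space M] [IsManifold (𝓡 n) ∞ M] :
    ∃ f : SmoothFun n M, ∀ x ∈ frameDomain n x₀, (f : M → ℂ) x = g x :=
  ⟨⟨_, (bump n x₀).contMDiff_smul hg⟩, fun x hx => by simp [bump_eq_one hx]⟩

/-- The ideal of the functions which vanish near `x₀`. -/
def germIdeal (n : ℕ) {M : Type*} [TopologicalSpace M]
    [ChartedSpace (EuclideanSpace ℝ (Fin n)) M] (x₀ : M) : Ideal (SmoothFun n M) where
  carrier := {f | ∀ᶠ x in 𝓝 x₀, (f : M → ℂ) x = 0}
  add_mem' {f g} hf hg := by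
    filter_upwards [hf, hg] with x h1 h2
    change (f : M → ℂ) x + (g : M → ℂ) x = 0
    rw [h1, h2, add_zero]
  zero_mem' := Filter.Eventually.of_forall fun _ => rfl
  smul_mem' c f hf := by
    filter_upwards [hf] with x h1
    change (c : M → ℂ) x * (f : M → ℂ) x = 0
    rw [h1, mul_zero]

theorem mem_germIdeal {x₀ : M} {f : SmoothFun n M} :
    f ∈ germIdeal n x₀ ↔ ∀ᶠ x in 𝓝 x₀, (f : M → ℂ) x = 0 := Iff.rfl

theorem sub_mem_germIdeal {x₀ : M} {f g : SmoothFun n M} :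
    f - g ∈ germIdeal n x₀ ↔ (f : M → ℂ) =ᶠ[𝓝 x₀] g := by
  rw [mem_germIdeal]
  exact Filter.eventually_congr (Filter.Eventually.of_forall fun x => sub_eq_zero)

theorem inChart_extChartAt {x₀ x : M} (hx : x ∈ (extChartAt (𝓡 n) x₀).source) (f : M → ℂ) :
    inChart (n := n) x₀ f (extChartAt (𝓡 n) x₀ x) = f x := by
  rw [inChart, (extChartAt (𝓡 n) x₀).left_inv hx]

variable [IsManifold (𝓡 n) ∞ M]

theorem vfApply_apply (v : SmoothVF n M) (f : SmoothFun n M) (x : M) :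
    (vfApply v f : M → ℂ) x = mfderiv (𝓡 n) 𝓘(ℝ, ℂ) (f : M → ℂ) x (v x) := rfl

theorem vfApply_mul (v : SmoothVF n M) (f g : SmoothFun n M) :
    vfApply v (f * g) = f * vfApply v g + g * vfApply v f := by
  ext x
  have h := ((mdifferentiableAt_smoothFun f x).hasMFDerivAt.mul
        (mdifferentiableAt_smoothFun g x).hasMFDerivAt).mfderiv
  change mfderiv (𝓡 n) 𝓘(ℝ, ℂ) ((f : M → ℂ) * (g : M → ℂ)) x (v x) = _
  rw [h]
  rfl

theorem vfApply_algebraMap (v : SmoothVF n M) (c : ℂ) :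
    vfApply v (algebraMap ℂ (SmoothFun n M) c) = 0 := by
  ext x
  change mfderiv (𝓡 n) 𝓘(ℝ, ℂ) (fun _ : M => c) x (v x) = 0
  rw [mfderiv_const]; rfl

/-- The derivation of `C^∞(M)` given by a vector field. -/
def vfDer (v : SmoothVF n M) : Derivation ℂ (SmoothFun n M) (SmoothFun n M) :=
  Derivation.mk' { vfApply v with
    map_smul' := fun c f => by
      simp only [ZeroHom.toFun_eq_coe, AddMonoidHom.toZeroHom_coe, RingHom.id_apply]
      rw [Algebra.smul_def, vfApply_mul, vfApply_algebraMap, mul_zero, add_zero,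
        ← Algebra.smul_def] }
    fun f g => by simpa using vfApply_mul v f g

@[simp] theorem vfDer_apply (v : SmoothVF n M) (f : SmoothFun n M) : vfDer v f = vfApply v f := rfl

theorem vfApply_congr {x : M} (v : SmoothVF n M) {f g : SmoothFun n M}
    (h : (f : M → ℂ) =ᶠ[𝓝 x] g) : (vfApply v f : M → ℂ) x = (vfApply v g : M → ℂ) x := by
  rw [vfApply_apply, vfApply_apply, h.mfderiv_eq]
  rfl

theorem vfApply_mem_germIdeal {x₀ : M} (v : SmoothVF n M) {f : SmoothFun n M}
    (hf : f ∈ germIdeal n x₀) : vfApply v f ∈ germIdeal n x₀ := by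
  filter_upwards [Filter.Eventually.eventually_nhds hf] with x hx
  rw [vfApply_congr v (g := 0) hx, map_zero]
  rfl

theorem contDiffAt_inChart (x₀ : M) (f : SmoothFun n M) {y : EuclideanSpace ℝ (Fin n)}
    (hy : y ∈ (extChartAt (𝓡 n) x₀).target) : ContDiffAt ℝ ∞ (inChart (n := n) x₀ f) y := by
  have h1 := (contMDiffOn_extChartAt_symm (I := 𝓡 n) (n := ∞) x₀).contMDiffAt
    (extChartAt_target_mem_nhds' hy)
  exact ((contMDiff_smoothFun f).contMDiffAt.comp y h1).contDiffAt

variable [T2Space M]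

theorem vfApply_frame {x₀ x : M} (hx : x ∈ frameDomain n x₀) (i : Fin n) (f : SmoothFun n M) :
    (vfApply (frame x₀ i) f : M → ℂ) x
      = fderiv ℝ (inChart (n := n) x₀ f) (extChartAt (𝓡 n) x₀ x) (EuclideanSpace.single i 1) := by
  have hs := frameDomain_subset x₀ hx
  have hs' : x ∈ (extChartAt (𝓡 n) x₀).source := by simpa using hs
  have h1 : (f : M → ℂ) =ᶠ[𝓝 x] inChart (n := n) x₀ f ∘ extChartAt (𝓡 n) x₀ := by
    filter_upwards [(isOpen_extChartAt_source x₀).mem_nhds hs'] with y hy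
    exact (inChart_extChartAt hy f).symm
  have h2 : DifferentiableAt ℝ (inChart (n := n) x₀ f) (extChartAt (𝓡 n) x₀ x) :=
    (contDiffAt_inChart x₀ f ((extChartAt (𝓡 n) x₀).map_source hs')).differentiableAt (by simp)
  have h3 : MDifferentiableAt (𝓡 n) 𝓘(ℝ, EuclideanSpace ℝ (Fin n)) (extChartAt (𝓡 n) x₀) x :=
    (contMDiffAt_extChartAt' (n := 1) hs).mdifferentiableAt one_ne_zero
  rw [vfApply_apply, h1.mfderiv_eq, mfderiv_comp x h2.mdifferentiableAt h3, frame_eq hx]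
  refine (congrArg _ (mfderiv_chartFrame hs i)).trans ?_
  rw [mfderiv_eq_fderiv]
  rfl

theorem inChart_frame_eventuallyEq {x₀ x : M} (hx : x ∈ frameDomain n x₀) (i : Fin n)
    (f : SmoothFun n M) :
    inChart (n := n) x₀ (vfApply (frame x₀ i) f) =ᶠ[𝓝 (extChartAt (𝓡 n) x₀ x)]
      fun y => fderiv ℝ (inChart (n := n) x₀ f) y (EuclideanSpace.single i 1) := by
  have hs' : x ∈ (extChartAt (𝓡 n) x₀).source := by simpa using frameDomain_subset x₀ hx
  have ht := (extChartAt (𝓡 n) x₀).map_source hs'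
  have hc : Filter.Tendsto (extChartAt (𝓡 n) x₀).symm (𝓝 (extChartAt (𝓡 n) x₀ x)) (𝓝 x) := by
    have := continuousAt_extChartAt_symm' hs'
    rwa [ContinuousAt, (extChartAt (𝓡 n) x₀).left_inv hs'] at this
  filter_upwards [hc ((isOpen_frameDomain n x₀).mem_nhds hx),
    extChartAt_target_mem_nhds' ht] with y hy hyt
  rw [inChart, vfApply_frame hy, (extChartAt (𝓡 n) x₀).right_inv hyt]

theorem vfApply_frame_frame {x₀ x : M} (hx : x ∈ frameDomain n x₀) (i j : Fin n)
    (f : SmoothFun n M) :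
    (vfApply (frame x₀ i) (vfApply (frame x₀ j) f) : M → ℂ) x
      = fderiv ℝ (fderiv ℝ (inChart (n := n) x₀ f)) (extChartAt (𝓡 n) x₀ x)
          (EuclideanSpace.single i 1) (EuclideanSpace.single j 1) := by
  have hs' : x ∈ (extChartAt (𝓡 n) x₀).source := by simpa using frameDomain_subset x₀ hx
  have h2 := contDiffAt_inChart x₀ f ((extChartAt (𝓡 n) x₀).map_source hs')
  have h3 : DifferentiableAt ℝ (fderiv ℝ (inChart (n := n) x₀ f)) (extChartAt (𝓡 n) x₀ x) :=
    (h2.fderiv_right (m := 1) (natCast_le_infty 2)).differentiableAt one_ne_zero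
  rw [vfApply_frame hx, (inChart_frame_eventuallyEq hx j f).fderiv_eq,
    fderiv_clm_apply h3 (differentiableAt_const _)]
  simp

/-- Symmetry of the second derivative in the chart. Off `frameDomain` the cut-off fields need not
commute, which is why `FormalFrame` asks for commutation only modulo an ideal. -/
theorem vfApply_frame_comm {x₀ x : M} (hx : x ∈ frameDomain n x₀) (i j : Fin n)
    (f : SmoothFun n M) :
    (vfApply (frame x₀ i) (vfApply (frame x₀ j) f) : M → ℂ) x
      = (vfApply (frame x₀ j) (vfApply (frame x₀ i) f) : M → ℂ) x := by
  have hs' : x ∈ (extChartAt (𝓡 n) x₀).source := by simpa using frameDomain_subset x₀ hx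
  have h2 := contDiffAt_inChart x₀ f ((extChartAt (𝓡 n) x₀).map_source hs')
  rw [vfApply_frame_frame hx, vfApply_frame_frame hx]
  exact (h2.isSymmSndFDerivAt (by simpa using natCast_le_infty 2)).eq _ _

/-- The components of a vector field in the frame `frame x₀`, as complex-valued functions. -/
def coord (x₀ : M) (v : SmoothVF n M) (i : Fin n) : SmoothFun n M :=
  ⟨fun x => (coordReal x₀ v i x : ℂ),
    Complex.ofRealCLM.contDiff.contMDiff.comp (contMDiff_coordReal x₀ v i)⟩

@[simp] theorem coord_apply (x₀ : M) (v : SmoothVF n M) (i : Fin n) (x : M) :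
    (coord x₀ v i : M → ℂ) x = coordReal x₀ v i x := rfl

theorem vfApply_eq_sum {x₀ x : M} (hx : x ∈ frameDomain n x₀) (v : SmoothVF n M)
    (f : SmoothFun n M) :
    (vfApply v f : M → ℂ) x
      = ∑ i, (coord x₀ v i : M → ℂ) x * (vfApply (frame x₀ i) f : M → ℂ) x := by
  simp only [vfApply_apply, coord_apply]
  rw [eq_sum_frame hx v, map_sum]
  refine Finset.sum_congr rfl fun i _ => ?_
  rw [map_smul]
  exact Complex.real_smul

end Functions

/-! ### Derivatives of determinants and top-degree alternating forms -/

section Determinant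

theorem Derivation.apply_prod {R A ι : Type*} [CommRing R] [CommRing A] [Algebra R A]
    [DecidableEq ι] (D : Derivation R A A) (s : Finset ι) (f : ι → A) :
    D (∏ i ∈ s, f i) = ∑ i ∈ s, ∏ j ∈ s, Function.update f i (D (f i)) j := by
  induction s using Finset.induction_on with
  | empty => simp
  | insert a s ha ih =>
    rw [Finset.prod_insert ha, D.leibniz, ih, Finset.sum_insert ha, Finset.prod_insert ha,
      Function.update_self, smul_eq_mul, smul_eq_mul, Finset.mul_sum, add_comm]
    congr 1
    · rw [mul_comm]
      congr 1
      refine Finset.prod_congr rfl fun j hj => ?_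
      rw [Function.update_of_ne (ne_of_mem_of_not_mem hj ha)]
    · refine Finset.sum_congr rfl fun i hi => ?_
      rw [Finset.prod_insert ha, Function.update_of_ne (ne_of_mem_of_not_mem hi ha).symm]

theorem Derivation.apply_det {R A ι : Type*} [CommRing R] [CommRing A] [Algebra R A]
    [DecidableEq ι] [Fintype ι] (D : Derivation R A A) (m : Matrix ι ι A) :
    D m.det = ∑ i, (m.updateRow i fun j => D (m i j)).det := by
  simp_rw [← Matrix.det_transpose m, ← Matrix.det_transpose (Matrix.updateRow _ _ _),
    Matrix.det_apply, map_sum]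
  rw [Finset.sum_comm]
  refine Finset.sum_congr rfl fun σ _ => ?_
  rw [← Finset.smul_sum]
  have : ∀ (u : ℤˣ) (a : A), D (u • a) = u • D a := fun u a => by
    rcases Int.units_eq_one_or u with rfl | rfl <;> simp
  rw [this, Derivation.apply_prod]
  congr 1
  refine Finset.sum_congr rfl fun i _ => Finset.prod_congr rfl fun j _ => ?_
  change Function.update (fun i => m i (σ i)) i (D (m i (σ i))) j
    = Function.update m i (fun j => D (m i j)) j (σ j)
  by_cases h : j = i
  · subst h
    rw [Function.update_self]
    exact (congrFun (Function.update_self j (fun l => D (m j l)) m) (σ j)).symm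
  · rw [Function.update_of_ne h]
    exact (congrFun (Function.update_of_ne h (fun l => D (m i l)) m) (σ j)).symm

theorem AlternatingMap.eq_det_smul {V W : Type*} [AddCommGroup V] [Module ℝ V] [AddCommGroup W]
    [Module ℝ W] {n : ℕ} (b : Module.Basis (Fin n) ℝ V) (f : V [⋀^Fin n]→ₗ[ℝ] W)
    (u : Fin n → V) : f u = (Matrix.of fun i j => b.repr (u i) j).det • f b := by
  have h : f = (LinearMap.toSpanSingleton ℝ W (f b)).compAlternatingMap b.det := by
    refine Module.Basis.ext_alternating b fun v hv => ?_
    let e := Equiv.ofBijective v (Finite.injective_iff_bijective.1 hv)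
    have h1 : (fun i => b (v i)) = b ∘ e := rfl
    rw [h1, AlternatingMap.map_perm, AlternatingMap.map_perm]
    simp [b.det_self]
  conv_lhs => rw [h]
  simp only [LinearMap.compAlternatingMap_apply, LinearMap.toSpanSingleton_apply]
  rw [Module.Basis.det_apply, ← Matrix.det_transpose]
  rfl

end Determinant

/-! ### Lie derivatives of top forms in coordinates -/

section Forms

variable {n : ℕ} {M : Type*} [TopologicalSpace M] [ChartedSpace (EuclideanSpace ℝ (Fin n)) M]
  [IsManifold (𝓡 n) ∞ M] [T2Space M]

theorem vfApply_coord (x₀ x : M) (v w : SmoothVF n M) (j : Fin n) :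
    (vfApply v (coord x₀ w j) : M → ℂ) x
      = (mvfderiv (𝓡 n) (coordReal x₀ w j) x (v x) : ℝ) := by
  have h1 : MDifferentiableAt (𝓡 n) 𝓘(ℝ, ℝ) (coordReal x₀ w j) x :=
    (contMDiff_coordReal x₀ w j).mdifferentiable (by simp) x
  have h2 := ((Complex.ofRealCLM.hasMFDerivAt (x := coordReal x₀ w j x)).comp x
    h1.hasMFDerivAt).mfderiv
  rw [vfApply_apply]
  change mfderiv (𝓡 n) 𝓘(ℝ, ℂ) (Complex.ofRealCLM ∘ coordReal x₀ w j) x (v x) = _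
  rw [h2]
  rfl

/-- A partial sum of the expansion of a vector field in the frame. -/
def frameSum (x₀ : M) (w : SmoothVF n M) (s : Finset (Fin n)) (y : M) : TangentSpace (𝓡 n) y :=
  ∑ j ∈ s, coordReal x₀ w j y • frame x₀ j y

/-- Expand `w` in the frame: the frame fields commute, so only the derivatives of the components of
`w` survive. -/
theorem mlieBracket_frame_left {x₀ x : M} (hx : x ∈ frameDomain n x₀) (k : Fin n)
    (w : SmoothVF n M) :
    VectorField.mlieBracket (𝓡 n) (frame x₀ k) w x
      = ∑ j, mvfderiv (𝓡 n) (coordReal x₀ w j) x (frame x₀ k x) • frame x₀ j x := by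
  have : IsManifold (𝓡 n) (minSmoothness ℝ 2) M := by
    rw [minSmoothness_of_isRCLikeNormedField]
    exact IsManifold.of_le (n := ∞) (natCast_le_infty 2)
  have hd : ∀ j, MDifferentiableAt (𝓡 n) 𝓘(ℝ, ℝ) (coordReal x₀ w j) x := fun j =>
    (contMDiff_coordReal x₀ w j).mdifferentiable (by simp) x
  have hX : ∀ j, MDifferentiableAt (𝓡 n) ((𝓡 n).prod 𝓘(ℝ, EuclideanSpace ℝ (Fin n)))
      (fun y => (⟨y, frame x₀ j y⟩ : TangentBundle (𝓡 n) M)) x := fun j =>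
    (frame x₀ j).contMDiff_toFun.mdifferentiable (by simp) x
  -- Differentiability is carried along with the formula because the bracket is additive only on
  -- differentiable fields.
  have key : ∀ s : Finset (Fin n),
      MDifferentiableAt (𝓡 n) ((𝓡 n).prod 𝓘(ℝ, EuclideanSpace ℝ (Fin n)))
        (fun y => (⟨y, frameSum x₀ w s y⟩ : TangentBundle (𝓡 n) M)) x ∧
      VectorField.mlieBracket (𝓡 n) (frame x₀ k) (frameSum x₀ w s) x
      = ∑ j ∈ s, mvfderiv (𝓡 n) (coordReal x₀ w j) x (frame x₀ k x) • frame x₀ j x := by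
    intro s
    induction s using Finset.induction_on with
    | empty =>
      have h0 : frameSum x₀ w ∅ = 0 := rfl
      rw [h0, VectorField.mlieBracket_zero_right]
      refine ⟨?_, rfl⟩
      exact (Bundle.contMDiff_zeroSection (n := 1) ℝ
        (TangentSpace (𝓡 n) : M → Type _)).mdifferentiable one_ne_zero x
    | insert a s ha ih =>
      have h1 := MDifferentiableAt.smul_section (hd a) (hX a)
      have h2 : frameSum x₀ w (insert a s)
          = coordReal x₀ w a • (frame x₀ a : ∀ y : M, TangentSpace (𝓡 n) y) + frameSum x₀ w s :=
        funext fun y => Finset.sum_insert ha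
      rw [h2]
      refine ⟨mdifferentiableAt_add_section h1 ih.1, ?_⟩
      rw [VectorField.mlieBracket_add_right h1 ih.1, ih.2,
        VectorField.mlieBracket_smul_right (hd a) (hX a), mlieBracket_frame hx, smul_zero, add_zero,
        Finset.sum_insert ha]
  have hw : (w : ∀ y : M, TangentSpace (𝓡 n) y) =ᶠ[𝓝 x] frameSum x₀ w Finset.univ := by
    filter_upwards [(isOpen_frameDomain n x₀).mem_nhds hx] with y hy
    exact eq_sum_frame hy w
  rw [Filter.EventuallyEq.rfl.mlieBracket_vectorField_eq hw, (key _).2]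

/-- The coefficient of the form `σ` with respect to the frame. -/
def density (x₀ : M) (σ : TopForm n M) : SmoothFun n M :=
  ⟨fun y => σ.form y (fun i => frame x₀ i y), σ.smooth _⟩

theorem form_apply {x₀ x : M} (hx : x ∈ frameDomain n x₀) (σ : TopForm n M)
    (w : Fin n → SmoothVF n M) :
    σ.form x (fun i => w i x)
      = (Matrix.of fun i j => (coord x₀ (w i) j : M → ℂ) x).det
        * (density x₀ σ : M → ℂ) x := by
  obtain ⟨b, hb, hr⟩ := exists_basis_frame hx
  rw [AlternatingMap.eq_det_smul b, Complex.real_smul]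
  have h1 : (b : Fin n → TangentSpace (𝓡 n) x) = fun i => frame x₀ i x := funext hb
  rw [h1]
  congr 1
  simp only [hr]
  exact (RingHom.map_det Complex.ofRealHom _)

/-- The classical `𝕃_v (r dx) = ∑ ∂ᵢ(vᵢ r) dx`. In `[v, ∂ᵢ] = -∑ⱼ (∂ᵢ vⱼ) ∂ⱼ` only `j = i`
contributes, since an alternating form vanishes on a repeated vector. -/
theorem lieDeriv_frame {x₀ x : M} (hx : x ∈ frameDomain n x₀) (v : SmoothVF n M)
    (σ : TopForm n M) :
    lieDeriv v σ (frame x₀) x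
      = (∑ i, vfApply (frame x₀ i) (coord x₀ v i * density x₀ σ) : SmoothFun n M).1 x := by
  have h1 : ∀ i, σ.form x (Function.update (fun j => frame x₀ j x) i
      (VectorField.mlieBracket (𝓡 n) v (frame x₀ i) x))
      = - ((vfApply (frame x₀ i) (coord x₀ v i) : M → ℂ) x * (density x₀ σ : M → ℂ) x) := by
    intro i
    rw [VectorField.mlieBracket_swap_apply, mlieBracket_frame_left hx,
      AlternatingMap.map_update_neg,
      AlternatingMap.map_update_sum, Finset.sum_eq_single i]
    · rw [AlternatingMap.map_update_smul, Function.update_eq_self, vfApply_coord, Complex.real_smul]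
      rfl
    · intro j _ hj
      rw [AlternatingMap.map_update_smul,
        σ.form x |>.map_update_self (fun j => frame x₀ j x) hj.symm, smul_zero]
    · simp
  rw [lieDeriv, Finset.sum_congr rfl fun i _ => h1 i, Finset.sum_neg_distrib, sub_neg_eq_add]
  change (vfApply v (density x₀ σ) : M → ℂ) x + _ = _
  rw [vfApply_eq_sum hx, ← Finset.sum_add_distrib]
  rw [smoothFun_sum_apply]
  refine Finset.sum_congr rfl fun i _ => ?_
  rw [vfApply_mul]
  change _ = (coord x₀ v i : M → ℂ) x * (vfApply (frame x₀ i) (density x₀ σ) : M → ℂ) x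
    + (density x₀ σ : M → ℂ) x * (vfApply (frame x₀ i) (coord x₀ v i) : M → ℂ) x
  ring

/-- Here the arguments are arbitrary, as `IsDivergence` demands. The value of the form is a
determinant of components times the density; the bracket terms add up to the derivative of the
determinant and cancel it, so only the density is differentiated. -/
theorem frame_lieDeriv {x₀ x : M} (hx : x ∈ frameDomain n x₀) (k : Fin n)
    (σ : TopForm n M) (w : Fin n → SmoothVF n M) :
    lieDeriv (frame x₀ k) σ w x
      = (Matrix.of fun i j => (coord x₀ (w i) j : M → ℂ) x).det
        * (vfApply (frame x₀ k) (density x₀ σ) : M → ℂ) x := by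
  obtain ⟨b, hb, hr⟩ := exists_basis_frame hx
  have hb' : (b : Fin n → TangentSpace (𝓡 n) x) = fun i => frame x₀ i x := funext hb
  let m : Matrix (Fin n) (Fin n) (SmoothFun n M) := Matrix.of fun i j => coord x₀ (w i) j
  have hdet : ∀ y, (m.det : M → ℂ) y = (Matrix.of fun i j => (coord x₀ (w i) j : M → ℂ) y).det :=
    fun y => RingHom.map_det (evalAt y).toRingHom m
  have h1 : (vfApply (frame x₀ k) ⟨fun y => σ.form y (fun i => w i y), σ.smooth w⟩ : M → ℂ) x
      = (vfApply (frame x₀ k) (m.det * density x₀ σ) : M → ℂ) x := by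
    refine vfApply_congr _ ?_
    filter_upwards [(isOpen_frameDomain n x₀).mem_nhds hx] with y hy
    change _ = (m.det : M → ℂ) y * (density x₀ σ : M → ℂ) y
    rw [hdet, ← form_apply hy]
  have h2 : ∀ i, σ.form x (Function.update (fun j => w j x) i
      (VectorField.mlieBracket (𝓡 n) (frame x₀ k) (w i) x))
      = ((m.updateRow i fun j => vfDer (frame x₀ k) (m i j)).det : M → ℂ) x
        * (density x₀ σ : M → ℂ) x := by
    intro i
    rw [AlternatingMap.eq_det_smul b, Complex.real_smul, hb']
    congr 1
    refine (RingHom.map_det Complex.ofRealHom _).trans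
      (Eq.trans ?_ (RingHom.map_det (evalAt x).toRingHom _).symm)
    congr 1
    ext a c
    simp only [RingHom.mapMatrix_apply, Matrix.map_apply, Matrix.of_apply, Matrix.updateRow_apply,
      Function.update_apply]
    split_ifs with h
    · subst h
      have h3 : VectorField.mlieBracket (𝓡 n) (frame x₀ k) (w a) x
          = ∑ j, mvfderiv (𝓡 n) (coordReal x₀ (w a) j) x (frame x₀ k x) • b j := by
        rw [mlieBracket_frame_left hx]
        exact Finset.sum_congr rfl fun j _ => by rw [hb]
      rw [h3, b.repr_sum_self]
      exact (vfApply_coord x₀ x (frame x₀ k) (w a) c).symm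
    · rw [hr]; rfl
  rw [lieDeriv, h1, Finset.sum_congr rfl fun i _ => h2 i, vfApply_mul, ← Finset.sum_mul,
    ← smoothFun_sum_apply, ← Derivation.apply_det, ← hdet]
  change (m.det : M → ℂ) x * (vfApply (frame x₀ k) (density x₀ σ) : M → ℂ) x
    + (density x₀ σ : M → ℂ) x * (vfApply (frame x₀ k) m.det : M → ℂ) x
    - (vfApply (frame x₀ k) m.det : M → ℂ) x * (density x₀ σ : M → ℂ) x = _
  ring

end Forms

/-! ### Division by the density: divergence and logarithmic derivative -/

section Division

theorem AlternatingMap.finset_sum_apply {R V W ι κ : Type*} [CommSemiring R] [AddCommMonoid V]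
    [Module R V] [AddCommMonoid W] [Module R W] (s : Finset κ) (f : κ → V [⋀^ι]→ₗ[R] W)
    (u : ι → V) : (∑ p ∈ s, f p) u = ∑ p ∈ s, f p u := by
  classical
  induction s using Finset.induction_on with
  | empty => simp
  | insert a s ha ih => rw [Finset.sum_insert ha, Finset.sum_insert ha,
    AlternatingMap.add_apply, ih]

variable {n : ℕ} {M : Type*} [TopologicalSpace M] [ChartedSpace (EuclideanSpace ℝ (Fin n)) M]
  [IsManifold (𝓡 n) ∞ M]

/-- The derivative of a formal power series of functions along a vector field. -/
def vfSeries (v : SmoothVF n M) (F : PowerSeries (SmoothFun n M)) : PowerSeries (SmoothFun n M) :=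
  PowerSeries.mk fun k => vfApply v (PowerSeries.coeff k F)

@[simp] theorem coeff_vfSeries (v : SmoothVF n M) (F : PowerSeries (SmoothFun n M)) (k : ℕ) :
    PowerSeries.coeff k (vfSeries v F) = vfApply v (PowerSeries.coeff k F) :=
  PowerSeries.coeff_mk _ _

variable [T2Space M]

theorem exists_local_inverse {x₀ : M} {f : SmoothFun n M} (hf : (f : M → ℂ) x₀ ≠ 0) :
    ∃ g : SmoothFun n M, ∀ᶠ x in 𝓝 x₀, (f : M → ℂ) x * (g : M → ℂ) x = 1 := by
  have hc := (contMDiff_smoothFun f).continuous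
  have hU : {x | (f : M → ℂ) x ≠ 0} ∈ 𝓝 x₀ := hc.continuousAt.eventually_ne hf
  obtain ⟨χ, -, hχ⟩ := (SmoothBumpFunction.nhds_basis_tsupport (I := 𝓡 n) x₀).mem_iff.1 hU
  refine ⟨⟨fun x => χ x • ((f : M → ℂ) x)⁻¹, contMDiff_of_tsupport fun x hx => ?_⟩, ?_⟩
  · have hx' : (f : M → ℂ) x ≠ 0 := hχ (tsupport_smul_subset_left _ _ hx)
    refine χ.contMDiffAt.smul ?_
    exact (contDiffAt_inv ℂ hx' |>.restrict_scalars ℝ).contMDiffAt.comp x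
      (contMDiff_smoothFun f).contMDiffAt
  · filter_upwards [χ.eventuallyEq_one, hU] with x h1 h2
    rw [h1, Pi.one_apply, one_smul, mul_inv_cancel₀ h2]

/-- The point is that one neighbourhood serves all powers of the formal variable: only the leading
coefficient is inverted locally, and the rest is algebra. -/
theorem exists_local_inverse_series {x₀ : M} {F : PowerSeries (SmoothFun n M)}
    (hF : ((PowerSeries.coeff 0 F : SmoothFun n M) : M → ℂ) x₀ ≠ 0) :
    ∃ S : PowerSeries (SmoothFun n M), ∀ᶠ x in 𝓝 x₀,
      PowerSeries.map (evalAt (n := n) x).toRingHom (F * S) = 1 := by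
  obtain ⟨g, hg⟩ := exists_local_inverse hF
  -- Near `x₀` the correction vanishes and `F'` equals `F * g`; globally its constant coefficient is
  -- exactly `1`, so it has an inverse series.
  let F' : PowerSeries (SmoothFun n M) :=
    F * PowerSeries.C g + PowerSeries.C (1 - PowerSeries.coeff 0 F * g)
  have hF' : PowerSeries.constantCoeff F' = ((1 : (SmoothFun n M)ˣ) : SmoothFun n M) := by
    simp [F']
  refine ⟨PowerSeries.C g * PowerSeries.invOfUnit F' 1, ?_⟩
  filter_upwards [hg] with x hx
  have h1 : PowerSeries.map (evalAt (n := n) x).toRingHom F'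
      = PowerSeries.map (evalAt (n := n) x).toRingHom (F * PowerSeries.C g) := by
    have h2 : (evalAt (n := n) x).toRingHom (1 - PowerSeries.coeff 0 F * g) = 0 := by
      rw [map_sub, map_one, map_mul, sub_eq_zero]
      exact hx.symm
    rw [map_add, PowerSeries.map_C, h2, map_zero, add_zero]
  rw [← mul_assoc, map_mul, ← h1, ← map_mul, PowerSeries.mul_invOfUnit _ _ hF', map_one]

/-- The coefficients of `ρ` with respect to the frame. -/
def densitySeries (x₀ : M) (ρ : ℕ → TopForm n M) : PowerSeries (SmoothFun n M) :=
  PowerSeries.mk fun k => density x₀ (ρ k)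

@[simp] theorem coeff_densitySeries (x₀ : M) (ρ : ℕ → TopForm n M) (k : ℕ) :
    PowerSeries.coeff k (densitySeries x₀ ρ) = density x₀ (ρ k) := PowerSeries.coeff_mk _ _

theorem form_eq_smul {x₀ x : M} (hx : x ∈ frameDomain n x₀) :
    ∃ d : (Fin n → TangentSpace (𝓡 n) x) → ℂ, ∀ (σ : TopForm n M) u,
      σ.form x u = d u * (density x₀ σ : M → ℂ) x := by
  obtain ⟨b, hb, -⟩ := exists_basis_frame hx
  refine ⟨fun u => ((Matrix.of fun i j => b.repr (u i) j).det : ℝ), fun σ u => ?_⟩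
  rw [AlternatingMap.eq_det_smul b, Complex.real_smul]
  have h1 : (b : Fin n → TangentSpace (𝓡 n) x) = fun i => frame x₀ i x := funext hb
  rw [h1]
  rfl

theorem density_ne_zero {x₀ : M} {σ : TopForm n M} (h : σ.form x₀ ≠ 0) :
    (density x₀ σ : M → ℂ) x₀ ≠ 0 := by
  obtain ⟨d, hd⟩ := form_eq_smul (mem_frameDomain n x₀)
  intro h0
  refine h (AlternatingMap.ext fun u => ?_)
  rw [hd, h0, mul_zero]
  rfl

/-- The divergence of `∂ₖ` is `(∂ₖ r) / r` for the density `r`. Existence of a representative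
matters: without it the integration by parts condition for this field would be vacuous in the
uniqueness argument. -/
theorem exists_isDivergence_frame {x₀ : M} {ρ : ℕ → TopForm n M} (hρ : (ρ 0).form x₀ ≠ 0)
    (k : Fin n) : ∃ g, IsDivergence x₀ ρ (frame x₀ k) g := by
  obtain ⟨S, hS⟩ := exists_local_inverse_series (F := densitySeries x₀ ρ)
    (x₀ := x₀) (by simpa using density_ne_zero hρ)
  refine ⟨vfSeries (frame x₀ k) (densitySeries x₀ ρ) * S, ?_⟩
  filter_upwards [hS, frameDomain_mem_nhds n x₀] with x hx hxU m w
  have h1 : PowerSeries.map (evalAt (n := n) x).toRingHom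
      (vfSeries (frame x₀ k) (densitySeries x₀ ρ) * S * densitySeries x₀ ρ)
      = PowerSeries.map (evalAt (n := n) x).toRingHom
        (vfSeries (frame x₀ k) (densitySeries x₀ ρ)) := by
    rw [mul_assoc, mul_comm S, map_mul, hx, mul_one]
  have h2 := congrArg (PowerSeries.coeff m) h1
  rw [map_mul, PowerSeries.coeff_mul, PowerSeries.coeff_map, coeff_vfSeries] at h2
  rw [frame_lieDeriv hxU]
  simp_rw [form_apply hxU]
  rw [coeff_densitySeries] at h2
  refine Eq.trans ?_ (congrArg _ h2)
  rw [Finset.mul_sum]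
  refine Finset.sum_congr rfl fun p _ => ?_
  rw [PowerSeries.coeff_map, PowerSeries.coeff_map, coeff_densitySeries]
  change _ = _ * (((PowerSeries.coeff p.1 _ : SmoothFun n M) : M → ℂ) x
    * (density x₀ (ρ p.2) : M → ℂ) x)
  ring

theorem exists_isLogDerivative {x₀ : M} {ρ : ℕ → TopForm n M} (hρ : (ρ 0).form x₀ ≠ 0) :
    ∃ g, IsLogDerivative x₀ ρ g := by
  obtain ⟨S, hS⟩ := exists_local_inverse_series (F := densitySeries x₀ ρ)
    (x₀ := x₀) (by simpa using density_ne_zero hρ)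
  refine ⟨PowerSeries.derivative (SmoothFun n M) (densitySeries x₀ ρ) * S, ?_⟩
  filter_upwards [hS, frameDomain_mem_nhds n x₀] with x hx hxU m
  obtain ⟨d, hd⟩ := form_eq_smul hxU
  have h1 : PowerSeries.map (evalAt (n := n) x).toRingHom
      (PowerSeries.derivative (SmoothFun n M) (densitySeries x₀ ρ) * S * densitySeries x₀ ρ)
      = PowerSeries.map (evalAt (n := n) x).toRingHom
        (PowerSeries.derivative (SmoothFun n M) (densitySeries x₀ ρ)) := by
    rw [mul_assoc, mul_comm S, map_mul, hx, mul_one]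
  have h2 := congrArg (PowerSeries.coeff m) h1
  rw [map_mul, PowerSeries.coeff_mul, PowerSeries.coeff_map, PowerSeries.coeff_derivative,
    coeff_densitySeries] at h2
  refine AlternatingMap.ext fun u => ?_
  simp only [AlternatingMap.finset_sum_apply, AlternatingMap.smul_apply, hd, smul_eq_mul]
  have h3 : ((m : ℂ) + 1) * (d u * (density x₀ (ρ (m + 1)) : M → ℂ) x)
      = d u * ((evalAt (n := n) x).toRingHom
          (density x₀ (ρ (m + 1)) * ((m : SmoothFun n M) + 1))) := by
    simp only [map_mul, map_add, map_natCast, map_one]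
    change _ = d u * ((density x₀ (ρ (m + 1)) : M → ℂ) x * _)
    ring
  rw [h3, ← h2, Finset.mul_sum]
  refine Finset.sum_congr rfl fun p _ => ?_
  rw [PowerSeries.coeff_map, PowerSeries.coeff_map, coeff_densitySeries]
  change _ = _ * (((PowerSeries.coeff p.1 _ : SmoothFun n M) : M → ℂ) x
    * (density x₀ (ρ p.2) : M → ℂ) x)
  ring

/-- Testing the definition on the frame alone gives `g r = ∑ ∂ᵢ(vᵢ r)` near `x₀`, the form in which
the divergence enters the formal integral. -/
theorem IsDivergence.coeff_mul {x₀ : M} {ρ : ℕ → TopForm n M} {v : SmoothVF n M}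
    {g : PowerSeries (SmoothFun n M)} (h : IsDivergence x₀ ρ v g) (m : ℕ) :
    PowerSeries.coeff m (g * densitySeries x₀ ρ)
      - ∑ i, vfApply (frame x₀ i) (coord x₀ v i * density x₀ (ρ m)) ∈ germIdeal n x₀ := by
  rw [sub_mem_germIdeal]
  filter_upwards [h, frameDomain_mem_nhds n x₀] with x hx hxU
  have := hx m (frame x₀)
  rw [lieDeriv_frame hxU] at this
  refine Eq.trans ?_ this
  rw [PowerSeries.coeff_mul, smoothFun_sum_apply]
  refine Finset.sum_congr rfl fun p _ => ?_
  rw [coeff_densitySeries]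
  rfl

theorem IsLogDerivative.coeff_mul {x₀ : M} {ρ : ℕ → TopForm n M}
    {g : PowerSeries (SmoothFun n M)} (h : IsLogDerivative x₀ ρ g) (m : ℕ) :
    PowerSeries.coeff m (g * densitySeries x₀ ρ)
      - PowerSeries.coeff m (PowerSeries.derivative (SmoothFun n M) (densitySeries x₀ ρ))
        ∈ germIdeal n x₀ := by
  rw [sub_mem_germIdeal]
  filter_upwards [h, frameDomain_mem_nhds n x₀] with x hx hxU
  have := congrArg (fun f => f (fun i => frame x₀ i x)) (hx m)
  simp only [AlternatingMap.finset_sum_apply, AlternatingMap.smul_apply, smul_eq_mul] at this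
  rw [PowerSeries.coeff_derivative, PowerSeries.coeff_mul, smoothFun_sum_apply]
  refine Eq.trans ?_ (this.trans ?_)
  · refine Finset.sum_congr rfl fun p _ => ?_
    rw [coeff_densitySeries]
    rfl
  · rw [coeff_densitySeries, mul_comm]
    change _ = (density x₀ (ρ (m + 1)) : M → ℂ) x * evalAt x ((m : SmoothFun n M) + 1)
    simp only [map_add, map_natCast, map_one]
    rfl

end Division

/-! ### Derivations of formal power series -/

section SeriesDerivation

variable {R B : Type*} [CommRing R] [CommRing B] [Algebra R B]

/-- A derivation of `B`, applied to the coefficients of formal power series. -/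
def seriesDer (D : Derivation R B B) : Derivation R (PowerSeries B) (PowerSeries B) :=
  Derivation.mk'
    { toFun := fun F => PowerSeries.mk fun k => D (PowerSeries.coeff k F)
      map_add' := fun F G => by ext k; simp
      map_smul' := fun c F => by
        ext k
        simp only [PowerSeries.coeff_mk, RingHom.id_apply]
        rw [PowerSeries.coeff_smul, PowerSeries.coeff_smul, D.map_smul, PowerSeries.coeff_mk] }
    fun F G => by
      ext k
      simp only [LinearMap.coe_mk, AddHom.coe_mk, PowerSeries.coeff_mk, smul_eq_mul, map_add,
        PowerSeries.coeff_mul, map_sum, D.leibniz, Finset.sum_add_distrib]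
      congr 1
      rw [← Finset.Nat.sum_antidiagonal_swap]
      simp

@[simp] theorem coeff_seriesDer (D : Derivation R B B) (F : PowerSeries B) (k : ℕ) :
    PowerSeries.coeff k (seriesDer D F) = D (PowerSeries.coeff k F) := by
  change PowerSeries.coeff k (PowerSeries.mk fun k => D (PowerSeries.coeff k F)) = _
  rw [PowerSeries.coeff_mk]

@[simp] theorem seriesDer_C (D : Derivation R B B) (b : B) :
    seriesDer D (PowerSeries.C b) = PowerSeries.C (D b) := by
  ext k
  rw [coeff_seriesDer, PowerSeries.coeff_C, PowerSeries.coeff_C]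
  split_ifs <;> simp

@[simp] theorem seriesDer_X (D : Derivation R B B) :
    seriesDer D (PowerSeries.X : PowerSeries B) = 0 := by
  ext k
  rw [coeff_seriesDer, PowerSeries.coeff_X]
  split_ifs <;> simp

theorem seriesDer_X_mul (D : Derivation R B B) (F : PowerSeries B) :
    seriesDer D (PowerSeries.X * F) = PowerSeries.X * seriesDer D F := by
  rw [Derivation.leibniz, seriesDer_X, smul_zero, add_zero, smul_eq_mul]

theorem seriesDer_X_pow_mul (D : Derivation R B B) (m : ℕ) (F : PowerSeries B) :
    seriesDer D (PowerSeries.X ^ m * F) = PowerSeries.X ^ m * seriesDer D F := by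
  induction m with
  | zero => simp
  | succ m ih => rw [pow_succ', mul_assoc, seriesDer_X_mul, ih, mul_assoc]

/-- The Euler operator `h d/dh` on formal power series in `h`. -/
def eulerSeries (B : Type*) [CommRing B] : Derivation B (PowerSeries B) (PowerSeries B) :=
  (PowerSeries.X : PowerSeries B) • PowerSeries.derivative B

theorem eulerSeries_apply (F : PowerSeries B) :
    eulerSeries B F = PowerSeries.X * PowerSeries.derivative B F := rfl

@[simp] theorem coeff_eulerSeries (F : PowerSeries B) (k : ℕ) :
    PowerSeries.coeff k (eulerSeries B F) = k * PowerSeries.coeff k F := by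
  rw [eulerSeries_apply]
  cases k with
  | zero => simp
  | succ k =>
    rw [PowerSeries.coeff_succ_X_mul, PowerSeries.coeff_derivative, mul_comm]
    push_cast
    rfl

end SeriesDerivation

/-! ### Algebraic Taylor expansion along a frame of derivations -/

section Taylor

/-- A frame of derivations at a point of a commutative algebra, which commute up to an ideal of
elements which are invisible at the point. -/
structure FormalFrame (n : ℕ) (A : Type*) [CommRing A] [Algebra ℂ A] where
  der : Fin n → Derivation ℂ A A
  ev : A →ₐ[ℂ] ℂ
  null : Ideal A
  der_mem : ∀ i, ∀ f ∈ null, der i f ∈ null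
  ev_null : ∀ f ∈ null, ev f = 0
  comm : ∀ i j f, der i (der j f) - der j (der i f) ∈ null

variable {n : ℕ} {A : Type*} [CommRing A] [Algebra ℂ A] (K : FormalFrame n A)

/-- The homogeneous part of degree `d` of the Taylor expansion. -/
def taylorCoeff : ℕ → A →ₗ[ℂ] MvPolynomial (Fin n) ℂ
  | 0 => (Algebra.linearMap ℂ (MvPolynomial (Fin n) ℂ)).comp K.ev.toLinearMap
  | d + 1 => ((d : ℂ) + 1)⁻¹ • ∑ i, (LinearMap.mulLeft ℂ (MvPolynomial.X i)).comp
      ((taylorCoeff d).comp (K.der i : A →ₗ[ℂ] A))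

theorem taylorCoeff_zero (f : A) : taylorCoeff K 0 f = MvPolynomial.C (K.ev f) := rfl

theorem taylorCoeff_succ (d : ℕ) (f : A) : taylorCoeff K (d + 1) f
    = ((d : ℂ) + 1)⁻¹ • ∑ i, MvPolynomial.X i * taylorCoeff K d (K.der i f) := by
  simp [taylorCoeff]

/-- Euler's identity for the homogeneous parts. It is the defining recursion without division, and
inductions on the degree rest on it. -/
theorem succ_smul_taylorCoeff_succ (d : ℕ) (f : A) : ((d : ℂ) + 1) • taylorCoeff K (d + 1) f
    = ∑ i, MvPolynomial.X i * taylorCoeff K d (K.der i f) := by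
  rw [taylorCoeff_succ, smul_smul, mul_inv_cancel₀ (Nat.cast_add_one_ne_zero d), one_smul]

theorem natCast_add_one_smul (d : ℕ) (p : MvPolynomial (Fin n) ℂ) :
    ((d : ℂ) + 1) • p = p * ((d : MvPolynomial (Fin n) ℂ) + 1) := by
  rw [MvPolynomial.smul_eq_C_mul, mul_comm]
  simp

theorem smul_left_cancel_succ {d : ℕ} {p q : MvPolynomial (Fin n) ℂ}
    (h : ((d : ℂ) + 1) • p = ((d : ℂ) + 1) • q) : p = q := by
  have := congrArg (fun r => ((d : ℂ) + 1)⁻¹ • r) h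
  simpa only [smul_smul, inv_mul_cancel₀ (Nat.cast_add_one_ne_zero (R := ℂ) d), one_smul] using this

theorem taylorCoeff_null (d : ℕ) : ∀ f ∈ K.null, taylorCoeff K d f = 0 := by
  induction d with
  | zero => intro f hf; rw [taylorCoeff_zero, K.ev_null f hf, map_zero]
  | succ d ih =>
    intro f hf
    rw [taylorCoeff_succ, Finset.sum_eq_zero fun i _ => by rw [ih _ (K.der_mem i f hf), mul_zero],
      smul_zero]

theorem pderiv_taylorCoeff_zero (i : Fin n) (f : A) :
    MvPolynomial.pderiv i (taylorCoeff K 0 f) = 0 := by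
  rw [taylorCoeff_zero, MvPolynomial.pderiv_C]

/-- Differentiating Euler's identity yields the term for `∂ᵢ f` itself and, by induction, `d` times
it once more; the latter needs that `∂ᵢ` and `∂ⱼ` commute modulo elements with zero expansion. -/
theorem pderiv_taylorCoeff_succ (d : ℕ) (i : Fin n) : ∀ f : A,
    MvPolynomial.pderiv i (taylorCoeff K (d + 1) f) = taylorCoeff K d (K.der i f) := by
  have h0 : ∀ d f, ∑ j, MvPolynomial.pderiv i (MvPolynomial.X j) * taylorCoeff K d (K.der j f)
      = taylorCoeff K d (K.der i f) := by
    intro d f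
    rw [Finset.sum_eq_single i]
    · simp
    · intro j _ hj
      rw [MvPolynomial.pderiv_X_of_ne hj, zero_mul]
    · simp
  induction d with
  | zero =>
    intro f
    rw [taylorCoeff_succ]
    simp only [Nat.cast_zero, zero_add, inv_one, one_smul, map_sum, Derivation.leibniz,
      pderiv_taylorCoeff_zero, smul_eq_mul]
    rw [← h0 0 f]
    exact Finset.sum_congr rfl fun j _ => by rw [mul_zero, zero_add, mul_comm]
  | succ d ih =>
    intro f
    apply smul_left_cancel_succ (d := d + 1)
    rw [← Derivation.map_smul, succ_smul_taylorCoeff_succ, map_sum]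
    simp only [Derivation.leibniz, smul_eq_mul, ih, Finset.sum_add_distrib]
    have h1 : ∀ j, taylorCoeff K d (K.der i (K.der j f)) = taylorCoeff K d (K.der j (K.der i f)) :=
      fun j => by rw [← sub_eq_zero, ← map_sub, taylorCoeff_null K d _ (K.comm i j f)]
    simp only [h1]
    rw [← succ_smul_taylorCoeff_succ]
    have h2 := h0 (d + 1) f
    simp_rw [mul_comm (MvPolynomial.pderiv i _)] at h2
    rw [h2]
    push_cast
    module

/-- The Taylor expansion, graded by the degree. -/
def taylor (f : A) : PowerSeries (MvPolynomial (Fin n) ℂ) :=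
  PowerSeries.mk fun d => taylorCoeff K d f

@[simp] theorem coeff_taylor (f : A) (d : ℕ) :
    PowerSeries.coeff d (taylor K f) = taylorCoeff K d f := PowerSeries.coeff_mk _ _

theorem taylor_add (f g : A) : taylor K (f + g) = taylor K f + taylor K g := by ext1 d; simp

theorem derivative_taylor (f : A) : PowerSeries.derivative _ (taylor K f)
    = ∑ i, PowerSeries.C (MvPolynomial.X i) * taylor K (K.der i f) := by
  ext1 d
  rw [PowerSeries.coeff_derivative, coeff_taylor, ← natCast_add_one_smul,
    succ_smul_taylorCoeff_succ, map_sum]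
  simp

/-- Induction on the degree: by `derivative_taylor` the coefficient of degree `d + 1` is governed by
expansions in degree `d` of first derivatives, where the Leibniz rule and the induction hypothesis
apply. -/
theorem taylor_mul (f g : A) : taylor K (f * g) = taylor K f * taylor K g := by
  ext1 d
  induction d generalizing f g with
  | zero =>
    rw [PowerSeries.coeff_mul, Finset.Nat.antidiagonal_zero, Finset.sum_singleton]
    simp only [coeff_taylor, taylorCoeff_zero, map_mul]
  | succ d ih =>
    have h : taylor K f * ∑ i, PowerSeries.C (MvPolynomial.X i) * taylor K (K.der i g)
        + taylor K g * ∑ i, PowerSeries.C (MvPolynomial.X i) * taylor K (K.der i f)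
        = ∑ i, PowerSeries.C (MvPolynomial.X i)
          * (taylor K f * taylor K (K.der i g) + taylor K g * taylor K (K.der i f)) := by
      rw [Finset.mul_sum, Finset.mul_sum, ← Finset.sum_add_distrib]
      exact Finset.sum_congr rfl fun i _ => by ring
    apply smul_left_cancel_succ (d := d)
    rw [natCast_add_one_smul, natCast_add_one_smul, ← PowerSeries.coeff_derivative,
      ← PowerSeries.coeff_derivative, Derivation.leibniz, derivative_taylor, derivative_taylor,
      derivative_taylor, smul_eq_mul, smul_eq_mul, h, map_sum, map_sum]
    refine Finset.sum_congr rfl fun i _ => ?_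
    rw [PowerSeries.coeff_C_mul, PowerSeries.coeff_C_mul, Derivation.leibniz, taylor_add,
      smul_eq_mul, smul_eq_mul, map_add, map_add, ih, ih]

theorem taylor_algebraMap (c : ℂ) :
    taylor K (algebraMap ℂ A c) = PowerSeries.C (MvPolynomial.C c) := by
  ext1 d
  cases d with
  | zero => simp [taylorCoeff_zero]
  | succ d => simp [taylorCoeff_succ]

theorem taylor_null {f : A} (hf : f ∈ K.null) : taylor K f = 0 := by
  ext1 d
  simp [taylorCoeff_null K d f hf]

theorem seriesDer_taylor (i : Fin n) (f : A) :
    seriesDer (MvPolynomial.pderiv i) (taylor K f) = PowerSeries.X * taylor K (K.der i f) := by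
  ext1 d
  cases d with
  | zero => simp [pderiv_taylorCoeff_zero]
  | succ d => simp [pderiv_taylorCoeff_succ, PowerSeries.coeff_succ_X_mul]

/-- The Euler vector field `∑ᵢ yᵢ ∂ᵢ`, applied to the coefficients of formal power series. -/
def eulerField (F : PowerSeries (MvPolynomial (Fin n) ℂ)) : PowerSeries (MvPolynomial (Fin n) ℂ) :=
  ∑ i, PowerSeries.C (MvPolynomial.X i) * seriesDer (MvPolynomial.pderiv i) F

theorem eulerField_add (F G : PowerSeries (MvPolynomial (Fin n) ℂ)) :
    eulerField (F + G) = eulerField F + eulerField G := by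
  simp [eulerField, mul_add, Finset.sum_add_distrib]

theorem eulerField_X_pow_mul (m : ℕ) (F : PowerSeries (MvPolynomial (Fin n) ℂ)) :
    eulerField (PowerSeries.X ^ m * F) = PowerSeries.X ^ m * eulerField F := by
  simp only [eulerField, seriesDer_X_pow_mul, Finset.mul_sum]
  exact Finset.sum_congr rfl fun i _ => by ring

/-- The grading variable `h` counts the degree in `y`, so `h d/dh` and `∑ yᵢ ∂ᵢ` agree on an
expansion of `f(hy)`. -/
theorem eulerSeries_taylor (f : A) : eulerSeries _ (taylor K f) = eulerField (taylor K f) := by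
  rw [eulerSeries_apply, derivative_taylor, eulerField, Finset.mul_sum]
  refine Finset.sum_congr rfl fun i _ => ?_
  rw [seriesDer_taylor]
  ring

end Taylor

/-! ### The substitution `x = h y`, `ν = h²` -/

section Rescaling

variable {n : ℕ} {A : Type*} [CommRing A] [Algebra ℂ A] (K : FormalFrame n A)

/-- A formal power series without its constant term, divided by the variable. -/
def shift {B : Type*} [Semiring B] (F : PowerSeries B) : PowerSeries B :=
  PowerSeries.mk fun k => PowerSeries.coeff (k + 1) F

theorem eq_C_add_X_mul_shift {B : Type*} [Semiring B] (F : PowerSeries B) :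
    F = PowerSeries.C (PowerSeries.coeff 0 F) + PowerSeries.X * shift F := by
  ext1 k
  cases k <;> simp [shift, PowerSeries.coeff_succ_X_mul]

/-- The expansion of a formal function under the substitution `x = h y`, `ν = h²`. -/
def rescale (F : PowerSeries A) : PowerSeries (MvPolynomial (Fin n) ℂ) :=
  PowerSeries.mk fun d => ∑ b ∈ Finset.range (d / 2 + 1),
    taylorCoeff K (d - 2 * b) (PowerSeries.coeff b F)

theorem rescale_add (F G : PowerSeries A) : rescale K (F + G) = rescale K F + rescale K G := by
  ext1 d
  simp [rescale, Finset.sum_add_distrib]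

theorem rescale_smul (c : ℂ) (F : PowerSeries A) : rescale K (c • F) = c • rescale K F := by
  ext1 d
  simp [rescale, Finset.smul_sum]

/-- Splitting off the `ν⁰` term costs a factor `h²`. Together with `series_eq_of_step` this reduces
identities for `rescale` to identities for `taylor`. -/
theorem rescale_C_add (f : A) (F : PowerSeries A) :
    rescale K (PowerSeries.C f + PowerSeries.X * F)
      = taylor K f + PowerSeries.X ^ 2 * rescale K F := by
  ext1 d
  rw [map_add, coeff_taylor, PowerSeries.coeff_X_pow_mul', rescale, PowerSeries.coeff_mk]
  rw [Finset.sum_range_succ']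
  simp only [map_add, PowerSeries.coeff_C, PowerSeries.coeff_succ_X_mul, Nat.succ_ne_zero, if_false,
    zero_add, PowerSeries.coeff_zero_X_mul, add_zero, mul_zero, Nat.sub_zero, if_true]
  rw [add_comm]
  congr 1
  split_ifs with h
  · obtain ⟨e, rfl⟩ := Nat.exists_eq_add_of_le' h
    rw [rescale, PowerSeries.coeff_mk, Nat.add_sub_cancel, Nat.add_div_right _ (by norm_num)]
    refine Finset.sum_congr rfl fun b _ => ?_
    rw [show e + 2 - 2 * (b + 1) = e - 2 * b by omega]
  · rw [Nat.div_eq_of_lt (by omega), Finset.sum_range_zero]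

theorem rescale_eq (F : PowerSeries A) : rescale K F
    = taylor K (PowerSeries.coeff 0 F) + PowerSeries.X ^ 2 * rescale K (shift F) := by
  conv_lhs => rw [eq_C_add_X_mul_shift F, rescale_C_add]

theorem taylor_zero : taylor K 0 = 0 := taylor_null K (Submodule.zero_mem _)

theorem rescale_X_mul (F : PowerSeries A) :
    rescale K (PowerSeries.X * F) = PowerSeries.X ^ 2 * rescale K F := by
  have := rescale_C_add K 0 F
  rwa [map_zero, zero_add, taylor_zero, zero_add] at this

theorem rescale_C (f : A) : rescale K (PowerSeries.C f) = taylor K f := by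
  have h0 : rescale K 0 = 0 := by ext1 d; simp [rescale]
  have := rescale_C_add K f 0
  rwa [mul_zero, add_zero, h0, mul_zero, add_zero] at this

/-- An equation between series follows from its preservation under one step of a recursion. -/
theorem series_eq_of_step {B S : Type*} [CommRing B] {L R : S → PowerSeries B}
    (σ : S → S) (h : ∀ F, L F - R F = PowerSeries.X ^ 2 * (L (σ F) - R (σ F))) (F : S) :
    L F = R F := by
  rw [← sub_eq_zero]
  ext1 d
  induction d using Nat.strong_induction_on generalizing F with
  | _ d ih =>
    rw [h, PowerSeries.coeff_X_pow_mul']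
    split_ifs with hd
    · rw [ih (d - 2) (by omega)]; simp
    · simp

theorem rescale_C_mul (f : A) (F : PowerSeries A) :
    rescale K (PowerSeries.C f * F) = taylor K f * rescale K F := by
  refine series_eq_of_step (L := fun F => rescale K (PowerSeries.C f * F))
    (R := fun F => taylor K f * rescale K F) shift (fun F => ?_) F
  have h : PowerSeries.C f * F = PowerSeries.C (f * PowerSeries.coeff 0 F)
      + PowerSeries.X * (PowerSeries.C f * shift F) := by
    conv_lhs => rw [eq_C_add_X_mul_shift F]
    rw [map_mul]
    ring
  simp only [h, rescale_C_add, taylor_mul]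
  rw [rescale_eq K F]
  ring

theorem rescale_mul (F G : PowerSeries A) : rescale K (F * G) = rescale K F * rescale K G := by
  refine series_eq_of_step (L := fun F => rescale K (F * G))
    (R := fun F => rescale K F * rescale K G) shift (fun F => ?_) F
  have h : F * G = PowerSeries.C (PowerSeries.coeff 0 F) * G + PowerSeries.X * (shift F * G) := by
    conv_lhs => rw [eq_C_add_X_mul_shift F]
    ring
  simp only [h, rescale_add, rescale_C_mul, rescale_X_mul]
  rw [rescale_eq K F]
  ring

theorem rescale_null {F : PowerSeries A} (hF : ∀ k, PowerSeries.coeff k F ∈ K.null) :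
    rescale K F = 0 := by
  ext1 d
  simp only [rescale, PowerSeries.coeff_mk, map_zero]
  exact Finset.sum_eq_zero fun b _ => taylorCoeff_null K _ _ (hF b)

theorem rescale_congr {F G : PowerSeries A}
    (h : ∀ k, PowerSeries.coeff k F - PowerSeries.coeff k G ∈ K.null) :
    rescale K F = rescale K G := by
  have h1 : F = G + (F - G) := by ring
  rw [h1, rescale_add, rescale_null K (F := F - G) (by simpa using h), add_zero]

/-- Chain rule: `∂/∂yᵢ` of `F(hy, h²)` is `h` times `(∂ᵢ F)(hy, h²)`. -/
theorem seriesDer_rescale (i : Fin n) (F : PowerSeries A) :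
    seriesDer (MvPolynomial.pderiv i) (rescale K F)
      = PowerSeries.X * rescale K (seriesDer (K.der i) F) := by
  refine series_eq_of_step (L := fun F => seriesDer (MvPolynomial.pderiv i) (rescale K F))
    (R := fun F => PowerSeries.X * rescale K (seriesDer (K.der i) F)) shift (fun F => ?_) F
  have h : shift (seriesDer (K.der i) F) = seriesDer (K.der i) (shift F) := by
    ext1 k; simp [shift]
  rw [rescale_eq K F, rescale_eq K (seriesDer (K.der i) F), map_add, seriesDer_taylor,
    seriesDer_X_pow_mul, coeff_seriesDer, h]
  ring

/-- Chain rule for `h d/dh` of `F(hy, h²)`: the space variables contribute the Euler field, and `ν =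
h²` contributes `2 ν d/dν`. -/
theorem eulerSeries_rescale (F : PowerSeries A) :
    eulerSeries _ (rescale K F)
      = eulerField (rescale K F) + 2 * rescale K (PowerSeries.X * PowerSeries.derivative A F) := by
  refine series_eq_of_step (L := fun F => eulerSeries _ (rescale K F))
    (R := fun F => eulerField (rescale K F)
      + 2 * rescale K (PowerSeries.X * PowerSeries.derivative A F)) shift (fun F => ?_) F
  have h1 : PowerSeries.derivative A F
      = shift F + PowerSeries.X * PowerSeries.derivative A (shift F) := by
    conv_lhs => rw [eq_C_add_X_mul_shift F]
    rw [map_add, PowerSeries.derivative_C, Derivation.leibniz, PowerSeries.derivative_X]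
    simp only [smul_eq_mul, mul_one, zero_add]
    ring
  have h2 : eulerSeries (MvPolynomial (Fin n) ℂ) (PowerSeries.X ^ 2 * rescale K (shift F))
      = PowerSeries.X ^ 2 * eulerSeries _ (rescale K (shift F))
        + 2 * PowerSeries.X ^ 2 * rescale K (shift F) := by
    rw [Derivation.leibniz, smul_eq_mul, smul_eq_mul, eulerSeries_apply (PowerSeries.X ^ 2),
      PowerSeries.derivative_pow, PowerSeries.derivative_X]
    push_cast
    ring
  rw [h1, rescale_eq K F, map_add, h2, eulerField_add, eulerField_X_pow_mul, eulerSeries_taylor]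
  simp only [rescale_X_mul, rescale_add]
  ring

end Rescaling

/-! ### Formal Gaussian functionals on polynomials -/

section Gaussian

open MvPolynomial in
theorem pderiv_pderiv_comm {R σ : Type*} [CommRing R] (i j : σ) (p : MvPolynomial σ R) :
    pderiv i (pderiv j p) = pderiv j (pderiv i p) := by
  classical
  have h : ⁅(pderiv i : Derivation R (MvPolynomial σ R) (MvPolynomial σ R)),
      (pderiv j : Derivation R (MvPolynomial σ R) (MvPolynomial σ R))⁆ = 0 := by
    refine MvPolynomial.derivation_ext fun k => ?_
    rw [Derivation.commutator_apply, pderiv_X, pderiv_X]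
    simp only [Pi.single_apply]
    split_ifs <;> simp
  have := congrArg (fun D : Derivation R _ _ => D p) h
  rwa [Derivation.commutator_apply, Derivation.coe_zero, Pi.zero_apply, sub_eq_zero] at this

variable {n : ℕ} (c : Matrix (Fin n) (Fin n) ℂ)

/-- The vector field `∑ⱼ cᵢⱼ ∂ⱼ` on polynomials. -/
def contract (i : Fin n) : MvPolynomial (Fin n) ℂ →ₗ[ℂ] MvPolynomial (Fin n) ℂ :=
  ∑ j, c i j • (MvPolynomial.pderiv (R := ℂ) j).toLinearMap

theorem contract_apply (i : Fin n) (p : MvPolynomial (Fin n) ℂ) :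
    contract c i p = ∑ j, c i j • MvPolynomial.pderiv j p := by
  simp [contract]

/-- The operator `½ ∑ᵢⱼ cᵢⱼ ∂ᵢ ∂ⱼ` on polynomials. -/
def gaussLaplacian : Module.End ℂ (MvPolynomial (Fin n) ℂ) :=
  (2⁻¹ : ℂ) • ∑ i, (contract c i).comp
    (MvPolynomial.pderiv (R := ℂ) i).toLinearMap

theorem gaussLaplacian_apply (p : MvPolynomial (Fin n) ℂ) :
    gaussLaplacian c p
      = (2⁻¹ : ℂ) • ∑ i, ∑ j, c i j • MvPolynomial.pderiv j (MvPolynomial.pderiv i p) := by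
  simp [gaussLaplacian, contract_apply]

theorem gaussLaplacian_contract (i : Fin n) (p : MvPolynomial (Fin n) ℂ) :
    gaussLaplacian c (contract c i p) = contract c i (gaussLaplacian c p) := by
  have h : ∀ k, gaussLaplacian c (MvPolynomial.pderiv k p)
      = MvPolynomial.pderiv k (gaussLaplacian c p) := by
    intro k
    rw [gaussLaplacian_apply, gaussLaplacian_apply, Derivation.map_smul, map_sum]
    congr 1
    refine Finset.sum_congr rfl fun a _ => ?_
    rw [map_sum]
    refine Finset.sum_congr rfl fun b _ => ?_
    rw [Derivation.map_smul, pderiv_pderiv_comm a k, pderiv_pderiv_comm b k]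
  rw [contract_apply, contract_apply, map_sum]
  exact Finset.sum_congr rfl fun j _ => by rw [map_smul, h]

theorem gaussLaplacian_pow_contract (k : ℕ) (i : Fin n) (p : MvPolynomial (Fin n) ℂ) :
    (gaussLaplacian c ^ k) (contract c i p) = contract c i ((gaussLaplacian c ^ k) p) := by
  induction k with
  | zero => rfl
  | succ k ih =>
    rw [pow_succ', Module.End.mul_apply, ih, gaussLaplacian_contract, Module.End.mul_apply]

variable {c}

/-- The commutator of the operator with `yᵢ` has two equal terms by the symmetry of `c`, which
cancels the factor `½`. -/
theorem gaussLaplacian_X_mul (hc : c.IsSymm) (i : Fin n) (p : MvPolynomial (Fin n) ℂ) :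
    gaussLaplacian c (MvPolynomial.X i * p)
      = MvPolynomial.X i * gaussLaplacian c p + contract c i p := by
  have h1 : ∀ a, MvPolynomial.pderiv a (MvPolynomial.X i * p)
      = MvPolynomial.X i * MvPolynomial.pderiv a p + (if a = i then p else 0) := by
    intro a
    rw [Derivation.leibniz, MvPolynomial.pderiv_X, smul_eq_mul, smul_eq_mul]
    simp only [Pi.single_apply, mul_ite, mul_one, mul_zero, eq_comm]
  have h2 : ∀ a b, MvPolynomial.pderiv b (MvPolynomial.pderiv a (MvPolynomial.X i * p))
      = MvPolynomial.X i * MvPolynomial.pderiv b (MvPolynomial.pderiv a p)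
        + (if b = i then MvPolynomial.pderiv a p else 0)
        + (if a = i then MvPolynomial.pderiv b p else 0) := by
    intro a b
    rw [h1, map_add, Derivation.leibniz, MvPolynomial.pderiv_X, smul_eq_mul, smul_eq_mul]
    simp only [Pi.single_apply, mul_ite, mul_one, mul_zero, apply_ite (MvPolynomial.pderiv b),
      map_zero, eq_comm]
  simp only [gaussLaplacian_apply, h2, smul_add, Finset.sum_add_distrib, smul_ite, smul_zero]
  rw [contract_apply]
  have h3 : ∑ x, ∑ y, (if y = i then c x y • MvPolynomial.pderiv x p else 0)
      = ∑ j, c i j • MvPolynomial.pderiv j p := by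
    refine Finset.sum_congr rfl fun x _ => ?_
    rw [Finset.sum_ite_eq' Finset.univ i, if_pos (Finset.mem_univ _), hc.apply]
  have h4 : ∑ x, ∑ y, (if x = i then c x y • MvPolynomial.pderiv y p else 0)
      = ∑ j, c i j • MvPolynomial.pderiv j p := by
    rw [Finset.sum_comm]
    refine Finset.sum_congr rfl fun x _ => ?_
    rw [Finset.sum_ite_eq' Finset.univ i, if_pos (Finset.mem_univ _)]
  rw [h3, h4, mul_smul_comm, Finset.mul_sum]
  simp only [Finset.mul_sum, mul_smul_comm]
  rw [add_assoc, ← smul_add, ← two_smul ℂ, smul_smul]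
  norm_num

theorem gaussLaplacian_pow_X_mul (hc : c.IsSymm) (k : ℕ) (i : Fin n)
    (p : MvPolynomial (Fin n) ℂ) :
    (gaussLaplacian c ^ (k + 1)) (MvPolynomial.X i * p)
      = MvPolynomial.X i * (gaussLaplacian c ^ (k + 1)) p
        + ((k : ℂ) + 1) • (gaussLaplacian c ^ k) (contract c i p) := by
  induction k with
  | zero => simp [gaussLaplacian_X_mul hc]
  | succ k ih =>
    have hp : ∀ m q, gaussLaplacian c ((gaussLaplacian c ^ m) q) = (gaussLaplacian c ^ (m + 1)) q :=
      fun m q => by rw [pow_succ', Module.End.mul_apply]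
    rw [← hp, ih, map_add, map_smul, gaussLaplacian_X_mul hc, hp, hp,
      ← gaussLaplacian_pow_contract]
    push_cast
    module

/-- Local nilpotency makes the exponential of the operator a finite sum on each polynomial. -/
theorem exists_gaussLaplacian_pow_eq_zero (hc : c.IsSymm) (p : MvPolynomial (Fin n) ℂ) :
    ∃ N, ∀ k ≥ N, (gaussLaplacian c ^ k) p = 0 := by
  induction p using MvPolynomial.induction_on with
  | C a =>
    refine ⟨1, fun k hk => ?_⟩
    obtain ⟨l, rfl⟩ := Nat.exists_eq_add_of_le' hk
    rw [pow_succ, Module.End.mul_apply, gaussLaplacian_apply]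
    simp
  | add p q hp hq =>
    obtain ⟨N, hN⟩ := hp
    obtain ⟨N', hN'⟩ := hq
    refine ⟨max N N', fun k hk => ?_⟩
    rw [map_add, hN k (le_of_max_le_left hk), hN' k (le_of_max_le_right hk), add_zero]
  | mul_X p i hp =>
    obtain ⟨N, hN⟩ := hp
    refine ⟨N + 1, fun k hk => ?_⟩
    obtain ⟨l, rfl⟩ : ∃ l, k = l + 1 := ⟨k - 1, by omega⟩
    rw [mul_comm, gaussLaplacian_pow_X_mul hc, hN _ (by omega), gaussLaplacian_pow_contract,
      hN _ (by omega)]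
    simp

theorem finite_support_gauss (hc : c.IsSymm) (p : MvPolynomial (Fin n) ℂ) :
    (Function.support fun k : ℕ =>
      ((k.factorial : ℂ)⁻¹ * MvPolynomial.constantCoeff ((gaussLaplacian c ^ k) p))).Finite := by
  obtain ⟨N, hN⟩ := exists_gaussLaplacian_pow_eq_zero hc p
  refine (Set.finite_lt_nat N).subset fun k hk => ?_
  by_contra h
  exact hk (by simp [hN k (not_lt.1 h)])

/-- The expectation of polynomials with respect to the formal Gaussian of covariance `c`. -/
def gauss (hc : c.IsSymm) : MvPolynomial (Fin n) ℂ →ₗ[ℂ] ℂ where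
  toFun p := ∑ᶠ k : ℕ,
    ((k.factorial : ℂ)⁻¹ * MvPolynomial.constantCoeff ((gaussLaplacian c ^ k) p))
  map_add' p q := by
    rw [← finsum_add_distrib (finite_support_gauss hc p) (finite_support_gauss hc q)]
    simp [mul_add]
  map_smul' a p := by
    rw [RingHom.id_apply, smul_eq_mul, mul_finsum'  _ _ (finite_support_gauss hc p)]
    refine finsum_congr fun k => ?_
    rw [map_smul, MvPolynomial.smul_eq_C_mul, map_mul, MvPolynomial.constantCoeff_C]
    ring

theorem gauss_eq_sum (hc : c.IsSymm) (p : MvPolynomial (Fin n) ℂ) :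
    ∃ N, ∀ m ≥ N, gauss hc p = ∑ k ∈ Finset.range m,
      ((k.factorial : ℂ)⁻¹ * MvPolynomial.constantCoeff ((gaussLaplacian c ^ k) p)) := by
  obtain ⟨N, hN⟩ := exists_gaussLaplacian_pow_eq_zero hc p
  refine ⟨N, fun m hm => finsum_eq_sum_of_support_subset _ fun k hk => ?_⟩
  by_contra h
  refine hk ?_
  have : m ≤ k := by simpa using h
  simp [hN k (hm.le.trans this)]

theorem gauss_C (hc : c.IsSymm) (a : ℂ) : gauss hc (MvPolynomial.C a) = a := by
  obtain ⟨N, hN⟩ := gauss_eq_sum hc (MvPolynomial.C a)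
  rw [hN (N + 1) (by omega), Finset.sum_range_succ', Finset.sum_eq_zero fun k _ => ?_]
  · simp
  · rw [pow_succ, Module.End.mul_apply, gaussLaplacian_apply]
    simp

/-- Wick's rule. Moving `yᵢ` to the left through the power `k + 1` of the operator leaves `k + 1`
copies of `contract c i`; the other term vanishes at the origin, and `(k + 1) / (k + 1)! = 1 / k!`.
-/
theorem gauss_X_mul (hc : c.IsSymm) (i : Fin n) (p : MvPolynomial (Fin n) ℂ) :
    gauss hc (MvPolynomial.X i * p) = gauss hc (contract c i p) := by
  obtain ⟨N, hN⟩ := gauss_eq_sum hc (MvPolynomial.X i * p)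
  obtain ⟨N', hN'⟩ := gauss_eq_sum hc (contract c i p)
  rw [hN (N + N' + 1) (by omega), hN' (N + N') (by omega), Finset.sum_range_succ']
  simp only [pow_zero, Module.End.one_apply, map_mul, MvPolynomial.constantCoeff_X, zero_mul,
    mul_zero, add_zero]
  refine Finset.sum_congr rfl fun k _ => ?_
  rw [gaussLaplacian_pow_X_mul hc, map_add, map_mul, MvPolynomial.constantCoeff_X, zero_mul,
    zero_add, MvPolynomial.smul_eq_C_mul, map_mul, MvPolynomial.constantCoeff_C,
    Nat.factorial_succ]
  push_cast
  have := Nat.cast_add_one_ne_zero (R := ℂ) k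
  field_simp

/-- Integration by parts for a formal Gaussian with a nondegenerate exponent. -/
theorem exists_gauss {h : Matrix (Fin n) (Fin n) ℂ} (hs : h.IsSymm) (hdet : IsUnit h.det) :
    ∃ G : MvPolynomial (Fin n) ℂ →ₗ[ℂ] ℂ, (∀ a, G (MvPolynomial.C a) = a) ∧ ∀ i p,
      G (MvPolynomial.pderiv i p + (∑ j, MvPolynomial.C (h i j) * MvPolynomial.X j) * p) = 0 := by
  -- The weight is `exp(½ ∑ hᵢⱼ yᵢ yⱼ)`, without a minus sign in the exponent, so the covariance is
  -- `-h⁻¹`.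
  have hc : (-h⁻¹).IsSymm := by
    rw [Matrix.IsSymm, Matrix.transpose_neg, Matrix.transpose_nonsing_inv, hs.eq]
  refine ⟨gauss hc, gauss_C hc, fun i p => ?_⟩
  rw [Finset.sum_mul, map_add, map_sum]
  have h1 : ∀ j, gauss hc (MvPolynomial.C (h i j) * MvPolynomial.X j * p)
      = ∑ l, h i j * (-h⁻¹) j l * gauss hc (MvPolynomial.pderiv l p) := by
    intro j
    rw [mul_assoc, ← MvPolynomial.smul_eq_C_mul, map_smul, gauss_X_mul, contract_apply, map_sum,
      smul_eq_mul, Finset.mul_sum]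
    exact Finset.sum_congr rfl fun l _ => by rw [map_smul, smul_eq_mul, mul_assoc]
  simp only [h1]
  rw [Finset.sum_comm]
  simp only [← Finset.sum_mul]
  have h2 : ∀ l, ∑ j, h i j * (-h⁻¹) j l = - (1 : Matrix (Fin n) (Fin n) ℂ) i l := by
    intro l
    rw [← Matrix.mul_apply, Matrix.mul_neg, Matrix.mul_nonsing_inv _ hdet, Matrix.neg_apply]
  simp only [h2, Matrix.one_apply]
  simp

end Gaussian

/-! ### Exponentials of formal power series -/

section Exponential

variable {n : ℕ}

/-- Uniqueness for a linear first-order equation, read off the coefficient recursion. It identifies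
the `y`-derivatives of the exponential from its `h`-derivative. -/
theorem eq_zero_of_derivative_eq_mul {D Z : PowerSeries (MvPolynomial (Fin n) ℂ)}
    (h0 : PowerSeries.coeff 0 D = 0) (h : PowerSeries.derivative _ D = D * Z) : D = 0 := by
  ext1 d
  induction d using Nat.strong_induction_on with
  | _ d ih =>
    cases d with
    | zero => rw [h0, map_zero]
    | succ d =>
      apply smul_left_cancel_succ (d := d)
      rw [natCast_add_one_smul, ← PowerSeries.coeff_derivative, h, PowerSeries.coeff_mul, map_zero,
        smul_zero]
      refine Finset.sum_eq_zero fun p hp => ?_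
      have := Finset.HasAntidiagonal.mem_antidiagonal.1 hp
      rw [ih p.1 (by omega), map_zero, zero_mul]

theorem derivative_seriesDer {B : Type*} [CommRing B] [Algebra ℂ B] (D : Derivation ℂ B B)
    (F : PowerSeries B) : PowerSeries.derivative B (seriesDer D F)
      = seriesDer D (PowerSeries.derivative B F) := by
  ext1 k
  rw [PowerSeries.coeff_derivative, coeff_seriesDer, coeff_seriesDer, PowerSeries.coeff_derivative,
    Derivation.leibniz]
  have : D ((k : B) + 1) = 0 := by simp
  rw [this, smul_zero, zero_add, smul_eq_mul, mul_comm]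

/-- The exponential of a formal power series without its constant term. -/
theorem exists_exp (S : PowerSeries (MvPolynomial (Fin n) ℂ)) :
    ∃ W : PowerSeries (MvPolynomial (Fin n) ℂ), PowerSeries.coeff 0 W = 1 ∧
      PowerSeries.derivative _ W = W * PowerSeries.derivative _ S ∧
      ∀ i, seriesDer (MvPolynomial.pderiv i) W = W * (seriesDer (MvPolynomial.pderiv i) S
        - PowerSeries.C (MvPolynomial.pderiv i (PowerSeries.coeff 0 S))) := by
  obtain ⟨W, h0, h1⟩ : ∃ W : PowerSeries (MvPolynomial (Fin n) ℂ), PowerSeries.coeff 0 W = 1 ∧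
      PowerSeries.derivative _ W = W * PowerSeries.derivative _ S := by
    -- Substitution into `exp` requires a zero constant term. The removed `S₀` is not lost: its
    -- quadratic part is the exponent of the Gaussian functional.
    let S' := S - PowerSeries.C (PowerSeries.coeff 0 S)
    have hz : PowerSeries.constantCoeff S' = 0 := by simp [S']
    have hS : PowerSeries.HasSubst S' := PowerSeries.HasSubst.of_constantCoeff_zero' hz
    refine ⟨(PowerSeries.exp (MvPolynomial (Fin n) ℂ)).subst S', ?_, ?_⟩
    · have h : PowerSeries.exp (MvPolynomial (Fin n) ℂ)
          = (PowerSeries.exp (MvPolynomial (Fin n) ℂ) - 1) + 1 := by ring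
      have h1 := PowerSeries.constantCoeff_subst_eq_zero (a := S') hz
        (PowerSeries.exp (MvPolynomial (Fin n) ℂ) - 1) (by simp)
      rw [h, ← PowerSeries.coe_substAlgHom hS, map_add, map_one, PowerSeries.coe_substAlgHom hS,
        PowerSeries.coeff_zero_eq_constantCoeff, map_add, map_one]
      exact (congrArg (· + 1) h1).trans (zero_add 1)
    · rw [PowerSeries.derivative_subst hS, PowerSeries.derivative_exp, map_sub,
        PowerSeries.derivative_C, sub_zero]
  refine ⟨W, h0, h1, fun i => ?_⟩
  rw [← sub_eq_zero]
  -- The difference of the two sides solves `D' = D S'`, with `S'` the derivative of `S`, and has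
  -- zero constant term.
  refine eq_zero_of_derivative_eq_mul (Z := PowerSeries.derivative _ S) ?_ ?_
  · rw [map_sub, coeff_seriesDer, h0, PowerSeries.coeff_mul, Finset.Nat.antidiagonal_zero,
      Finset.sum_singleton, h0, map_sub, coeff_seriesDer, PowerSeries.coeff_C, if_pos rfl]
    simp
  · rw [map_sub, derivative_seriesDer, h1, Derivation.leibniz, Derivation.leibniz, map_sub,
      PowerSeries.derivative_C, derivative_seriesDer, h1]
    simp only [smul_eq_mul]
    ring

end Exponential

/-! ### The formal integral with weight `exp S` and its identities -/

section FormalIntegral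

variable {n : ℕ} {A : Type*} [CommRing A] [Algebra ℂ A] (K : FormalFrame n A)

/-- A linear functional, applied to the coefficients of even degree of a formal power series. -/
def evenFunctional {V : Type*} [CommRing V] [Algebra ℂ V] (G : V →ₗ[ℂ] ℂ) :
    PowerSeries V →ₗ[ℂ] PowerSeries ℂ where
  toFun F := PowerSeries.mk fun k => G (PowerSeries.coeff (2 * k) F)
  map_add' F F' := by ext1 k; simp
  map_smul' a F := by
    ext1 k
    simp only [RingHom.id_apply, PowerSeries.coeff_mk, PowerSeries.coeff_smul]
    exact G.map_smul _ _

theorem coeff_evenFunctional {V : Type*} [CommRing V] [Algebra ℂ V] (G : V →ₗ[ℂ] ℂ)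
    (F : PowerSeries V) (k : ℕ) :
    PowerSeries.coeff k (evenFunctional G F) = G (PowerSeries.coeff (2 * k) F) := by
  change PowerSeries.coeff k (PowerSeries.mk fun k => G (PowerSeries.coeff (2 * k) F)) = _
  rw [PowerSeries.coeff_mk]

theorem evenFunctional_X_sq_mul {V : Type*} [CommRing V] [Algebra ℂ V] (G : V →ₗ[ℂ] ℂ)
    (F : PowerSeries V) :
    evenFunctional G (PowerSeries.X ^ 2 * F) = PowerSeries.X * evenFunctional G F := by
  ext1 k
  rw [coeff_evenFunctional, PowerSeries.coeff_X_pow_mul']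
  cases k with
  | zero => simp
  | succ k =>
    rw [if_pos (by omega), PowerSeries.coeff_succ_X_mul, coeff_evenFunctional]
    congr 2

/-- On the coefficient of `h^(2k) = ν^k`, `h d/dh` is multiplication by `2k`, that is, `2 ν d/dν`.
-/
theorem evenFunctional_eulerSeries {V : Type*} [CommRing V] [Algebra ℂ V] (G : V →ₗ[ℂ] ℂ)
    (F : PowerSeries V) :
    evenFunctional G (eulerSeries V F) = 2 * eulerSeries ℂ (evenFunctional G F) := by
  ext1 k
  have h2 : (2 : PowerSeries ℂ) = PowerSeries.C 2 := (map_ofNat PowerSeries.C 2).symm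
  rw [coeff_evenFunctional, coeff_eulerSeries, h2, PowerSeries.coeff_C_mul, coeff_eulerSeries,
    coeff_evenFunctional]
  have h3 : ((2 * k : ℕ) : V) * PowerSeries.coeff (2 * k) F
      = ((2 * k : ℕ) : ℂ) • PowerSeries.coeff (2 * k) F := by
    rw [Algebra.smul_def, map_natCast]
  rw [h3, map_smul, smul_eq_mul]
  push_cast
  ring

/-- The formal Gaussian integral with weight `exp S`, where the leading term of `S` is a
nondegenerate quadratic form. -/
theorem exists_weightedGauss {h : Matrix (Fin n) (Fin n) ℂ} (hs : h.IsSymm) (hdet : IsUnit h.det)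
    (S : PowerSeries (MvPolynomial (Fin n) ℂ))
    (hS : ∀ i, MvPolynomial.pderiv i (PowerSeries.coeff 0 S)
      = ∑ j, MvPolynomial.C (h i j) * MvPolynomial.X j) :
    ∃ I : PowerSeries (MvPolynomial (Fin n) ℂ) →ₗ[ℂ] PowerSeries ℂ,
      (∀ Y, I (PowerSeries.X ^ 2 * Y) = PowerSeries.X * I Y) ∧
      (∀ i Y, I (seriesDer (MvPolynomial.pderiv i) Y
        + seriesDer (MvPolynomial.pderiv i) S * Y) = 0) ∧
      (∀ Y, I (eulerSeries _ Y + eulerSeries _ S * Y) = 2 * eulerSeries ℂ (I Y)) ∧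
      (∀ a Y, PowerSeries.coeff 0 Y = MvPolynomial.C a → PowerSeries.coeff 0 (I Y) = a) ∧
      (∀ Y k, ∃ m : ℕ → (MvPolynomial (Fin n) ℂ →ₗ[ℂ] ℂ), ∀ T,
        PowerSeries.coeff k (I (Y * T))
          = ∑ b ∈ Finset.range (2 * k + 1), m b (PowerSeries.coeff b T)) := by
  obtain ⟨G, hGC, hG⟩ := exists_gauss hs hdet
  obtain ⟨W, hW0, hW1, hW2⟩ := exists_exp S
  have hI : ∀ k Y, PowerSeries.coeff k ((evenFunctional G ∘ₗ LinearMap.mulLeft ℂ W) Y)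
      = G (PowerSeries.coeff (2 * k) (W * Y)) := fun k Y => coeff_evenFunctional _ _ _
  refine ⟨evenFunctional G ∘ₗ LinearMap.mulLeft ℂ W, fun Y => ?_, fun i Y => ?_, fun Y => ?_,
    fun a Y hY => ?_, fun Y k => ?_⟩
  · rw [LinearMap.comp_apply, LinearMap.comp_apply, LinearMap.mulLeft_apply,
      LinearMap.mulLeft_apply, ← evenFunctional_X_sq_mul, mul_left_comm]
  · have h1 : W * (seriesDer (MvPolynomial.pderiv i) Y + seriesDer (MvPolynomial.pderiv i) S * Y)
        = seriesDer (MvPolynomial.pderiv i) (W * Y)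
          + PowerSeries.C (MvPolynomial.pderiv i (PowerSeries.coeff 0 S)) * (W * Y) := by
      rw [Derivation.leibniz, hW2, smul_eq_mul, smul_eq_mul]
      ring
    ext1 k
    rw [hI, h1, map_add, coeff_seriesDer, PowerSeries.coeff_C_mul, hS, map_zero]
    exact hG i _
  · rw [LinearMap.comp_apply, LinearMap.comp_apply, LinearMap.mulLeft_apply,
      LinearMap.mulLeft_apply, ← evenFunctional_eulerSeries, Derivation.leibniz, smul_eq_mul,
      smul_eq_mul, eulerSeries_apply W, hW1, eulerSeries_apply S]
    congr 1
    ring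
  · rw [hI, mul_zero, PowerSeries.coeff_mul, Finset.Nat.antidiagonal_zero, Finset.sum_singleton,
      hW0, one_mul, hY, hGC]
  · refine ⟨fun b => G ∘ₗ LinearMap.mulLeft ℂ (PowerSeries.coeff (2 * k - b) (W * Y)),
      fun T => ?_⟩
    rw [hI, ← mul_assoc, mul_comm (W * Y), PowerSeries.coeff_mul,
      Finset.Nat.sum_antidiagonal_eq_sum_range_succ_mk, map_sum]
    refine Finset.sum_congr rfl fun b _ => ?_
    rw [LinearMap.comp_apply, LinearMap.mulLeft_apply, mul_comm]

/-- Write `yᵢ ∂ᵢ` as `∂ᵢ yᵢ - 1`: the total derivatives integrate to zero and `-n` remains. This is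
the source of the term `n / (2ν)`. -/
theorem apply_eulerField {V : Type*} [AddCommGroup V] [Module ℂ V]
    (I : PowerSeries (MvPolynomial (Fin n) ℂ) →ₗ[ℂ] V) (S : PowerSeries (MvPolynomial (Fin n) ℂ))
    (hI : ∀ i Y, I (seriesDer (MvPolynomial.pderiv i) Y
        + seriesDer (MvPolynomial.pderiv i) S * Y) = 0)
    (Y : PowerSeries (MvPolynomial (Fin n) ℂ)) :
    I (eulerField Y + eulerField S * Y) = -((n : ℂ) • I Y) := by
  have h1 : eulerField Y + eulerField S * Y
      = ∑ i : Fin n, (seriesDer (MvPolynomial.pderiv i) (PowerSeries.C (MvPolynomial.X i) * Y)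
        + seriesDer (MvPolynomial.pderiv i) S * (PowerSeries.C (MvPolynomial.X i) * Y) - Y) := by
    rw [eulerField, eulerField, Finset.sum_mul, ← Finset.sum_add_distrib]
    refine Finset.sum_congr rfl fun i _ => ?_
    rw [Derivation.leibniz, seriesDer_C, MvPolynomial.pderiv_X_self, map_one, smul_eq_mul,
      smul_eq_mul]
    ring
  rw [h1, map_sum]
  simp only [map_sub, hI, zero_sub, Finset.sum_const, Finset.card_univ, Fintype.card_fin]
  rw [smul_neg, Nat.cast_smul_eq_nsmul]

/-- The rescaling of a phase with a critical point of value zero is divisible by the square of the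
variable. -/
theorem exists_rescale_eq_X_sq_mul (Φ : PowerSeries A)
    (h0 : K.ev (PowerSeries.coeff 0 Φ) = 0)
    (h1 : ∀ i, K.ev (K.der i (PowerSeries.coeff 0 Φ)) = 0) :
    ∃ S, PowerSeries.X ^ 2 * S = rescale K Φ ∧ ∀ i, MvPolynomial.pderiv i (PowerSeries.coeff 0 S)
      = ∑ j, MvPolynomial.C (K.ev (K.der i (K.der j (PowerSeries.coeff 0 Φ))))
        * MvPolynomial.X j := by
  refine ⟨PowerSeries.mk fun d => PowerSeries.coeff (d + 2) (rescale K Φ), ?_, fun i => ?_⟩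
  · ext1 d
    rw [PowerSeries.coeff_X_pow_mul']
    rcases Nat.lt_or_ge d 2 with hd | hd
    · rw [if_neg (by omega), rescale, PowerSeries.coeff_mk, Nat.div_eq_of_lt hd,
        Finset.sum_range_one, mul_zero, Nat.sub_zero]
      interval_cases d
      · rw [taylorCoeff_zero, h0, map_zero]
      · rw [taylorCoeff_succ]
        simp only [taylorCoeff_zero, h1, map_zero, mul_zero, Finset.sum_const_zero, smul_zero]
    · rw [if_pos hd, PowerSeries.coeff_mk, Nat.sub_add_cancel hd]
  -- The coefficient of `h²` is the quadratic part of `Φ₀` plus the constant `Φ₁(x₀)`, which the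
  -- derivative kills.
  · rw [PowerSeries.coeff_mk, rescale, PowerSeries.coeff_mk, zero_add, Nat.div_self two_pos,
      Finset.sum_range_succ, Finset.sum_range_one, mul_zero, Nat.sub_zero, mul_one, Nat.sub_self,
      map_add, pderiv_taylorCoeff_succ, pderiv_taylorCoeff_zero, add_zero, taylorCoeff_succ]
    simp only [Nat.cast_zero, zero_add, inv_one, one_smul, taylorCoeff_zero]
    refine Finset.sum_congr rfl fun j _ => ?_
    rw [mul_comm]
    congr 2
    rw [← sub_eq_zero, ← map_sub, K.ev_null _ (K.comm j i _)]

/-- The chain rule for `h² S`: the term `2 h² S` from differentiating `h²` turns `νΦ'` into `νΦ' - Φ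
= ν² φ'`. -/
theorem X_sq_mul_eulerSeries (Φ : PowerSeries A) (S : PowerSeries (MvPolynomial (Fin n) ℂ))
    (hS : PowerSeries.X ^ 2 * S = rescale K Φ) :
    PowerSeries.X ^ 2 * eulerSeries _ S = PowerSeries.X ^ 2 * eulerField S
      + 2 * rescale K (PowerSeries.X * PowerSeries.derivative A Φ - Φ) := by
  have h3 := eulerSeries_rescale K Φ
  rw [← hS, eulerField_X_pow_mul, Derivation.leibniz, smul_eq_mul, smul_eq_mul,
    eulerSeries_apply (PowerSeries.X ^ 2), PowerSeries.derivative_pow,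
    PowerSeries.derivative_X] at h3
  have h4 : rescale K (PowerSeries.X * PowerSeries.derivative A Φ)
      = rescale K (PowerSeries.X * PowerSeries.derivative A Φ - Φ) + PowerSeries.X ^ 2 * S := by
    rw [hS, ← rescale_add, sub_add_cancel]
  rw [h4] at h3
  generalize eulerSeries (MvPolynomial (Fin n) ℂ) S = a at *
  generalize eulerField S = b at *
  generalize rescale K (PowerSeries.X * PowerSeries.derivative A Φ - Φ) = c at *
  push_cast at h3
  linear_combination h3

theorem rescale_eulerPhase (Ψ Z : PowerSeries A) :
    rescale K ((2 * Ψ - (n : PowerSeries A) * PowerSeries.X) * Z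
        + 2 * PowerSeries.X ^ 2 * PowerSeries.derivative A Z)
      = 2 * (rescale K Ψ * rescale K Z)
        + 2 * (PowerSeries.X ^ 2 * rescale K (PowerSeries.X * PowerSeries.derivative A Z))
        - (n : ℂ) • (PowerSeries.X ^ 2 * rescale K Z) := by
  have hn : rescale K ((n : ℂ) • (PowerSeries.X * Z))
      = (n : ℂ) • (PowerSeries.X ^ 2 * rescale K Z) := by
    rw [← rescale_X_mul, ← rescale_smul]
  have h1 : (2 * Ψ - (n : PowerSeries A) * PowerSeries.X) * Z
        + 2 * PowerSeries.X ^ 2 * PowerSeries.derivative A Z + (n : ℂ) • (PowerSeries.X * Z)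
      = (Ψ * Z + Ψ * Z)
        + (PowerSeries.X * (PowerSeries.X * PowerSeries.derivative A Z)
          + PowerSeries.X * (PowerSeries.X * PowerSeries.derivative A Z)) := by
    rw [Algebra.smul_def, map_natCast]
    ring
  rw [eq_sub_iff_add_eq, ← hn, ← rescale_add, h1, rescale_add, rescale_add, rescale_add,
    rescale_X_mul, rescale_mul, two_mul, two_mul]

/-- The formal integral of the phase `Φ / ν`, as a functional on the rescaled series. -/
theorem exists_formalIntegral (Φ : PowerSeries A)
    (h0 : K.ev (PowerSeries.coeff 0 Φ) = 0) (h1 : ∀ i, K.ev (K.der i (PowerSeries.coeff 0 Φ)) = 0)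
    (h2 : IsUnit (Matrix.of fun i j => K.ev (K.der i (K.der j (PowerSeries.coeff 0 Φ)))).det) :
    ∃ I : PowerSeries (MvPolynomial (Fin n) ℂ) →ₗ[ℂ] PowerSeries ℂ,
      (∀ Y, I (PowerSeries.X ^ 2 * Y) = PowerSeries.X * I Y) ∧
      (∀ i Y, I (PowerSeries.X * seriesDer (MvPolynomial.pderiv i) Y
        + rescale K (seriesDer (K.der i) Φ) * Y) = 0) ∧
      (∀ Z : PowerSeries A, 2 * (PowerSeries.X * eulerSeries ℂ (I (rescale K Z)))
        = I (rescale K ((2 * (PowerSeries.X * PowerSeries.derivative A Φ - Φ)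
          - (n : PowerSeries A) * PowerSeries.X) * Z
          + 2 * PowerSeries.X ^ 2 * PowerSeries.derivative A Z))) ∧
      (∀ Z, PowerSeries.coeff 0 (I (rescale K Z)) = K.ev (PowerSeries.coeff 0 Z)) ∧
      (∀ Y k, ∃ m : ℕ → (MvPolynomial (Fin n) ℂ →ₗ[ℂ] ℂ), ∀ f,
        PowerSeries.coeff k (I (Y * taylor K f))
          = ∑ b ∈ Finset.range (2 * k + 1), m b (taylorCoeff K b f)) := by
  have hsymm : (Matrix.of fun i j => K.ev (K.der i (K.der j (PowerSeries.coeff 0 Φ)))).IsSymm := by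
    ext i j
    rw [Matrix.transpose_apply, Matrix.of_apply, Matrix.of_apply, ← sub_eq_zero, ← map_sub,
      K.ev_null _ (K.comm j i _)]
  obtain ⟨S, hS, hS0⟩ := exists_rescale_eq_X_sq_mul K Φ h0 h1
  obtain ⟨I, hX, hI, hE, hI0, hm⟩ := exists_weightedGauss hsymm h2 S hS0
  have hSder : ∀ i, PowerSeries.X * seriesDer (MvPolynomial.pderiv i) S
      = rescale K (seriesDer (K.der i) Φ) := by
    intro i
    refine mul_left_cancel₀ PowerSeries.X_ne_zero ?_
    rw [← seriesDer_rescale, ← hS, seriesDer_X_pow_mul]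
    ring
  refine ⟨I, hX, fun i Y => ?_, fun Z => ?_, fun Z => hI0 _ _ ?_, fun Y k => ?_⟩
  · have h4 := hI i (PowerSeries.X * Y)
    rwa [seriesDer_X_mul, mul_left_comm, ← mul_assoc, hSder] at h4
  · have h5 : PowerSeries.X ^ 2 * (eulerSeries _ (rescale K Z) + eulerSeries _ S * rescale K Z)
        = PowerSeries.X ^ 2 * (eulerField (rescale K Z) + eulerField S * rescale K Z)
          + (2 * (rescale K (PowerSeries.X * PowerSeries.derivative A Φ - Φ) * rescale K Z)
          + 2 * (PowerSeries.X ^ 2 * rescale K (PowerSeries.X * PowerSeries.derivative A Z))) := by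
      have hθS := X_sq_mul_eulerSeries K Φ S hS
      rw [eulerSeries_rescale]
      generalize eulerSeries (MvPolynomial (Fin n) ℂ) S = a at *
      generalize eulerField S = b at *
      linear_combination (rescale K Z) * hθS
    rw [rescale_eulerPhase, mul_left_comm, ← hE, ← hX, h5, map_add, hX, apply_eulerField I S hI,
      map_sub, map_smul, hX, mul_neg, mul_smul_comm, neg_add_eq_sub]
  · rw [rescale, PowerSeries.coeff_mk, Nat.zero_div, zero_add, Finset.sum_range_one, mul_zero,
      Nat.sub_zero, taylorCoeff_zero]
  · obtain ⟨m, hm⟩ := hm Y k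
    refine ⟨m, fun f => ?_⟩
    rw [hm]
    simp only [coeff_taylor]

end FormalIntegral

/-! ### Action of sequences of functionals on power series -/

section SeriesAction

variable {A : Type*} [CommRing A] [Algebra ℂ A]

/-- The action of a sequence of functionals `Λ₀ + ν Λ₁ + …` on formal power series in `ν`. -/
def seriesAct (L : ℕ → A →ₗ[ℂ] ℂ) : PowerSeries A →ₗ[ℂ] PowerSeries ℂ where
  toFun F := PowerSeries.mk fun k =>
    ∑ p ∈ Finset.HasAntidiagonal.antidiagonal k, L p.1 (PowerSeries.coeff p.2 F)
  map_add' F G := by ext1 k; simp [Finset.sum_add_distrib]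
  map_smul' c F := by
    ext1 k
    rw [RingHom.id_apply, PowerSeries.coeff_mk, PowerSeries.coeff_smul, PowerSeries.coeff_mk,
      Finset.smul_sum]
    refine Finset.sum_congr rfl fun p _ => ?_
    rw [← map_smul]
    rfl

theorem coeff_seriesAct (L : ℕ → A →ₗ[ℂ] ℂ) (F : PowerSeries A) (k : ℕ) :
    PowerSeries.coeff k (seriesAct L F)
      = ∑ p ∈ Finset.HasAntidiagonal.antidiagonal k, L p.1 (PowerSeries.coeff p.2 F) :=
  PowerSeries.coeff_mk k fun k =>
    ∑ p ∈ Finset.HasAntidiagonal.antidiagonal k, L p.1 (PowerSeries.coeff p.2 F)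

theorem coeff_seriesAct_C (L : ℕ → A →ₗ[ℂ] ℂ) (f : A) (k : ℕ) :
    PowerSeries.coeff k (seriesAct L (PowerSeries.C f)) = L k f := by
  rw [coeff_seriesAct, Finset.sum_eq_single (k, 0)]
  · simp
  · rintro ⟨a, b⟩ hp hb
    rw [PowerSeries.coeff_C, if_neg, map_zero]
    rintro rfl
    exact hb (by simpa using hp)
  · simp

theorem seriesAct_X_mul (L : ℕ → A →ₗ[ℂ] ℂ) (F : PowerSeries A) :
    seriesAct L (PowerSeries.X * F) = PowerSeries.X * seriesAct L F := by
  ext1 k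
  rw [coeff_seriesAct]
  cases k with
  | zero => simp
  | succ k =>
    rw [PowerSeries.coeff_succ_X_mul, coeff_seriesAct, Finset.Nat.sum_antidiagonal_succ']
    simp [PowerSeries.coeff_succ_X_mul]

theorem seriesAct_eq (L : ℕ → A →ₗ[ℂ] ℂ) (F : PowerSeries A) : seriesAct L F
    = seriesAct L (PowerSeries.C (PowerSeries.coeff 0 F))
      + PowerSeries.X * seriesAct L (shift F) := by
  conv_lhs => rw [eq_C_add_X_mul_shift F, map_add, seriesAct_X_mul]

end SeriesAction

/-! ### The two FOI identities for the formal integral -/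

section FormalOscillatory

variable {n : ℕ} {A : Type*} [CommRing A] [Algebra ℂ A] (K : FormalFrame n A)

theorem rescale_sum {ι : Type*} (s : Finset ι) (F : ι → PowerSeries A) :
    rescale K (∑ i ∈ s, F i) = ∑ i ∈ s, rescale K (F i) :=
  map_sum (AddMonoidHom.mk' (rescale K) (rescale_add K)) F s

/-- The components of the functional `F ↦ I (rescale (r F))`. -/
def formalComponents (I : PowerSeries (MvPolynomial (Fin n) ℂ) →ₗ[ℂ] PowerSeries ℂ)
    (r : PowerSeries A) (k : ℕ) : A →ₗ[ℂ] ℂ where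
  toFun f := PowerSeries.coeff k (I (rescale K r * taylor K f))
  map_add' f g := by rw [taylor_add, mul_add, map_add, map_add]
  map_smul' c f := by
    rw [Algebra.smul_def, taylor_mul, taylor_algebraMap, mul_left_comm, RingHom.id_apply,
      ← MvPolynomial.algebraMap_eq]
    have h : ∀ Y : PowerSeries (MvPolynomial (Fin n) ℂ),
        PowerSeries.C (algebraMap ℂ (MvPolynomial (Fin n) ℂ) c) * Y = c • Y := fun Y => by
      ext1 d
      rw [PowerSeries.coeff_C_mul, PowerSeries.coeff_smul, Algebra.smul_def]
    rw [h, map_smul]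
    rfl

/-- Both sides are `ν`-linear, because `I` turns `h²` into `ν`, and they agree on series constant in
`ν`. -/
theorem seriesAct_formalComponents
    (I : PowerSeries (MvPolynomial (Fin n) ℂ) →ₗ[ℂ] PowerSeries ℂ)
    (hI : ∀ Y, I (PowerSeries.X ^ 2 * Y) = PowerSeries.X * I Y) (r F : PowerSeries A) :
    seriesAct (formalComponents K I r) F = I (rescale K (r * F)) := by
  rw [rescale_mul]
  ext1 k
  induction k generalizing F with
  | zero =>
    rw [seriesAct_eq, rescale_eq K F, mul_add, mul_left_comm, map_add, map_add, map_add, hI,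
      PowerSeries.coeff_zero_X_mul, PowerSeries.coeff_zero_X_mul, coeff_seriesAct_C]
    rfl
  | succ k ih =>
    rw [seriesAct_eq, rescale_eq K F, mul_add, mul_left_comm, map_add, map_add, map_add, hI,
      PowerSeries.coeff_succ_X_mul, PowerSeries.coeff_succ_X_mul, coeff_seriesAct_C, ih]
    rfl

theorem formalIntegral_ibp (I : PowerSeries (MvPolynomial (Fin n) ℂ) →ₗ[ℂ] PowerSeries ℂ)
    (Φ : PowerSeries A)
    (hI : ∀ i Y, I (PowerSeries.X * seriesDer (MvPolynomial.pderiv i) Y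
        + rescale K (seriesDer (K.der i) Φ) * Y) = 0)
    (D : Derivation ℂ A A) (a : Fin n → A) (hD : ∀ f, D f - ∑ i, a i * K.der i f ∈ K.null)
    (r g : PowerSeries A)
    (hg : ∀ m, PowerSeries.coeff m (g * r) - ∑ i, K.der i (a i * PowerSeries.coeff m r) ∈ K.null)
    (F : PowerSeries A) :
    I (rescale K (r * (PowerSeries.X * seriesDer D F
      + (seriesDer D Φ + PowerSeries.X * g) * F))) = 0 := by
  have h1 : ∀ H : PowerSeries A, rescale K (seriesDer D H)
      = ∑ i, rescale K (PowerSeries.C (a i)) * rescale K (seriesDer (K.der i) H) := fun H => by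
    simp only [← rescale_mul, ← rescale_sum]
    refine rescale_congr K fun k => ?_
    rw [map_sum, coeff_seriesDer]
    simpa only [PowerSeries.coeff_C_mul, coeff_seriesDer] using hD (PowerSeries.coeff k H)
  have h2 : rescale K g * rescale K r
      = ∑ i, rescale K (seriesDer (K.der i) (PowerSeries.C (a i) * r)) := by
    rw [← rescale_mul, ← rescale_sum]
    refine rescale_congr K fun k => ?_
    rw [map_sum]
    simpa only [PowerSeries.coeff_C_mul, coeff_seriesDer] using hg k
  -- With `D = ∑ aᵢ ∂ᵢ` and `g r = ∑ ∂ᵢ(aᵢ r)`, the Leibniz rule makes the integrand a sum of total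
  -- derivatives of `aᵢ r F` twisted by the phase.
  have h3 : rescale K (r * (PowerSeries.X * seriesDer D F
      + (seriesDer D Φ + PowerSeries.X * g) * F))
      = ∑ i, (PowerSeries.X * seriesDer (MvPolynomial.pderiv i)
          (rescale K (PowerSeries.C (a i) * r * F))
        + rescale K (seriesDer (K.der i) Φ) * rescale K (PowerSeries.C (a i) * r * F)) := by
    have h4 : ∀ i, PowerSeries.X * seriesDer (MvPolynomial.pderiv i)
          (rescale K (PowerSeries.C (a i) * r * F))
        + rescale K (seriesDer (K.der i) Φ) * rescale K (PowerSeries.C (a i) * r * F)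
        = PowerSeries.X ^ 2 * rescale K r
            * (rescale K (PowerSeries.C (a i)) * rescale K (seriesDer (K.der i) F))
          + rescale K r * rescale K F
            * (rescale K (PowerSeries.C (a i)) * rescale K (seriesDer (K.der i) Φ))
          + PowerSeries.X ^ 2 * rescale K F
            * rescale K (seriesDer (K.der i) (PowerSeries.C (a i) * r)) := fun i => by
      rw [seriesDer_rescale, Derivation.leibniz, smul_eq_mul, smul_eq_mul, rescale_add]
      simp only [rescale_mul]
      ring
    simp only [h4, Finset.sum_add_distrib, ← Finset.mul_sum, ← h1, ← h2]
    rw [rescale_mul, rescale_add, rescale_X_mul, rescale_mul, rescale_add, rescale_X_mul]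
    ring
  rw [h3, map_sum]
  exact Finset.sum_eq_zero fun i _ => hI i _

/-- Apply the identity for `I` to `r F`. The derivative of the density becomes `g r`, and the common
factor `2` is cancelled. -/
theorem formalIntegral_differentiation
    (I : PowerSeries (MvPolynomial (Fin n) ℂ) →ₗ[ℂ] PowerSeries ℂ) (Φ : PowerSeries A)
    (hI : ∀ Z : PowerSeries A, 2 * (PowerSeries.X * eulerSeries ℂ (I (rescale K Z)))
        = I (rescale K ((2 * (PowerSeries.X * PowerSeries.derivative A Φ - Φ)
          - (n : PowerSeries A) * PowerSeries.X) * Z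
          + 2 * PowerSeries.X ^ 2 * PowerSeries.derivative A Z)))
    (r g : PowerSeries A)
    (hg : ∀ m, PowerSeries.coeff m (g * r)
      - PowerSeries.coeff m (PowerSeries.derivative A r) ∈ K.null) (F : PowerSeries A) :
    PowerSeries.X ^ 2 * PowerSeries.derivative ℂ (I (rescale K (r * F)))
      = I (rescale K (r * (PowerSeries.X ^ 2 * PowerSeries.derivative A F
        + (PowerSeries.X * PowerSeries.derivative A Φ - Φ + PowerSeries.X ^ 2 * g
          - PowerSeries.C (algebraMap ℂ A (n / 2)) * PowerSeries.X) * F))) := by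
  have h2 : (2 : PowerSeries ℂ) ≠ 0 := fun h =>
    two_ne_zero (α := ℂ) (by
      simpa only [map_ofNat, map_zero] using congrArg PowerSeries.constantCoeff h)
  refine mul_left_cancel₀ h2 ?_
  have h3 : (n : PowerSeries A) = 2 * PowerSeries.C (algebraMap ℂ A (n / 2)) := by
    rw [two_mul, ← map_add, ← map_add, add_halves, map_natCast, map_natCast]
  have h5 := hI (r * F)
  rw [eulerSeries_apply, ← mul_assoc PowerSeries.X, ← pow_two] at h5
  rw [h5, two_mul (I _), ← map_add, ← rescale_add]
  congr 1
  have h6 : rescale K (PowerSeries.derivative A r) = rescale K (g * r) :=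
    (rescale_congr K hg).symm
  have h7 : rescale K (PowerSeries.X ^ 2 * (PowerSeries.derivative A r * F))
      = rescale K (PowerSeries.X ^ 2 * (g * r * F)) := by
    rw [pow_two, mul_assoc, mul_assoc, rescale_X_mul, rescale_X_mul, rescale_X_mul, rescale_X_mul,
      rescale_mul, h6, rescale_mul K (g * r)]
  have h8 : (2 * (PowerSeries.X * PowerSeries.derivative A Φ - Φ)
          - (n : PowerSeries A) * PowerSeries.X) * (r * F)
          + 2 * PowerSeries.X ^ 2 * PowerSeries.derivative A (r * F)
      = 2 * ((PowerSeries.X * PowerSeries.derivative A Φ - Φ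
          - PowerSeries.C (algebraMap ℂ A (n / 2)) * PowerSeries.X) * (r * F)
          + PowerSeries.X ^ 2 * (r * PowerSeries.derivative A F))
        + (PowerSeries.X ^ 2 * (PowerSeries.derivative A r * F)
          + PowerSeries.X ^ 2 * (PowerSeries.derivative A r * F)) := by
    rw [Derivation.leibniz, smul_eq_mul, smul_eq_mul, h3]
    ring
  rw [h8, rescale_add, rescale_add, h7, ← rescale_add, ← rescale_add]
  congr 1
  ring

end FormalOscillatory

/-! ### Reduction from Laurent series to power series -/

section Laurent

/-- The power `ν^m` of the formal variable. -/
def nuPow (R : Type*) [CommRing R] (m : ℤ) : LaurentSeries R := HahnSeries.single m 1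

section
variable {R : Type*} [CommRing R]

theorem nuPow_mul_nuPow (a b : ℤ) : nuPow R a * nuPow R b = nuPow R (a + b) := by
  rw [nuPow, nuPow, HahnSeries.single_mul_single, mul_one, nuPow]

theorem nuPow_zero : nuPow R 0 = 1 := rfl

theorem nuPow_mul_eq_zero {m : ℤ} {f : LaurentSeries R} : nuPow R m * f = 0 ↔ f = 0 := by
  refine ⟨fun h => ?_, fun h => by rw [h, mul_zero]⟩
  rw [← one_mul f, ← nuPow_zero, ← neg_add_cancel m, ← nuPow_mul_nuPow, mul_assoc, h, mul_zero]

theorem coeff_nuPow_mul (m k : ℤ) (f : LaurentSeries R) :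
    (nuPow R m * f).coeff k = f.coeff (k - m) := by
  rw [nuPow, HahnSeries.coeff_single_mul, one_mul]

theorem coeff_ofPowerSeries (F : PowerSeries R) (k : ℤ) : (HahnSeries.ofPowerSeries ℤ R F).coeff k
    = if k < 0 then 0 else PowerSeries.coeff k.toNat F := by
  rw [PowerSeries.coeff_coe]
  split_ifs with h
  · rfl
  · congr 2
    omega

theorem ofPowerSeries_X : HahnSeries.ofPowerSeries ℤ R PowerSeries.X = nuPow R 1 :=
  HahnSeries.ofPowerSeries_X

theorem exists_eq_nuPow_mul (f : LaurentSeries R) :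
    ∃ (m : ℤ) (F : PowerSeries R), f = nuPow R m * HahnSeries.ofPowerSeries ℤ R F :=
  ⟨_, _, f.single_order_mul_powerSeriesPart.symm⟩

variable [Algebra ℂ R]

theorem coeff_derivative (f : LaurentSeries R) (k : ℤ) :
    (LaurentSeries.derivative ℂ f).coeff k = (k + 1) • f.coeff (k + 1) := by
  rw [LaurentSeries.derivative_apply, LaurentSeries.hasseDeriv_coeff, Nat.cast_one,
    Ring.choose_one_right]

theorem derivative_nuPow_mul (m : ℤ) (f : LaurentSeries R) :
    LaurentSeries.derivative ℂ (nuPow R m * f)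
      = m • (nuPow R (m - 1) * f) + nuPow R m * LaurentSeries.derivative ℂ f := by
  ext k
  rw [coeff_derivative, HahnSeries.coeff_add, HahnSeries.coeff_smul, coeff_nuPow_mul,
    coeff_nuPow_mul, coeff_nuPow_mul, coeff_derivative, show k - (m - 1) = k + 1 - m by ring,
    show k - m + 1 = k + 1 - m by ring, ← add_smul]
  congr 1
  ring

theorem derivative_ofPowerSeries (F : PowerSeries R) :
    LaurentSeries.derivative ℂ (HahnSeries.ofPowerSeries ℤ R F)
      = HahnSeries.ofPowerSeries ℤ R (PowerSeries.derivative R F) := by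
  ext k
  rw [coeff_derivative, coeff_ofPowerSeries, coeff_ofPowerSeries]
  rcases lt_trichotomy k (-1) with h | rfl | h
  · rw [if_pos (by omega), if_pos (by omega), smul_zero]
  · simp
  · rw [if_neg (by omega), if_neg (by omega), PowerSeries.coeff_derivative,
      show (k + 1).toNat = k.toNat + 1 by omega, zsmul_eq_mul, mul_comm]
    congr 1
    obtain ⟨j, rfl⟩ := Int.eq_ofNat_of_zero_le (show 0 ≤ k by omega)
    simp

end

section
variable {n : ℕ} {M : Type*} [TopologicalSpace M] [ChartedSpace (EuclideanSpace ℝ (Fin n)) M]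

theorem coeff_act (L : FormalFunctional n M) (f : LaurentSeries (SmoothFun n M)) (k : ℤ) :
    (act L f).coeff k = ∑ᶠ r : ℕ, L r (f.coeff (k - r)) := rfl

theorem act_add (L : FormalFunctional n M) (f g : LaurentSeries (SmoothFun n M)) :
    act L (f + g) = act L f + act L g := by
  ext k
  rw [HahnSeries.coeff_add, coeff_act, coeff_act, coeff_act,
    ← finsum_add_distrib (finite_support_act L f k) (finite_support_act L g k)]
  simp only [HahnSeries.coeff_add, map_add]

theorem act_zsmul (L : FormalFunctional n M) (m : ℤ) (f : LaurentSeries (SmoothFun n M)) :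
    act L (m • f) = m • act L f :=
  map_zsmul (AddMonoidHom.mk' (act L) (act_add L)) m f

theorem act_nuPow_mul (L : FormalFunctional n M) (m : ℤ) (f : LaurentSeries (SmoothFun n M)) :
    act L (nuPow _ m * f) = nuPow ℂ m * act L f := by
  ext k
  rw [coeff_nuPow_mul, coeff_act, coeff_act]
  refine finsum_congr fun r => ?_
  rw [coeff_nuPow_mul, sub_right_comm]

theorem act_ofPowerSeries (L : FormalFunctional n M) (F : PowerSeries (SmoothFun n M)) :
    act L (HahnSeries.ofPowerSeries ℤ _ F) = HahnSeries.ofPowerSeries ℤ ℂ (seriesAct L F) := by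
  ext k
  rw [coeff_act, coeff_ofPowerSeries]
  split_ifs with hk
  · refine finsum_eq_zero_of_forall_eq_zero fun r => ?_
    rw [coeff_ofPowerSeries, if_pos (by omega), map_zero]
  · rw [coeff_seriesAct, Finset.Nat.sum_antidiagonal_eq_sum_range_succ_mk,
      finsum_eq_sum_of_support_subset (s := Finset.range k.toNat.succ)]
    · refine Finset.sum_congr rfl fun r hr => ?_
      have hr := Finset.mem_range.1 hr
      rw [coeff_ofPowerSeries, if_neg (by omega), show (k - (r : ℤ)).toNat = k.toNat - r by omega]
    · intro r hr
      by_contra h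
      simp only [Finset.coe_range, Set.mem_Iio, not_lt] at h
      refine hr ?_
      change L r ((HahnSeries.ofPowerSeries ℤ _ F).coeff (k - r)) = 0
      rw [coeff_ofPowerSeries, if_pos (by omega), map_zero]

theorem halfDimOverNu_eq : halfDimOverNu n M = nuPow _ (-1)
    * HahnSeries.ofPowerSeries ℤ _ (PowerSeries.C (algebraMap ℂ (SmoothFun n M) (n / 2))) := by
  rw [HahnSeries.ofPowerSeries_C, HahnSeries.C_apply, nuPow, HahnSeries.single_mul_single, one_mul,
    add_zero, halfDimOverNu]

/-- The formal power series `ν φ`. -/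
def phaseSeries (φ : LaurentSeries (SmoothFun n M)) : PowerSeries (SmoothFun n M) :=
  PowerSeries.mk fun k => φ.coeff (k - 1)

theorem eq_nuPow_mul_phaseSeries {φ : LaurentSeries (SmoothFun n M)}
    (hφ : ∀ k : ℤ, k < -1 → φ.coeff k = 0) :
    φ = nuPow _ (-1) * HahnSeries.ofPowerSeries ℤ _ (phaseSeries φ) := by
  ext1
  funext k
  rw [coeff_nuPow_mul, coeff_ofPowerSeries]
  split_ifs with h
  · rw [hφ k (by omega)]
  · rw [phaseSeries, PowerSeries.coeff_mk]
    congr 1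
    omega

/-- Multiply by `ν²` to clear denominators. A general argument is `ν^m F`, and the terms from
differentiating `ν^m` cancel between the two sides, so power series suffice. -/
theorem differentiation_iff {φ : LaurentSeries (SmoothFun n M)}
    (hφ : ∀ k : ℤ, k < -1 → φ.coeff k = 0) (L : FormalFunctional n M)
    (g : PowerSeries (SmoothFun n M)) :
    (∀ f, LaurentSeries.derivative ℂ (act L f)
        - act L (LaurentSeries.derivative ℂ f
            + (LaurentSeries.derivative ℂ φ + HahnSeries.ofPowerSeries ℤ _ g
                - halfDimOverNu n M) * f) = 0) ↔
      ∀ F, PowerSeries.X ^ 2 * PowerSeries.derivative ℂ (seriesAct L F)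
        = seriesAct L (PowerSeries.X ^ 2 * PowerSeries.derivative (SmoothFun n M) F
          + (PowerSeries.X * PowerSeries.derivative (SmoothFun n M) (phaseSeries φ) - phaseSeries φ
            + PowerSeries.X ^ 2 * g
            - PowerSeries.C (algebraMap ℂ (SmoothFun n M) (n / 2)) * PowerSeries.X) * F) := by
  have h1 : ∀ m F, LaurentSeries.derivative ℂ (act L (nuPow _ m * HahnSeries.ofPowerSeries ℤ _ F))
        - act L (LaurentSeries.derivative ℂ (nuPow _ m * HahnSeries.ofPowerSeries ℤ _ F)
            + (LaurentSeries.derivative ℂ φ + HahnSeries.ofPowerSeries ℤ _ g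
                - halfDimOverNu n M) * (nuPow _ m * HahnSeries.ofPowerSeries ℤ _ F)) = 0 ↔
      PowerSeries.X ^ 2 * PowerSeries.derivative ℂ (seriesAct L F)
        = seriesAct L (PowerSeries.X ^ 2 * PowerSeries.derivative (SmoothFun n M) F
          + (PowerSeries.X * PowerSeries.derivative (SmoothFun n M) (phaseSeries φ) - phaseSeries φ
            + PowerSeries.X ^ 2 * g
            - PowerSeries.C (algebraMap ℂ (SmoothFun n M) (n / 2)) * PowerSeries.X) * F) := by
    intro m F
    have h2 : LaurentSeries.derivative ℂ (nuPow _ m * HahnSeries.ofPowerSeries ℤ _ F)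
        + (LaurentSeries.derivative ℂ φ + HahnSeries.ofPowerSeries ℤ _ g - halfDimOverNu n M)
          * (nuPow _ m * HahnSeries.ofPowerSeries ℤ _ F)
        = m • (nuPow _ (m - 1) * HahnSeries.ofPowerSeries ℤ _ F)
          + nuPow _ (m - 2) * HahnSeries.ofPowerSeries ℤ _
            (PowerSeries.X ^ 2 * PowerSeries.derivative (SmoothFun n M) F
          + (PowerSeries.X * PowerSeries.derivative (SmoothFun n M) (phaseSeries φ) - phaseSeries φ
            + PowerSeries.X ^ 2 * g
            - PowerSeries.C (algebraMap ℂ (SmoothFun n M) (n / 2)) * PowerSeries.X) * F) := by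
      conv_lhs => rw [eq_nuPow_mul_phaseSeries hφ]
      rw [derivative_nuPow_mul, derivative_nuPow_mul, derivative_ofPowerSeries,
        derivative_ofPowerSeries, halfDimOverNu_eq, neg_one_zsmul, add_assoc]
      congr 1
      simp only [map_add, map_sub, map_mul, map_pow, ofPowerSeries_X]
      have h3 : (nuPow (SmoothFun n M) (-1)) * nuPow _ 1 = 1 := nuPow_mul_nuPow _ _
      have h4 : nuPow (SmoothFun n M) m = nuPow _ (m - 2) * nuPow _ 1 ^ 2 := by
        rw [pow_two, nuPow_mul_nuPow, nuPow_mul_nuPow]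
        congr 1
        ring
      have h5 : nuPow (SmoothFun n M) (-1 - 1) = nuPow _ (-1) ^ 2 := by
        rw [pow_two, nuPow_mul_nuPow]
        rfl
      rw [h4, h5]
      generalize nuPow (SmoothFun n M) (m - 2) = s
      generalize nuPow (SmoothFun n M) 1 = t at *
      generalize nuPow (SmoothFun n M) (-1) = u at *
      generalize HahnSeries.ofPowerSeries ℤ (SmoothFun n M) F = a
      generalize HahnSeries.ofPowerSeries ℤ (SmoothFun n M) (phaseSeries φ) = b
      generalize HahnSeries.ofPowerSeries ℤ (SmoothFun n M) (PowerSeries.derivative (SmoothFun n M)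
        (phaseSeries φ)) = c
      generalize HahnSeries.ofPowerSeries ℤ (SmoothFun n M) (PowerSeries.C _) = d
      linear_combination (s * a * t * (c - d) - s * a * b * (u * t + 1)) * h3
    rw [h2, act_add, act_zsmul, act_nuPow_mul, act_nuPow_mul, act_nuPow_mul, act_ofPowerSeries,
      act_ofPowerSeries, derivative_nuPow_mul, add_sub_add_left_eq_sub, derivative_ofPowerSeries]
    have h6 : nuPow ℂ m = nuPow _ (m - 2) * HahnSeries.ofPowerSeries ℤ ℂ PowerSeries.X ^ 2 := by
      rw [ofPowerSeries_X, pow_two, nuPow_mul_nuPow, nuPow_mul_nuPow]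
      congr 1
      ring
    rw [h6, mul_assoc, ← map_pow, ← map_mul, ← mul_sub, nuPow_mul_eq_zero, sub_eq_zero]
    exact HahnSeries.ofPowerSeries_injective.eq_iff
  refine ⟨fun h F => (h1 0 F).1 (h _), fun h f => ?_⟩
  obtain ⟨m, F, rfl⟩ := exists_eq_nuPow_mul f
  exact (h1 m F).2 (h F)

variable [IsManifold (𝓡 n) ∞ M]

theorem vfApplyFormal_nuPow_mul (v : SmoothVF n M) (m : ℤ) (F : PowerSeries (SmoothFun n M)) :
    vfApplyFormal v (nuPow _ m * HahnSeries.ofPowerSeries ℤ _ F)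
      = nuPow _ m * HahnSeries.ofPowerSeries ℤ _ (vfSeries v F) := by
  ext1
  funext k
  change vfApply v ((nuPow _ m * HahnSeries.ofPowerSeries ℤ _ F).coeff k) = _
  rw [coeff_nuPow_mul, coeff_nuPow_mul, coeff_ofPowerSeries, coeff_ofPowerSeries]
  split_ifs
  · exact map_zero _
  · rw [coeff_vfSeries]

theorem vfSeries_eq (v : SmoothVF n M) (F : PowerSeries (SmoothFun n M)) :
    vfSeries v F = seriesDer (vfDer v) F := by
  ext1 k
  rw [coeff_vfSeries, coeff_seriesDer, vfDer_apply]

theorem mul_add_mul_eq_of_mul_eq_one {B : Type*} [CommRing B] {t u : B} (h : u * t = 1)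
    (s a b c g : B) :
    s * t * c + (u * b + g) * (s * t * a) = s * (t * c + (b + t * g) * a) := by
  linear_combination (s * b * a) * h

/-- Here one factor `ν` clears the pole of `φ`, and `ν^m` factors out because vector fields do not
act on `ν`. -/
theorem integration_by_parts_iff {φ : LaurentSeries (SmoothFun n M)}
    (hφ : ∀ k : ℤ, k < -1 → φ.coeff k = 0) (L : FormalFunctional n M) (v : SmoothVF n M)
    (g : PowerSeries (SmoothFun n M)) :
    (∀ f, act L (vfApplyFormal v f
        + (vfApplyFormal v φ + HahnSeries.ofPowerSeries ℤ (SmoothFun n M) g) * f) = 0) ↔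
      ∀ F, seriesAct L (PowerSeries.X * vfSeries v F
        + (vfSeries v (phaseSeries φ) + PowerSeries.X * g) * F) = 0 := by
  have h1 : ∀ m F, act L (vfApplyFormal v
      (nuPow (SmoothFun n M) m * HahnSeries.ofPowerSeries ℤ (SmoothFun n M) F)
        + (vfApplyFormal v φ + HahnSeries.ofPowerSeries ℤ (SmoothFun n M) g)
          * (nuPow (SmoothFun n M) m * HahnSeries.ofPowerSeries ℤ (SmoothFun n M) F)) = 0 ↔
      seriesAct L (PowerSeries.X * vfSeries v F
        + (vfSeries v (phaseSeries φ) + PowerSeries.X * g) * F) = 0 := by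
    intro m F
    let H : PowerSeries (SmoothFun n M) := PowerSeries.X * vfSeries v F
        + (vfSeries v (phaseSeries φ) + PowerSeries.X * g) * F
    have h2 : vfApplyFormal v
      (nuPow (SmoothFun n M) m * HahnSeries.ofPowerSeries ℤ (SmoothFun n M) F)
        + (vfApplyFormal v φ + HahnSeries.ofPowerSeries ℤ (SmoothFun n M) g)
          * (nuPow (SmoothFun n M) m * HahnSeries.ofPowerSeries ℤ (SmoothFun n M) F)
        = nuPow (SmoothFun n M) (m - 1) * HahnSeries.ofPowerSeries ℤ (SmoothFun n M) H := by
      conv_lhs => rw [eq_nuPow_mul_phaseSeries hφ]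
      rw [vfApplyFormal_nuPow_mul, vfApplyFormal_nuPow_mul]
      simp only [H, map_add, map_mul, ofPowerSeries_X]
      have h3 : (nuPow (SmoothFun n M) (-1)) * nuPow (SmoothFun n M) 1 = 1 := nuPow_mul_nuPow _ _
      have h4 : nuPow (SmoothFun n M) m
        = nuPow (SmoothFun n M) (m - 1) * nuPow (SmoothFun n M) 1 := by
        rw [nuPow_mul_nuPow, sub_add_cancel]
      rw [h4]
      exact mul_add_mul_eq_of_mul_eq_one h3 _ _ _ _ _
    rw [h2, act_nuPow_mul, nuPow_mul_eq_zero, act_ofPowerSeries,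
      map_eq_zero_iff _ HahnSeries.ofPowerSeries_injective]
  refine ⟨fun h F => (h1 0 F).1 (h _), fun h f => ?_⟩
  obtain ⟨m, F, rfl⟩ := exists_eq_nuPow_mul f
  exact (h1 m F).2 (h F)

end

end Laurent

/-! ### Existence of a strongly associated FOI -/

section Existence

variable {n : ℕ} {M : Type*} [TopologicalSpace M] [ChartedSpace (EuclideanSpace ℝ (Fin n)) M]

theorem coeff_zero_phaseSeries (φ : LaurentSeries (SmoothFun n M)) :
    PowerSeries.coeff 0 (phaseSeries φ) = φ.coeff (-1) := by
  rw [phaseSeries, PowerSeries.coeff_mk]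
  rfl

variable [IsManifold (𝓡 n) ∞ M]

theorem isStrongFOI_iff {x₀ : M} {φ : LaurentSeries (SmoothFun n M)} (hφ : IsFormalPhase x₀ φ)
    (ρ : ℕ → TopForm n M) (L : FormalFunctional n M) : IsStrongFOI x₀ φ ρ L ↔
      (∀ r, IsPointDistribution x₀ (L r)) ∧ L 0 ≠ 0 ∧
      (∀ v g, IsDivergence x₀ ρ v g → ∀ F, seriesAct L (PowerSeries.X * vfSeries v F
        + (vfSeries v (phaseSeries φ) + PowerSeries.X * g) * F) = 0) ∧
      (∀ g, IsLogDerivative x₀ ρ g → ∀ F,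
        PowerSeries.X ^ 2 * PowerSeries.derivative ℂ (seriesAct L F)
        = seriesAct L (PowerSeries.X ^ 2 * PowerSeries.derivative (SmoothFun n M) F
          + (PowerSeries.X * PowerSeries.derivative (SmoothFun n M) (phaseSeries φ) - phaseSeries φ
            + PowerSeries.X ^ 2 * g
            - PowerSeries.C (algebraMap ℂ (SmoothFun n M) (n / 2)) * PowerSeries.X) * F)) := by
  constructor
  · intro h
    exact ⟨h.distribution, h.leading_ne_zero,
      fun v g hg => (integration_by_parts_iff hφ.coeff_eq_zero L v g).1
        (h.integration_by_parts v g hg),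
      fun g hg => (differentiation_iff hφ.coeff_eq_zero L g).1 (h.differentiation g hg)⟩
  · rintro ⟨h1, h2, h3, h4⟩
    exact ⟨⟨h1, h2, fun v g hg => (integration_by_parts_iff hφ.coeff_eq_zero L v g).2 (h3 v g hg)⟩,
      fun g hg => (differentiation_iff hφ.coeff_eq_zero L g).2 (h4 g hg)⟩

variable [T2Space M]

/-- The coordinate frame at `x₀`. -/
def pointFrame (x₀ : M) : FormalFrame n (SmoothFun n M) where
  der i := vfDer (frame x₀ i)
  ev := evalAt x₀
  null := germIdeal n x₀
  der_mem i _ hf := vfApply_mem_germIdeal (frame x₀ i) hf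
  ev_null _ hf := hf.self_of_nhds
  comm i j f := by
    refine sub_mem_germIdeal.2 ?_
    filter_upwards [frameDomain_mem_nhds n x₀] with x hx
    exact vfApply_frame_comm hx i j f

theorem norm_iteratedFDeriv_frame_le (x₀ : M) (i : Fin n) (f : SmoothFun n M) (j : ℕ) :
    ‖iteratedFDeriv ℝ j (inChart (n := n) x₀ (vfApply (frame x₀ i) f)) (extChartAt (𝓡 n) x₀ x₀)‖
      ≤ ‖iteratedFDeriv ℝ (j + 1) (inChart (n := n) x₀ f) (extChartAt (𝓡 n) x₀ x₀)‖ := by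
  have h1 := inChart_frame_eventuallyEq (mem_frameDomain n x₀) i f
  rw [(h1.iteratedFDeriv ℝ j).self_of_nhds, ← norm_iteratedFDeriv_fderiv]
  have h2 : ContDiffAt ℝ ∞ (fderiv ℝ (inChart (n := n) x₀ f)) (extChartAt (𝓡 n) x₀ x₀) :=
    (contDiffAt_inChart x₀ f (mem_extChartAt_target x₀)).fderiv_right (by simp)
  refine (norm_iteratedFDeriv_clm_apply_const h2 (natCast_le_infty j)).trans_eq ?_
  rw [PiLp.norm_single, norm_one, one_mul]

/-- The functional `m` is left arbitrary so that the induction can absorb the multiplication by `yᵢ`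
from the recursion. -/
theorem exists_norm_taylorCoeff_le (x₀ : M) (d : ℕ) (m : MvPolynomial (Fin n) ℂ →ₗ[ℂ] ℂ) :
    ∃ C : ℝ, ∀ (f : SmoothFun n M) (B : ℝ),
      (∀ j ≤ d, ‖iteratedFDeriv ℝ j (inChart (n := n) x₀ f) (extChartAt (𝓡 n) x₀ x₀)‖ ≤ B) →
      ‖m (taylorCoeff (pointFrame x₀) d f)‖ ≤ C * B := by
  induction d generalizing m with
  | zero =>
    refine ⟨‖m 1‖, fun f B hB => ?_⟩
    have h1 := hB 0 le_rfl
    rw [norm_iteratedFDeriv_zero, inChart_extChartAt (mem_extChartAt_source x₀)] at h1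
    have h2 : MvPolynomial.C ((pointFrame x₀).ev f)
        = ((f : M → ℂ) x₀) • (1 : MvPolynomial (Fin n) ℂ) := by
      rw [MvPolynomial.smul_eq_C_mul, mul_one]
      rfl
    rw [taylorCoeff_zero, h2, map_smul, norm_smul, mul_comm]
    gcongr
  | succ d ih =>
    choose C hC using fun i => ih (m ∘ₗ LinearMap.mulLeft ℂ (MvPolynomial.X i))
    refine ⟨‖((d : ℂ) + 1)⁻¹‖ * ∑ i, C i, fun f B hB => ?_⟩
    rw [taylorCoeff_succ, map_smul, norm_smul, mul_assoc, map_sum, Finset.sum_mul]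
    gcongr
    refine norm_sum_le_of_le _ fun i _ => hC i _ B fun j hj => ?_
    exact (norm_iteratedFDeriv_frame_le x₀ i f j).trans (hB (j + 1) (by omega))

theorem isPointDistribution_of_taylorCoeff {x₀ : M} {L : SmoothFun n M →ₗ[ℂ] ℂ} {N : ℕ}
    {m : ℕ → MvPolynomial (Fin n) ℂ →ₗ[ℂ] ℂ}
    (hL : ∀ f, L f = ∑ b ∈ Finset.range N, m b (taylorCoeff (pointFrame x₀) b f)) :
    IsPointDistribution x₀ L := by
  refine ⟨fun f hf => ?_, ?_⟩
  · rw [hL]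
    exact Finset.sum_eq_zero fun b _ => by
      rw [taylorCoeff_null (pointFrame x₀) b f hf, map_zero]
  · choose C hC using fun b => exists_norm_taylorCoeff_le x₀ b (m b)
    refine ⟨{extChartAt (𝓡 n) x₀ x₀}, N, ∑ b ∈ Finset.range N, C b, isCompact_singleton,
      Set.singleton_subset_iff.2 (mem_extChartAt_target x₀), fun f B _ hB => ?_⟩
    rw [hL, Finset.sum_mul]
    refine norm_sum_le_of_le _ fun b hb => hC b f B fun j hj => hB j ?_ _ rfl
    exact hj.trans (Finset.mem_range.1 hb).le

/-- Besides existence, two features are recorded for later use: the leading term is a multiple of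
the Dirac distribution, and functions with zero Taylor series are killed. -/
theorem exists_isStrongFOI {x₀ : M} {φ : LaurentSeries (SmoothFun n M)} (hφ : IsFormalPhase x₀ φ)
    {ρ : ℕ → TopForm n M} (hρ : (ρ 0).form x₀ ≠ 0) : ∃ L, IsStrongFOI x₀ φ ρ L ∧
      (∃ c : ℂ, c ≠ 0 ∧ L 0 = c • dirac x₀) ∧
      ∀ r f, taylor (pointFrame x₀) f = 0 → L r f = 0 := by
  have hc := coeff_zero_phaseSeries φ
  obtain ⟨I, hX, hI, hE, hI0, hm⟩ := exists_formalIntegral (pointFrame x₀) (phaseSeries φ)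
    (by rw [hc]; exact hφ.critical_value)
    (fun i => by
      rw [hc]
      change (vfApply (frame x₀ i) (φ.coeff (-1)) : M → ℂ) x₀ = 0
      rw [vfApply_apply, hφ.critical.1]
      rfl)
    (by
      rw [hc]
      convert hφ.critical.2 using 2
      ext i j
      exact vfApply_frame_frame (mem_frameDomain n x₀) i j _)
  -- Taking the `ν⁰` part of the integral evaluates the product of density and function at `x₀`,
  -- since the Gaussian functional is normalised.
  have hL0 : ∀ f, formalComponents (pointFrame x₀) I (densitySeries x₀ ρ) 0 f
      = (density x₀ (ρ 0) : M → ℂ) x₀ * (f : M → ℂ) x₀ := by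
    intro f
    have h1 := hI0 (densitySeries x₀ ρ * PowerSeries.C f)
    rw [rescale_mul, rescale_C, PowerSeries.coeff_mul_C, coeff_densitySeries] at h1
    exact h1
  refine ⟨formalComponents (pointFrame x₀) I (densitySeries x₀ ρ),
    (isStrongFOI_iff hφ ρ _).2 ⟨fun r => ?_, fun h => ?_, fun v g hg F => ?_, fun g hg F => ?_⟩,
    ⟨(density x₀ (ρ 0) : M → ℂ) x₀, density_ne_zero hρ, LinearMap.ext hL0⟩, fun r f hf => ?_⟩
  · obtain ⟨m, hm⟩ := hm (rescale (pointFrame x₀) (densitySeries x₀ ρ)) r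
    exact isPointDistribution_of_taylorCoeff hm
  · have h1 := hL0 1
    rw [h] at h1
    exact density_ne_zero hρ (by simpa using h1.symm)
  · rw [seriesAct_formalComponents _ _ hX, vfSeries_eq, vfSeries_eq]
    refine formalIntegral_ibp (pointFrame x₀) I (phaseSeries φ) hI (vfDer v) (coord x₀ v)
      (fun f => ?_) _ g (fun m => ?_) F
    · refine sub_mem_germIdeal.2 ?_
      filter_upwards [frameDomain_mem_nhds n x₀] with x hx
      rw [smoothFun_sum_apply]
      exact vfApply_eq_sum hx v f
    · rw [coeff_densitySeries]
      exact hg.coeff_mul m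
  · rw [seriesAct_formalComponents _ _ hX, seriesAct_formalComponents _ _ hX]
    exact formalIntegral_differentiation (pointFrame x₀) I (phaseSeries φ) hE _ g hg.coeff_mul F
  · change PowerSeries.coeff r (I (_ * taylor _ f)) = 0
    rw [hf, mul_zero, map_zero, map_zero]

end Existence

/-! ### Hadamard's lemma with smooth quotients -/

section Hadamard

open MeasureTheory

/-- The integral is a convolution in `t`, evaluated at `0`, of the indicator of `(0, 1]` with the
reflected integrand. The cutoff `χ`, equal to `1` on the interval of integration, supplies the
compact support that smoothness of parametric convolutions requires. -/
theorem contDiff_parametric_integral {P F : Type*} [NormedAddCommGroup P] [NormedSpace ℝ P]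
    [NormedAddCommGroup F] [NormedSpace ℝ F] [CompleteSpace F] {a : P × ℝ → F}
    (ha : ContDiff ℝ ∞ a) : ContDiff ℝ ∞ fun p => ∫ t in (0 : ℝ)..1, a (p, t) := by
  let χ : ContDiffBump (0 : ℝ) := ⟨1, 2, one_pos, one_lt_two⟩
  have hf : LocallyIntegrable (Set.indicator (Set.Ioc (0 : ℝ) 1) fun _ => (1 : ℝ)) volume :=
    (locallyIntegrable_const 1).indicator measurableSet_Ioc
  have hg : ContDiff ℝ ∞ fun q : P × ℝ => χ (-q.2) • a (q.1, -q.2) :=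
    (χ.contDiff.comp contDiff_snd.neg).smul
      (ha.comp (contDiff_fst.prodMk contDiff_snd.neg))
  have h := contDiffOn_convolution_right_with_param (μ := volume) (n := ⊤)
    (ContinuousLinearMap.lsmul ℝ ℝ : ℝ →L[ℝ] F →L[ℝ] F) (s := (Set.univ : Set P))
    (k := Metric.closedBall (0 : ℝ) 2) (g := fun p t => χ (-t) • a (p, -t)) isOpen_univ
    (isCompact_closedBall _ _) (fun p t _ ht => ?_) hf hg.contDiffOn
  · rw [Set.univ_prod_univ, contDiffOn_univ] at h
    have h1 := h.comp (contDiff_id.prodMk (contDiff_const (c := (0 : ℝ))))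
    convert h1 using 1
    funext p
    rw [intervalIntegral.integral_of_le zero_le_one, ← integral_indicator measurableSet_Ioc]
    refine integral_congr_ae (Filter.Eventually.of_forall fun t => ?_)
    change _ = Set.indicator (Set.Ioc (0 : ℝ) 1) (fun _ => (1 : ℝ)) t
      • (χ (-(0 - t)) • a (p, -(0 - t)))
    rw [zero_sub, neg_neg]
    by_cases ht : t ∈ Set.Ioc (0 : ℝ) 1
    · have h2 : χ t = 1 := χ.one_of_mem_closedBall (by
        rw [Metric.mem_closedBall, Real.dist_eq, sub_zero, abs_of_pos ht.1]
        exact ht.2)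
      simp only [Set.indicator_of_mem ht, h2, one_smul]
    · simp only [Set.indicator_of_notMem ht, zero_smul]
  · have h2 : χ (-t) = 0 := χ.zero_of_le_dist (by
      rw [Metric.mem_closedBall, not_le] at ht
      rw [dist_eq_norm, sub_zero, norm_neg, ← sub_zero t, ← dist_eq_norm]
      exact ht.le)
    change χ (-t) • _ = 0
    rw [h2, zero_smul]

theorem exists_hadamard {n : ℕ} {F : EuclideanSpace ℝ (Fin n) → ℂ} (hF : ContDiff ℝ ∞ F)
    (p : EuclideanSpace ℝ (Fin n)) :
    ∃ h : Fin n → EuclideanSpace ℝ (Fin n) → ℂ, (∀ i, ContDiff ℝ ∞ (h i)) ∧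
      ∀ y, F y = F p + ∑ i, ((y i - p i : ℝ) : ℂ) * h i y := by
  have hD : ContDiff ℝ ∞ (fderiv ℝ F) := hF.fderiv_right (by simp)
  have hline : ContDiff ℝ ∞ fun q : EuclideanSpace ℝ (Fin n) × ℝ => p + q.2 • (q.1 - p) :=
    contDiff_const.add (contDiff_snd.smul (contDiff_fst.sub contDiff_const))
  have ha : ∀ i, ContDiff ℝ ∞ fun q : EuclideanSpace ℝ (Fin n) × ℝ =>
      fderiv ℝ F (p + q.2 • (q.1 - p)) (EuclideanSpace.single i 1) := fun i =>
    (hD.comp hline).clm_apply contDiff_const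
  refine ⟨fun i y => ∫ t in (0 : ℝ)..1, fderiv ℝ F (p + t • (y - p)) (EuclideanSpace.single i 1),
    fun i => contDiff_parametric_integral (ha i), fun y => ?_⟩
  have hderiv : ∀ t ∈ Set.uIcc (0 : ℝ) 1, HasDerivAt (fun t : ℝ => F (p + t • (y - p)))
      (∑ i, ((y i - p i : ℝ) : ℂ)
        * fderiv ℝ F (p + t • (y - p)) (EuclideanSpace.single i 1)) t := by
    intro t _
    have h1 : HasDerivAt (fun t : ℝ => p + t • (y - p)) (y - p) t := by
      simpa using ((hasDerivAt_id t).smul_const (y - p)).const_add p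
    have h2 := ((hF.differentiable (by simp)) (p + t • (y - p))).hasFDerivAt.comp_hasDerivAt t h1
    have h3 : y - p = ∑ i, (y i - p i) • EuclideanSpace.single i (1 : ℝ) := by
      ext j
      simp [Finset.sum_apply, Pi.single_apply]
    have h4 := congrArg (fderiv ℝ F (p + t • (y - p))) h3
    simp only [map_sum, map_smul, Complex.real_smul] at h4
    rw [← h4]
    exact h2
  have hcont : ∀ i, Continuous fun t : ℝ => ((y i - p i : ℝ) : ℂ)
      * fderiv ℝ F (p + t • (y - p)) (EuclideanSpace.single i 1) := fun i =>
    continuous_const.mul (((ha i).continuous).comp (continuous_const.prodMk continuous_id))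
  have h4 := intervalIntegral.integral_eq_sub_of_hasDerivAt hderiv
    ((continuous_finsetSum _ fun i _ => hcont i).intervalIntegrable 0 1)
  rw [intervalIntegral.integral_finsetSum fun i _ => (hcont i).intervalIntegrable 0 1] at h4
  simp only [intervalIntegral.integral_const_mul, one_smul, zero_smul, add_zero,
    add_sub_cancel] at h4
  rw [h4, add_sub_cancel]

end Hadamard

/-! ### The gradient of a nondegenerate phase generates the maximal ideal of germs -/

section Critical

theorem exists_contDiff_eventuallyEq {E : Type*} [NormedAddCommGroup E] [InnerProductSpace ℝ E]
    {F : E → ℂ} {U : Set E} (hU : IsOpen U)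
    (hF : ∀ y ∈ U, ContDiffAt ℝ ∞ F y) {p : E} (hp : p ∈ U) :
    ∃ G : E → ℂ, ContDiff ℝ ∞ G ∧ G =ᶠ[𝓝 p] F := by
  obtain ⟨ε, hε, hball⟩ := Metric.nhds_basis_closedBall.mem_iff.1 (hU.mem_nhds hp)
  let χ : ContDiffBump p := ⟨ε / 2, ε, half_pos hε, half_lt_self hε⟩
  refine ⟨fun y => χ y • F y, contDiff_iff_contDiffAt.2 fun y => ?_, ?_⟩
  · by_cases hy : y ∈ U
    · exact χ.contDiffAt.smul (hF y hy)
    · have h1 : ∀ᶠ z in 𝓝 y, χ z • F z = 0 := by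
        filter_upwards [Metric.isClosed_closedBall.isOpen_compl.mem_nhds
          fun h : y ∈ Metric.closedBall p ε => hy (hball h)] with z hz
        have h2 : ε < dist z p := not_le.1 fun h => hz h
        rw [χ.zero_of_le_dist h2.le, zero_smul]
      exact contDiffAt_const.congr_of_eventuallyEq h1
  · filter_upwards [χ.eventuallyEq_one] with y hy
    rw [hy, Pi.one_apply, one_smul]

variable {n : ℕ} {M : Type*} [TopologicalSpace M] [ChartedSpace (EuclideanSpace ℝ (Fin n)) M]
  [IsManifold (𝓡 n) ∞ M] [T2Space M]

theorem exists_smoothFun_eq_comp_chart (x₀ : M) {G : EuclideanSpace ℝ (Fin n) → ℂ}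
    (hG : ContDiff ℝ ∞ G) :
    ∃ f : SmoothFun n M, ∀ x ∈ frameDomain n x₀, (f : M → ℂ) x = G (extChartAt (𝓡 n) x₀ x) :=
  mul_smooth_of_source (g := fun x => G (extChartAt (𝓡 n) x₀ x))
    (hG.contMDiff.comp_contMDiffOn contMDiffOn_extChartAt)

theorem exists_coordinates (x₀ : M) : ∃ ξ : Fin n → SmoothFun n M,
    (∀ j, (ξ j : M → ℂ) x₀ = 0) ∧
    ∀ f : SmoothFun n M, ∃ h : Fin n → SmoothFun n M,
      f - (algebraMap ℂ (SmoothFun n M) ((f : M → ℂ) x₀) + ∑ j, ξ j * h j) ∈ germIdeal n x₀ := by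
  choose ξ hξ using fun j => exists_smoothFun_eq_comp_chart x₀
    (G := fun y : EuclideanSpace ℝ (Fin n) => ((y j - extChartAt (𝓡 n) x₀ x₀ j : ℝ) : ℂ))
    (Complex.ofRealCLM.contDiff.comp (ContDiff.sub (by fun_prop) contDiff_const))
  refine ⟨ξ, fun j => by rw [hξ j _ (mem_frameDomain n x₀), sub_self, Complex.ofReal_zero],
    fun f => ?_⟩
  obtain ⟨F, hF, hFf⟩ := exists_contDiff_eventuallyEq (isOpen_extChartAt_target x₀)
    (fun y hy => contDiffAt_inChart x₀ f hy) (mem_extChartAt_target (I := 𝓡 n) x₀)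
  obtain ⟨h, hh, hFh⟩ := exists_hadamard hF (extChartAt (𝓡 n) x₀ x₀)
  choose H hH using fun j => exists_smoothFun_eq_comp_chart x₀ (hh j)
  refine ⟨H, sub_mem_germIdeal.2 ?_⟩
  filter_upwards [frameDomain_mem_nhds n x₀,
    (continuousAt_extChartAt x₀).eventually hFf] with x hx h1
  have hs : ∀ {z}, z ∈ frameDomain n x₀ → z ∈ (extChartAt (𝓡 n) x₀).source := fun hz => by
    simpa using frameDomain_subset x₀ hz
  rw [inChart_extChartAt (hs hx), hFh] at h1
  rw [← h1, hFf.self_of_nhds, inChart_extChartAt (hs (mem_frameDomain n x₀))]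
  change _ = (f : M → ℂ) x₀ + ((∑ j, ξ j * H j : SmoothFun n M) : M → ℂ) x
  rw [smoothFun_sum_apply]
  congr 1
  refine Finset.sum_congr rfl fun j _ => ?_
  change _ = (ξ j : M → ℂ) x * (H j : M → ℂ) x
  rw [hξ j x hx, hH j x hx]

/-- At a critical point the gradient is a matrix `A` applied to the coordinates. Nondegeneracy makes
`A` invertible near `x₀`, so the coordinates, and with them every germ vanishing at `x₀`, are
combinations of the gradient. -/
theorem exists_eq_sum_frame_mul {x₀ : M} {ψ : SmoothFun n M}
    (h1 : ∀ i, (vfApply (frame x₀ i) ψ : M → ℂ) x₀ = 0)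
    (h2 : IsUnit (Matrix.of fun i j =>
      (vfApply (frame x₀ i) (vfApply (frame x₀ j) ψ) : M → ℂ) x₀).det) (f : SmoothFun n M) :
    ∃ h : Fin n → SmoothFun n M, f - (algebraMap ℂ (SmoothFun n M) ((f : M → ℂ) x₀)
      + ∑ k, vfApply (frame x₀ k) ψ * h k) ∈ germIdeal n x₀ := by
  obtain ⟨ξ, hξ, hξh⟩ := exists_coordinates (n := n) x₀
  choose A hA using fun k => hξh (vfApply (frame x₀ k) ψ)
  simp only [h1, map_zero, zero_add] at hA
  -- Differentiate `∂ₖψ = ∑ ξⱼ Aₖⱼ` at `x₀`, where the `ξⱼ` vanish; invertibility of the Hessian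
  -- then passes to `A(x₀)`.
  have h3 : Matrix.of (fun i j => (vfApply (frame x₀ i) (vfApply (frame x₀ j) ψ) : M → ℂ) x₀)
      = Matrix.of (fun i j => (vfApply (frame x₀ i) (ξ j) : M → ℂ) x₀)
        * (Matrix.of fun k j => (A k j : M → ℂ) x₀).transpose := by
    ext i k
    rw [Matrix.of_apply, Matrix.mul_apply,
      vfApply_congr (n := n) (frame x₀ i) (sub_mem_germIdeal.1 (hA k)),
      map_sum, smoothFun_sum_apply]
    refine Finset.sum_congr rfl fun j _ => ?_
    rw [vfApply_mul, Matrix.transpose_apply, Matrix.of_apply, Matrix.of_apply]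
    change (ξ j : M → ℂ) x₀ * _ + (A k j : M → ℂ) x₀ * _ = _
    rw [hξ, zero_mul, zero_add, mul_comm]
  have h4 : ((Matrix.of A).det : M → ℂ) x₀ ≠ 0 := by
    have h5 : ((Matrix.of A).det : M → ℂ) x₀ = (Matrix.of fun k j => (A k j : M → ℂ) x₀).det :=
      RingHom.map_det (evalAt (n := n) x₀).toRingHom (Matrix.of A)
    rw [h3, Matrix.det_mul, Matrix.det_transpose, ← h5] at h2
    exact right_ne_zero_of_mul h2.ne_zero
  obtain ⟨d, hd⟩ := exists_local_inverse h4
  have hd : (Matrix.of A).det * d - 1 ∈ germIdeal n x₀ := sub_mem_germIdeal.2 hd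
  obtain ⟨g, hg⟩ := hξh f
  -- Cramer's rule, with `d` a local inverse of the determinant.
  have h6 : ∀ j, ∑ k, (d * (Matrix.of A).adjugate j k) * ∑ l, ξ l * A k l
      = (Matrix.of A).det * d * ξ j := by
    intro j
    have h7 : ∀ l, ∑ k, (Matrix.of A).adjugate j k * A k l
        = if j = l then (Matrix.of A).det else 0 := fun l => by
      have := congrFun (congrFun (Matrix.adjugate_mul (Matrix.of A)) j) l
      rw [Matrix.mul_apply, Matrix.smul_apply, Matrix.one_apply, smul_eq_mul, mul_ite, mul_one,
        mul_zero] at this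
      exact this
    calc _ = ∑ l, d * ξ l * ∑ k, (Matrix.of A).adjugate j k * A k l := by
          simp only [Finset.mul_sum]
          rw [Finset.sum_comm]
          exact Finset.sum_congr rfl fun l _ => Finset.sum_congr rfl fun k _ => by ring
      _ = _ := by
          simp only [h7, mul_ite, mul_zero, Finset.sum_ite_eq, Finset.mem_univ, if_true]
          ring
  refine ⟨fun k => ∑ j, (d * (Matrix.of A).adjugate j k) * g j, ?_⟩
  have h8 : f - (algebraMap ℂ (SmoothFun n M) ((f : M → ℂ) x₀)
      + ∑ k, vfApply (frame x₀ k) ψ * ∑ j, (d * (Matrix.of A).adjugate j k) * g j)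
      = (f - (algebraMap ℂ (SmoothFun n M) ((f : M → ℂ) x₀) + ∑ j, ξ j * g j))
        - ∑ k, (∑ j, (d * (Matrix.of A).adjugate j k) * g j)
            * (vfApply (frame x₀ k) ψ - ∑ l, ξ l * A k l)
        - ∑ j, (ξ j * g j) * ((Matrix.of A).det * d - 1) := by
    have h9 : ∑ k, (∑ j, (d * (Matrix.of A).adjugate j k) * g j) * ∑ l, ξ l * A k l
        = ∑ j, (ξ j * g j) * ((Matrix.of A).det * d) := by
      calc _ = ∑ j, g j * ∑ k, (d * (Matrix.of A).adjugate j k) * ∑ l, ξ l * A k l := by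
            simp only [Finset.sum_mul]
            rw [Finset.sum_comm]
            refine Finset.sum_congr rfl fun j _ => ?_
            rw [Finset.mul_sum]
            exact Finset.sum_congr rfl fun k _ => by ring
        _ = _ := Finset.sum_congr rfl fun j _ => by rw [h6]; ring
    simp only [mul_sub, mul_one, Finset.sum_sub_distrib]
    rw [h9]
    have h10 : ∑ k, vfApply (frame x₀ k) ψ * ∑ j, (d * (Matrix.of A).adjugate j k) * g j
        = ∑ k, (∑ j, (d * (Matrix.of A).adjugate j k) * g j) * vfApply (frame x₀ k) ψ :=
      Finset.sum_congr rfl fun k _ => mul_comm _ _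
    rw [h10]
    abel
  rw [h8]
  exact Ideal.sub_mem _ (Ideal.sub_mem _ hg
    (Ideal.sum_mem _ fun k _ => Ideal.mul_mem_left _ _ (hA k)))
    (Ideal.sum_mem _ fun j _ => Ideal.mul_mem_left _ _ hd)

end Critical

/-! ### Uniqueness up to a constant factor -/

section Uniqueness

section
variable {A : Type*} [CommRing A] [Algebra ℂ A]

/-- Every `ν`-linear functional has components. This is needed because a combination of FOIs with a
coefficient in `ℂ[[ν]]` is not formed componentwise. -/
theorem exists_seriesAct_eq (T : PowerSeries A →ₗ[ℂ] PowerSeries ℂ)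
    (hT : ∀ F, T (PowerSeries.X * F) = PowerSeries.X * T F) :
    ∃ L : ℕ → A →ₗ[ℂ] ℂ, (∀ r f, L r f = PowerSeries.coeff r (T (PowerSeries.C f))) ∧
      ∀ F, seriesAct L F = T F := by
  have hC : ∀ (c : ℂ) (f : A), PowerSeries.C (c • f) = c • PowerSeries.C f := fun c f => by
    ext1 k
    rw [PowerSeries.coeff_smul, PowerSeries.coeff_C, PowerSeries.coeff_C]
    split_ifs <;> simp
  let L : ℕ → A →ₗ[ℂ] ℂ := fun r =>
    { toFun := fun f => PowerSeries.coeff r (T (PowerSeries.C f))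
      map_add' := fun f g => by rw [map_add, map_add, map_add]
      map_smul' := fun c f => by rw [hC, map_smul, PowerSeries.coeff_smul]; rfl }
  refine ⟨L, fun r f => rfl, fun F => ?_⟩
  have h : ∀ F, T F = T (PowerSeries.C (PowerSeries.coeff 0 F)) + PowerSeries.X * T (shift F) :=
    fun F => by conv_lhs => rw [eq_C_add_X_mul_shift F, map_add, hT]
  ext1 k
  induction k generalizing F with
  | zero =>
    rw [seriesAct_eq, h F, map_add, map_add, coeff_seriesAct_C, PowerSeries.coeff_zero_X_mul,
      PowerSeries.coeff_zero_X_mul]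
    rfl
  | succ k ih =>
    rw [seriesAct_eq, h F, map_add, map_add, coeff_seriesAct_C, PowerSeries.coeff_succ_X_mul,
      PowerSeries.coeff_succ_X_mul, ih]
    rfl

theorem coeff_seriesAct_of_lt {L : ℕ → A →ₗ[ℂ] ℂ} {r : ℕ} (h : ∀ a < r, L a = 0)
    (F : PowerSeries A) :
    PowerSeries.coeff r (seriesAct L F) = L r (PowerSeries.coeff 0 F) := by
  rw [coeff_seriesAct, Finset.sum_eq_single (r, 0)]
  · rintro ⟨a, b⟩ hp hb
    have hp : a + b = r := by simpa using hp
    have hab : a < r := by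
      rcases Nat.eq_zero_or_pos b with rfl | hb0
      · exact absurd (by rw [← hp, add_zero]) hb
      · omega
    rw [h a hab, LinearMap.zero_apply]
  · simp

theorem seriesAct_smul (c : ℂ) (L : ℕ → A →ₗ[ℂ] ℂ) (F : PowerSeries A) :
    seriesAct (c • L) F = c • seriesAct L F := by
  ext1 k
  rw [PowerSeries.coeff_smul, coeff_seriesAct, coeff_seriesAct, Finset.smul_sum]
  rfl

end

variable {n : ℕ} {M : Type*} [TopologicalSpace M] [ChartedSpace (EuclideanSpace ℝ (Fin n)) M]

theorem IsPointDistribution.smul {x₀ : M} {L : SmoothFun n M →ₗ[ℂ] ℂ}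
    (h : IsPointDistribution x₀ L) (c : ℂ) : IsPointDistribution x₀ (c • L) := by
  obtain ⟨S, N, C, hS, hS', hC⟩ := h.continuous
  refine ⟨fun f hf => by rw [LinearMap.smul_apply, h.support f hf, smul_zero],
    S, N, ‖c‖ * C, hS, hS', fun f B hB0 hB => ?_⟩
  rw [LinearMap.smul_apply, norm_smul, mul_assoc]
  exact mul_le_mul_of_nonneg_left (hC f B hB0 hB) (norm_nonneg c)

variable [IsManifold (𝓡 n) ∞ M]

theorem IsStrongFOI.smul {x₀ : M} {φ : LaurentSeries (SmoothFun n M)} (hφ : IsFormalPhase x₀ φ)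
    {ρ : ℕ → TopForm n M} {L : FormalFunctional n M} (h : IsStrongFOI x₀ φ ρ L) {c : ℂ}
    (hc : c ≠ 0) : IsStrongFOI x₀ φ ρ (c • L) := by
  obtain ⟨h1, h2, h3, h4⟩ := (isStrongFOI_iff hφ ρ L).1 h
  refine (isStrongFOI_iff hφ ρ _).2 ⟨fun r => (h1 r).smul c, smul_ne_zero hc h2,
    fun v g hg F => ?_, fun g hg F => ?_⟩
  · rw [seriesAct_smul, h3 v g hg, smul_zero]
  · rw [seriesAct_smul, seriesAct_smul, ← h4 g hg, ← mul_smul_comm,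
      Derivation.map_smul]

variable [T2Space M]

theorem eq_zero_of_integration_by_parts {x₀ : M} {φ : LaurentSeries (SmoothFun n M)}
    (hφ : IsFormalPhase x₀ φ) {L : FormalFunctional n M}
    (hL : ∀ r, ∀ f ∈ germIdeal n x₀, L r f = 0)
    (hibp : ∀ i, ∃ g, ∀ F, seriesAct L (PowerSeries.X * vfSeries (frame x₀ i) F
      + (vfSeries (frame x₀ i) (phaseSeries φ) + PowerSeries.X * g) * F) = 0)
    (h1 : seriesAct L 1 = 0) (r : ℕ) : L r = 0 := by
  induction r using Nat.strong_induction_on with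
  | _ r ih =>
    have h2 : ∀ i f, L r (vfApply (frame x₀ i) (φ.coeff (-1)) * f) = 0 := by
      intro i f
      obtain ⟨g, hg⟩ := hibp i
      -- With the earlier components zero, the coefficient at `ν^r` sees only the `ν⁰` part of the
      -- argument, which is `(∂ᵢφ₋₁) f`.
      have h3 := congrArg (PowerSeries.coeff r) (hg (PowerSeries.C f))
      rw [coeff_seriesAct_of_lt ih, map_zero, map_add, PowerSeries.coeff_zero_X_mul, zero_add,
        PowerSeries.coeff_mul_C, map_add, PowerSeries.coeff_zero_X_mul, add_zero, coeff_vfSeries,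
        coeff_zero_phaseSeries] at h3
      exact h3
    have h4 : L r 1 = 0 := by
      rw [← coeff_seriesAct_C L, map_one, h1, map_zero]
    ext f
    obtain ⟨h, hh⟩ := exists_eq_sum_frame_mul (ψ := φ.coeff (-1)) (x₀ := x₀)
      (fun i => by rw [vfApply_apply, hφ.critical.1]; rfl)
      (by
        convert hφ.critical.2 using 2
        ext i j
        exact vfApply_frame_frame (mem_frameDomain n x₀) i j _) f
    have h5 := hL r _ hh
    rw [map_sub, map_add, map_sum, Finset.sum_eq_zero fun i _ => h2 i _, add_zero, sub_eq_zero,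
      Algebra.algebraMap_eq_smul_one, map_smul, h4, smul_zero] at h5
    rw [h5, LinearMap.zero_apply]

theorem IsStrongFOI.exists_eq_smul {x₀ : M} {φ : LaurentSeries (SmoothFun n M)}
    (hφ : IsFormalPhase x₀ φ) {ρ : ℕ → TopForm n M} (hρ : (ρ 0).form x₀ ≠ 0)
    {L L' : FormalFunctional n M} (h : IsStrongFOI x₀ φ ρ L) (h' : IsStrongFOI x₀ φ ρ L')
    (hL : L 0 1 ≠ 0) : ∃ c : ℂ, c ≠ 0 ∧ L' = c • L := by
  have h01 := h'.leading_ne_zero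
  obtain ⟨h1, -, h3, h4⟩ := (isStrongFOI_iff hφ ρ L).1 h
  obtain ⟨h1', -, h3', h4'⟩ := (isStrongFOI_iff hφ ρ L').1 h'
  have hcoeff : PowerSeries.coeff 0 (seriesAct L 1) = L 0 1 := by
    have h5 := coeff_seriesAct_C L 1 0
    rwa [map_one PowerSeries.C] at h5
  have hinv : seriesAct L 1 * (seriesAct L 1)⁻¹ = 1 := by
    refine PowerSeries.mul_inv_cancel _ ?_
    rw [← PowerSeries.coeff_zero_eq_constantCoeff_apply, hcoeff]
    exact hL
  have hne : seriesAct L 1 ≠ 0 := fun h0 => hL (by rw [← hcoeff, h0, map_zero])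
  -- The ratio of the values on `1`; subtracting `c` times the first functional leaves one that
  -- integrates by parts and vanishes on `1`, hence is zero.
  let c : PowerSeries ℂ := seriesAct L' 1 * (seriesAct L 1)⁻¹
  have hc1 : c * seriesAct L 1 = seriesAct L' 1 := by
    rw [mul_assoc, mul_comm _ (seriesAct L 1), hinv, mul_one]
  obtain ⟨K, hK, hKF⟩ := exists_seriesAct_eq (seriesAct L' - LinearMap.mulLeft ℂ c ∘ₗ seriesAct L)
    (fun F => by
      simp only [LinearMap.sub_apply, LinearMap.comp_apply, LinearMap.mulLeft_apply,
        seriesAct_X_mul]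
      ring)
  have hKF' : ∀ F, seriesAct K F = seriesAct L' F - c * seriesAct L F := hKF
  have hK0 : ∀ r, K r = 0 := by
    refine eq_zero_of_integration_by_parts hφ (fun r f hf => ?_) (fun i => ?_) ?_
    · rw [← coeff_seriesAct_C K, hKF']
      have h5 : seriesAct L' (PowerSeries.C f) = 0 := by
        ext1 k
        rw [coeff_seriesAct_C, (h1' k).support f hf, map_zero]
      have h6 : seriesAct L (PowerSeries.C f) = 0 := by
        ext1 k
        rw [coeff_seriesAct_C, (h1 k).support f hf, map_zero]
      rw [h5, h6, mul_zero, sub_zero, map_zero]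
    · obtain ⟨g, hg⟩ := exists_isDivergence_frame hρ i
      exact ⟨g, fun F => by rw [hKF', h3 _ g hg, h3' _ g hg, mul_zero, sub_zero]⟩
    · rw [hKF', hc1, sub_self]
  have hL' : ∀ F, seriesAct L' F = c * seriesAct L F := fun F => by
    rw [← sub_eq_zero, ← hKF']
    ext1 k
    rw [coeff_seriesAct, Finset.sum_eq_zero fun p _ => by rw [hK0, LinearMap.zero_apply], map_zero]
  obtain ⟨g, hg⟩ := exists_isLogDerivative hρ
  have h7 := h4' g hg 1
  rw [hL', hL', ← h4 g hg, Derivation.leibniz, smul_eq_mul, smul_eq_mul] at h7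
  -- Comparing the differentiation identities at `1`, the Leibniz rule leaves only the term with the
  -- derivative of `c`.
  have h8 : PowerSeries.X ^ 2 * (seriesAct L 1 * PowerSeries.derivative ℂ c) = 0 := by
    linear_combination h7
  have h9 : PowerSeries.derivative ℂ c = 0 := by
    rcases mul_eq_zero.1 h8 with h0 | h0
    · exact absurd h0 (pow_ne_zero 2 PowerSeries.X_ne_zero)
    · exact (mul_eq_zero.1 h0).resolve_left hne
  have h10 : c = PowerSeries.C (PowerSeries.coeff 0 c) := by
    ext1 k
    cases k with
    | zero => rw [PowerSeries.coeff_C, if_pos rfl]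
    | succ k =>
      have := congrArg (PowerSeries.coeff k) h9
      rw [PowerSeries.coeff_derivative, map_zero] at this
      rw [PowerSeries.coeff_C, if_neg (Nat.succ_ne_zero k)]
      exact (mul_eq_zero.1 this).resolve_right (Nat.cast_add_one_ne_zero k)
  have h11 : L' = PowerSeries.coeff 0 c • L := by
    funext r
    ext f
    rw [← coeff_seriesAct_C L', hL', h10, PowerSeries.coeff_C_mul, coeff_seriesAct_C,
      PowerSeries.coeff_C, if_pos rfl]
    rfl
  refine ⟨_, fun h0 => h01 ?_, h11⟩
  rw [h11, h0, zero_smul, Pi.zero_apply]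

end Uniqueness

/-! ### Recovering the jet of the phase -/

section Jets

variable {n : ℕ} {M : Type*} [TopologicalSpace M] [ChartedSpace (EuclideanSpace ℝ (Fin n)) M]
  [IsManifold (𝓡 n) ∞ M]

theorem vfSeries_sub (v : SmoothVF n M) (F G : PowerSeries (SmoothFun n M)) :
    vfSeries v (F - G) = vfSeries v F - vfSeries v G := by
  ext1 k
  simp

variable [T2Space M]

theorem taylor_der {A : Type*} [CommRing A] [Algebra ℂ A] (K : FormalFrame n A) {f : A}
    (hf : taylor K f = 0) (i : Fin n) : taylor K (K.der i f) = 0 := by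
  have h := seriesDer_taylor K i f
  rw [hf, map_zero] at h
  exact (mul_eq_zero.1 h.symm).resolve_left PowerSeries.X_ne_zero

/-- A zero Taylor series is inherited by frame derivatives (`taylor_der`), so the induction on the
order applies to each `∂ᵢ f`. -/
theorem jetVanishes_of_taylor_eq_zero {x₀ : M} {f : SmoothFun n M}
    (hf : taylor (pointFrame x₀) f = 0) : JetVanishes x₀ f := by
  intro m
  induction m generalizing f with
  | zero =>
    ext v
    have h := congrArg (PowerSeries.coeff 0) hf
    rw [coeff_taylor, taylorCoeff_zero, map_zero, map_eq_zero_iff _ (MvPolynomial.C_injective _ _)]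
      at h
    rw [iteratedFDeriv_zero_apply, inChart_extChartAt (mem_extChartAt_source x₀)]
    exact h
  | succ m ih =>
    have hD : ContDiffAt ℝ ∞ (fderiv ℝ (inChart (n := n) x₀ f)) (extChartAt (𝓡 n) x₀ x₀) :=
      (contDiffAt_inChart x₀ f (mem_extChartAt_target x₀)).fderiv_right (by simp)
    ext v
    rw [iteratedFDeriv_succ_apply_right]
    suffices h : ∀ w, iteratedFDeriv ℝ m (fderiv ℝ (inChart (n := n) x₀ f))
        (extChartAt (𝓡 n) x₀ x₀) w = 0 by
      rw [h]
      rfl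
    intro w
    refine ContinuousLinearMap.coe_injective ((stdBasis n).ext fun i => ?_)
    have h1 := ih (taylor_der (pointFrame x₀) hf i)
    have h2 := inChart_frame_eventuallyEq (mem_frameDomain n x₀) i f
    have h3 : inChart (n := n) x₀ ((pointFrame x₀).der i f) = inChart x₀ (vfApply (frame x₀ i) f) :=
      rfl
    rw [h3, (h2.iteratedFDeriv ℝ m).self_of_nhds] at h1
    have h4 : stdBasis n i = EuclideanSpace.single i (1 : ℝ) := by simp [stdBasis]
    rw [h4]
    have h5 := (ContinuousLinearMap.apply ℝ ℂ
      (EuclideanSpace.single i (1 : ℝ))).iteratedFDeriv_comp_left hD (natCast_le_infty m)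
    exact (congrArg (fun T => T w) (h1.symm.trans h5)).symm

/-- The series `H` all of whose multiples are annihilated form an ideal, stable under the frame by
integration by parts. The Dirac leading term makes `H₀` and all its derivatives vanish at `x₀`; as
flat functions are killed, `H₀` can be dropped and `H` divided by `ν`. -/
theorem taylor_coeff_eq_zero_of_seriesAct {x₀ : M} {Φ : PowerSeries (SmoothFun n M)}
    {L : FormalFunctional n M} {c : ℂ} (hc : c ≠ 0) (h0 : L 0 = c • dirac x₀)
    (hL : ∀ r f, taylor (pointFrame x₀) f = 0 → L r f = 0)
    (hibp : ∀ i, ∃ g, ∀ F, seriesAct L (PowerSeries.X * vfSeries (frame x₀ i) F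
      + (vfSeries (frame x₀ i) Φ + PowerSeries.X * g) * F) = 0)
    {H : PowerSeries (SmoothFun n M)} (hH : ∀ F, seriesAct L (H * F) = 0) (k : ℕ) :
    taylor (pointFrame x₀) (PowerSeries.coeff k H) = 0 := by
  have hzero : ∀ H : PowerSeries (SmoothFun n M), (∀ F, seriesAct L (H * F) = 0) →
      taylor (pointFrame x₀) (PowerSeries.coeff 0 H) = 0 := by
    intro H hH
    ext1 d
    rw [coeff_taylor, map_zero]
    induction d generalizing H with
    | zero =>
      have h1 := congrArg (PowerSeries.coeff 0) (hH 1)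
      rw [mul_one, coeff_seriesAct_of_lt (by simp), h0, map_zero] at h1
      rw [taylorCoeff_zero]
      exact (congrArg _ ((mul_eq_zero.1 h1).resolve_left hc)).trans (map_zero _)
    | succ d ih =>
      rw [taylorCoeff_succ, Finset.sum_eq_zero fun i _ => ?_, smul_zero]
      have h1 := ih (vfSeries (frame x₀ i) H) fun F => ?_
      · rw [coeff_vfSeries] at h1
        exact (congrArg _ h1).trans (mul_zero _)
      · obtain ⟨g, hg⟩ := hibp i
        have h2 := hg (H * F)
        -- In integration by parts for `H F`, all terms except the one with `∂ᵢH` are multiples of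
        -- `H` and are annihilated.
        have h3 : PowerSeries.X * vfSeries (frame x₀ i) (H * F)
            + (vfSeries (frame x₀ i) Φ + PowerSeries.X * g) * (H * F)
            = PowerSeries.X * (vfSeries (frame x₀ i) H * F)
              + H * (PowerSeries.X * vfSeries (frame x₀ i) F
                + (vfSeries (frame x₀ i) Φ + PowerSeries.X * g) * F) := by
          have h4 : vfSeries (frame x₀ i) (H * F)
              = H * vfSeries (frame x₀ i) F + F * vfSeries (frame x₀ i) H := by
            rw [vfSeries_eq, vfSeries_eq, vfSeries_eq, Derivation.leibniz, smul_eq_mul, smul_eq_mul]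
          rw [h4]
          ring
        rw [h3, map_add, hH, add_zero, seriesAct_X_mul] at h2
        exact (mul_eq_zero.1 h2).resolve_left PowerSeries.X_ne_zero
  induction k generalizing H with
  | zero => exact hzero H hH
  | succ k ih =>
    have h1 := ih (H := shift H) fun F => ?_
    · rwa [shift, PowerSeries.coeff_mk] at h1
    · have h2 := hH F
      rw [eq_C_add_X_mul_shift H, add_mul, map_add, mul_assoc, seriesAct_X_mul] at h2
      have h3 : seriesAct L (PowerSeries.C (PowerSeries.coeff 0 H) * F) = 0 := by
        ext1 r
        rw [coeff_seriesAct, map_zero]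
        refine Finset.sum_eq_zero fun p _ => hL _ _ ?_
        rw [PowerSeries.coeff_C_mul, taylor_mul, hzero H hH, zero_mul]
      rw [h3, zero_add] at h2
      exact (mul_eq_zero.1 h2).resolve_left PowerSeries.X_ne_zero

theorem IsStrongFOI.exists_jetIsConst {x₀ : M} {φ φ' : LaurentSeries (SmoothFun n M)}
    (hφ : IsFormalPhase x₀ φ) (hφ' : IsFormalPhase x₀ φ') {ρ : ℕ → TopForm n M}
    (hρ : (ρ 0).form x₀ ≠ 0) {L : FormalFunctional n M} (h : IsStrongFOI x₀ φ ρ L)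
    (h' : IsStrongFOI x₀ φ' ρ L) {c : ℂ} (hc : c ≠ 0) (h0 : L 0 = c • dirac x₀)
    (hL : ∀ r f, taylor (pointFrame x₀) f = 0 → L r f = 0) : ∃ c, JetIsConst x₀ (φ - φ') c := by
  obtain ⟨-, -, h3, h4⟩ := (isStrongFOI_iff hφ ρ L).1 h
  obtain ⟨-, -, h3', h4'⟩ := (isStrongFOI_iff hφ' ρ L).1 h'
  let G : PowerSeries (SmoothFun n M) := phaseSeries φ - phaseSeries φ'
  have hibp : ∀ i, ∃ g, ∀ F, seriesAct L (PowerSeries.X * vfSeries (frame x₀ i) F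
      + (vfSeries (frame x₀ i) (phaseSeries φ) + PowerSeries.X * g) * F) = 0 := fun i => by
    obtain ⟨g, hg⟩ := exists_isDivergence_frame hρ i
    exact ⟨g, h3 _ g hg⟩
  have hvf : ∀ i F, seriesAct L (vfSeries (frame x₀ i) G * F) = 0 := fun i F => by
    obtain ⟨g, hg⟩ := exists_isDivergence_frame hρ i
    have h5 := congrArg₂ (· - ·) (h3 _ g hg F) (h3' _ g hg F)
    simp only [← map_sub, sub_self] at h5
    rw [← h5, vfSeries_sub]
    congr 1
    ring
  have hder : ∀ F, seriesAct L
      ((PowerSeries.X * PowerSeries.derivative (SmoothFun n M) G - G) * F) = 0 := fun F => by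
    obtain ⟨g, hg⟩ := exists_isLogDerivative hρ
    have h5 := (h4 g hg F).symm.trans (h4' g hg F)
    rw [← sub_eq_zero, ← map_sub] at h5
    rw [← h5, map_sub]
    congr 1
    ring
  have hvf' : ∀ i k, taylor (pointFrame x₀) ((pointFrame x₀).der i (PowerSeries.coeff k G)) = 0 :=
    fun i k => by
      have := taylor_coeff_eq_zero_of_seriesAct hc h0 hL hibp (hvf i) k
      rwa [coeff_vfSeries] at this
  have hflat : ∀ k, k ≠ 1 → taylor (pointFrame x₀) (PowerSeries.coeff k G) = 0 := by
    intro k hk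
    have h5 := taylor_coeff_eq_zero_of_seriesAct hc h0 hL hibp hder k
    -- The operator `ν d/dν - 1` acts on the coefficient at `ν^k` as `k - 1`, so it loses
    -- information only at `k = 1`.
    have h6 : PowerSeries.coeff k (PowerSeries.X * PowerSeries.derivative (SmoothFun n M) G - G)
        = algebraMap ℂ (SmoothFun n M) (k - 1) * PowerSeries.coeff k G := by
      rw [← eulerSeries_apply, map_sub, coeff_eulerSeries,
        map_sub (algebraMap ℂ (SmoothFun n M)), map_natCast,
        map_one]
      ring
    rw [h6, taylor_mul, taylor_algebraMap] at h5
    refine (mul_eq_zero.1 h5).resolve_left fun h7 => ?_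
    rw [map_eq_zero_iff _ PowerSeries.C_injective,
      map_eq_zero_iff _ (MvPolynomial.C_injective _ _), sub_eq_zero] at h7
    exact hk (by exact_mod_cast h7)
  -- Index `1` in `G = ν(φ - φ')` is index `0` in `φ - φ'`, where the constant of `JetIsConst` sits.
  let a : ℂ := ((PowerSeries.coeff 1 G : SmoothFun n M) : M → ℂ) x₀
  have hone : taylor (pointFrame x₀)
      (PowerSeries.coeff 1 G - algebraMap ℂ (SmoothFun n M) a) = 0 := by
    ext1 d
    rw [coeff_taylor, map_zero]
    cases d with
    | zero =>
      rw [taylorCoeff_zero, map_sub, AlgHom.commutes]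
      exact (congrArg _ (sub_self a)).trans (map_zero _)
    | succ d =>
      rw [taylorCoeff_succ, Finset.sum_eq_zero fun i _ => ?_, smul_zero]
      have h5 := congrArg (PowerSeries.coeff d) (hvf' i 1)
      rw [coeff_taylor, map_zero] at h5
      rw [map_sub, Derivation.map_algebraMap, sub_zero, h5, mul_zero]
  have hG : ∀ k : ℕ, PowerSeries.coeff k G = (φ - φ').coeff (k - 1) := fun k => by
    rw [HahnSeries.coeff_sub, map_sub, phaseSeries, phaseSeries, PowerSeries.coeff_mk,
      PowerSeries.coeff_mk]
  refine ⟨a, fun k => jetVanishes_of_taylor_eq_zero ?_⟩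
  rw [HahnSeries.coeff_sub, HahnSeries.C_apply, HahnSeries.coeff_single]
  split_ifs with hk
  · rw [← hone, hG, hk]
    rfl
  · rw [sub_zero]
    rcases lt_or_ge k (-1) with hk1 | hk1
    · rw [HahnSeries.coeff_sub, hφ.coeff_eq_zero k hk1, hφ'.coeff_eq_zero k hk1, sub_self,
        taylor_zero]
    · obtain ⟨j, hj⟩ := Int.eq_ofNat_of_zero_le (show 0 ≤ k + 1 by omega)
      have h5 := hflat j (by omega)
      rwa [hG, show (j : ℤ) - 1 = k by omega] at h5

end Jets

end FOI

end

/-! ### Conclusion: the four statements, by comparison with the constructed FOI -/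

theorem mainTheorem1 (n : ℕ) (M : Type*) [TopologicalSpace M] [T2Space M]
    [SecondCountableTopology M] [ChartedSpace (EuclideanSpace ℝ (Fin n)) M]
    [IsManifold (𝓡 n) ∞ M] (x₀ : M)
    (φ : LaurentSeries (FOI.SmoothFun n M)) (hφ : FOI.IsFormalPhase x₀ φ)
    (ρ : ℕ → FOI.TopForm n M) (hρ : (ρ 0).form x₀ ≠ 0) :
    (∃ Λ : FOI.FormalFunctional n M, FOI.IsStrongFOI x₀ φ ρ Λ) ∧
    (∀ Λ : FOI.FormalFunctional n M, FOI.IsStrongFOI x₀ φ ρ Λ →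
      ∀ Λ' : FOI.FormalFunctional n M,
        FOI.IsStrongFOI x₀ φ ρ Λ' ↔ ∃ c : ℂ, c ≠ 0 ∧ Λ' = c • Λ) ∧
    (∃! Λ : FOI.FormalFunctional n M, FOI.IsStrongFOI x₀ φ ρ Λ ∧ Λ 0 = FOI.dirac x₀) ∧
    (∀ Λ : FOI.FormalFunctional n M, FOI.IsStrongFOI x₀ φ ρ Λ →
      ∀ φ' : LaurentSeries (FOI.SmoothFun n M), FOI.IsFormalPhase x₀ φ' →
        FOI.IsStrongFOI x₀ φ' ρ Λ → ∃ c : ℂ, FOI.JetIsConst x₀ (φ - φ') c) := by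
  obtain ⟨L, hL, ⟨a, ha, hLa⟩, hLt⟩ := FOI.exists_isStrongFOI hφ hρ
  have hone : ∀ b : ℂ, (b • FOI.dirac (n := n) x₀) 1 = b := fun b => mul_one b
  have hL1 : L 0 1 ≠ 0 := by
    rw [hLa, hone]
    exact ha
  have huniq : ∀ Λ, FOI.IsStrongFOI x₀ φ ρ Λ → ∃ c : ℂ, c ≠ 0 ∧ Λ = c • L :=
    fun Λ hΛ => hL.exists_eq_smul hφ hρ hΛ hL1
  refine ⟨⟨L, hL⟩, fun Λ hΛ Λ' => ⟨fun hΛ' => ?_, ?_⟩, ?_, fun Λ hΛ φ' hφ' hΛ' => ?_⟩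
  · obtain ⟨c, hc, rfl⟩ := huniq Λ hΛ
    obtain ⟨c', hc', rfl⟩ := huniq Λ' hΛ'
    exact ⟨c' / c, div_ne_zero hc' hc, by rw [smul_smul, div_mul_cancel₀ _ hc]⟩
  · rintro ⟨c, hc, rfl⟩
    exact hΛ.smul hφ hc
  · refine ⟨a⁻¹ • L, ⟨hL.smul hφ (inv_ne_zero ha), ?_⟩, ?_⟩
    · rw [Pi.smul_apply, hLa, smul_smul, inv_mul_cancel₀ ha, one_smul]
    · rintro Λ ⟨hΛ, hΛ0⟩
      obtain ⟨c, -, rfl⟩ := huniq Λ hΛ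
      rw [Pi.smul_apply, hLa, smul_smul] at hΛ0
      -- Evaluating the leading terms on the function `1` fixes the factor.
      have h1 := congrArg (fun T : FOI.SmoothFun n M →ₗ[ℂ] ℂ => T 1) hΛ0
      have h2 : c * a = 1 := (hone (c * a)).symm.trans h1
      rw [eq_inv_of_mul_eq_one_left h2]
  · obtain ⟨c, hc, rfl⟩ := huniq Λ hΛ
    refine hΛ.exists_jetIsConst hφ hφ' hρ hΛ' (mul_ne_zero hc ha) ?_ fun r f hf => ?_
    · rw [Pi.smul_apply, hLa, smul_smul]
    · rw [Pi.smul_apply, LinearMap.smul_apply, hLt r f hf, smul_zero]
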